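/- Let $\mathfrak P$ be the polytopal ring: the free abelian group on the combinatorial equivalence classes of (nonempty) convex polytopes, with multiplication induced by the direct product of polytopes, so that the point is the unit $1$. For a polytope $P$ define its motivic interior $$P^\circ=\sum_{f}(-1)^{\operatorname{codim} f} f\in\mathfrak P,$$ where the sum is over all nonempty faces $f$ of $P$, including $P$ itself. For a graph $\Gamma$ with vertex set $[n]=\{1,\dots,n\}$, $n\ge 1$, let $$P_\Gamma=\Big\{x\in\mathbb R^n:\ \sum_{i=1}^n x_i=3^n,\ \ \sum_{i\in S}x_i\ge 3^{|S|}\ \text{ for all nonempty } S\subsetneq[n] \text{ such that } \Gamma|_S \text{ is connected}\Big\}$$ be its graph-associahedron. For $n\ge1$ let $\mathfrak a_n$ (the associahedron) and $W_n$ (the cyclohedron) be the graph-associahedra of the path and of the cycle with $n$ vertices, respectively, where the cycle is a single vertex for $n=1$ and a single edge for $n=2$; in particular $\mathfrak a_1=W_1=1$. Put $$\alpha(x)=x+\sum_{n\ge1}\mathfrak a_n x^{n+1},\qquad \beta(x)=x-\sum_{n\ge1}\mathfrak a_n^\circ x^{n+1},\qquad W(x)=\sum_{n\ge1}W_n\frac{x^n}{n},\qquad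 W^\circ(x)=\sum_{n\ge1}W_n^\circ\frac{x^n}{n}.$$ **Theorem 6.1.** In $(\mathfrak P\otimes\mathbb Q)[[x]]$ the series $\beta$ is the compositional inverse of $\alpha$, that is, $\alpha(\beta(x))=x$ and $\beta(\alpha(x))=x$, and the generating function of the motivic interiors of the cyclohedra is $$W^\circ(x)=W(\beta(x)).$$ -/

import Mathlib

namespace PolytopeAlgebra

/-! ### Faces of convex sets -/

section Faces

variable {E : Type*} [NormedAddCommGroup E] [NormedSpace ℝ E]
variable {E' : Type*} [NormedAddCommGroup E'] [NormedSpace ℝ E']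

/-- The nonempty faces of `P`, ordered by inclusion: the nonempty subsets of `P` on which some linear
functional attains its maximum over `P`.  (The zero functional gives the face `P` itself.) -/
abbrev Face (P : Set E) : Type _ := {F : Set E // F.Nonempty ∧ IsExposed ℝ P F}

/-- `P` is the intersection of finitely many closed half-spaces. -/
def IsPolyhedron (P : Set E) : Prop :=
  ∃ s : Set ((E →L[ℝ] ℝ) × ℝ), s.Finite ∧ P = {x | ∀ c ∈ s, c.1 x ≤ c.2}

theorem IsPolyhedron.inter {P Q : Set E} (hP : IsPolyhedron P) (hQ : IsPolyhedron Q) :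
    IsPolyhedron (P ∩ Q) := by
  obtain ⟨s, hs, rfl⟩ := hP
  obtain ⟨t, ht, rfl⟩ := hQ
  refine ⟨s ∪ t, hs.union ht, ?_⟩
  ext x
  simp only [Set.mem_inter_iff, Set.mem_ofPred_eq, Set.mem_union]
  constructor
  · rintro ⟨h1, h2⟩ c (hc | hc)
    · exact h1 c hc
    · exact h2 c hc
  · exact fun h => ⟨fun c hc => h c (Or.inl hc), fun c hc => h c (Or.inr hc)⟩

theorem IsPolyhedron.halfSpace (l : E →L[ℝ] ℝ) (b : ℝ) : IsPolyhedron {x | l x ≤ b} :=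
  ⟨{(l, b)}, Set.finite_singleton _, by ext x; simp⟩

theorem IsPolyhedron.iInter {ι : Type*} [Finite ι] {P : ι → Set E}
    (h : ∀ i, IsPolyhedron (P i)) : IsPolyhedron (⋂ i, P i) := by
  choose s hs hP using h
  refine ⟨⋃ i, s i, Set.finite_iUnion hs, ?_⟩
  ext x
  simp only [Set.mem_iInter, Set.mem_iUnion, Set.mem_ofPred_eq]
  constructor
  · rintro hx c ⟨i, hc⟩
    have := hx i
    rw [hP i] at this
    exact this c hc
  · intro hx i
    rw [hP i]
    exact fun c hc => hx c ⟨i, hc⟩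

theorem IsPolyhedron.preimage {P : Set E'} (hP : IsPolyhedron P) (f : E →L[ℝ] E') :
    IsPolyhedron (f ⁻¹' P) := by
  obtain ⟨s, hs, rfl⟩ := hP
  refine ⟨(fun c : (E' →L[ℝ] ℝ) × ℝ => (c.1.comp f, c.2)) '' s, hs.image _, ?_⟩
  ext x
  constructor
  · rintro hx _ ⟨c, hc, rfl⟩
    exact hx c hc
  · exact fun hx c hc => hx _ ⟨c, hc, rfl⟩

theorem IsPolyhedron.face {P F : Set E} (hP : IsPolyhedron P) (hF : IsExposed ℝ P F)
    (hne : F.Nonempty) : IsPolyhedron F := by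
  obtain ⟨l, a, rfl⟩ := hF.eq_inter_halfSpace' hne
  have h := hP.inter (IsPolyhedron.halfSpace (-l) (-a))
  convert h using 1
  ext x
  simp

/-- A polyhedron has only finitely many faces: a face is determined by the set of those defining
inequalities that are equalities on it. -/
theorem IsPolyhedron.finite_face {P : Set E} (hP : IsPolyhedron P) : Finite (Face P) := by
  obtain ⟨s, hs, rfl⟩ := hP
  set P : Set E := {x | ∀ c ∈ s, c.1 x ≤ c.2} with hPdef
  have key : ∀ F G : Face P,
      (∀ c ∈ s, (∀ x ∈ F.1, c.1 x = c.2) → ∀ x ∈ G.1, c.1 x = c.2) → G.1 ⊆ F.1 := by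
    intro F G hFG y hy
    obtain ⟨⟨x0, hx0⟩, hexp⟩ := F.2
    obtain ⟨l, hl⟩ := hexp ⟨x0, hx0⟩
    have hyP : y ∈ P := G.2.2.subset hy
    -- a point of `F` at which only the inequalities tight on all of `F` are tight
    have hconv : Convex ℝ F.1 := by
      refine hexp.convex ?_
      intro a ha b hb u v hu hv huv c hc
      have h1 := ha c hc
      have h2 := hb c hc
      simp only [map_add, map_smul, smul_eq_mul]
      have : c.2 = u * c.2 + v * c.2 := by rw [← add_mul, huv, one_mul]
      rw [this]
      gcongr
    have hz : ∀ t : Set ((E →L[ℝ] ℝ) × ℝ), t.Finite → t ⊆ s → ∃ z ∈ F.1, ∀ c ∈ t,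
        c.1 z = c.2 → ∀ x ∈ F.1, c.1 x = c.2 := by
      intro t ht
      induction t, ht using Set.Finite.induction_on with
      | empty => exact fun _ => ⟨x0, hx0, by simp⟩
      | @insert c t hct ht ih =>
        intro hts
        obtain ⟨z, hz, hzt⟩ := ih ((Set.subset_insert _ _).trans hts)
        by_cases hc : ∀ x ∈ F.1, c.1 x = c.2
        · refine ⟨z, hz, ?_⟩
          rintro c' (rfl | hc') h
          · exact hc
          · exact hzt c' hc' h
        · push Not at hc
          obtain ⟨w, hw, hwc⟩ := hc
          refine ⟨(1 / 2 : ℝ) • z + (1 / 2 : ℝ) • w,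
            hconv hz hw (by norm_num) (by norm_num) (by norm_num), ?_⟩
          intro c' hc' h
          have h1 : c'.1 z ≤ c'.2 := hexp.subset hz c' (hts hc')
          have h2 : c'.1 w ≤ c'.2 := hexp.subset hw c' (hts hc')
          simp only [map_add, map_smul, smul_eq_mul] at h
          rcases hc' with rfl | hc'
          · exact absurd (by linarith) hwc
          · exact hzt c' hc' (by linarith)
    obtain ⟨z, hzF, hz⟩ := hz s hs subset_rfl
    have hzP : z ∈ P := hexp.subset hzF
    -- move a little from `z` away from `y`, staying inside `P`
    have hε : ∀ t : Set ((E →L[ℝ] ℝ) × ℝ), t.Finite → t ⊆ s → ∃ ε : ℝ, 0 < ε ∧ ∀ c ∈ t,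
        ε * (c.1 z - c.1 y) ≤ c.2 - c.1 z := by
      intro t ht
      induction t, ht using Set.Finite.induction_on with
      | empty => exact fun _ => ⟨1, one_pos, by simp⟩
      | @insert c t hct ht ih =>
        intro hts
        obtain ⟨ε, hε, hεt⟩ := ih ((Set.subset_insert _ _).trans hts)
        have hcs : c ∈ s := hts (Set.mem_insert _ _)
        have hδ : ∃ δ : ℝ, 0 < δ ∧ δ * (c.1 z - c.1 y) ≤ c.2 - c.1 z := by
          by_cases hc : c.1 z = c.2
          · have h1 := hz c hcs hc
            have h2 := hFG c hcs h1 y hy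
            exact ⟨1, one_pos, by rw [hc, h2]; simp⟩
          · have h1 : 0 < c.2 - c.1 z := sub_pos.2 (lt_of_le_of_ne (hzP c hcs) hc)
            refine ⟨(c.2 - c.1 z) / (|c.1 z - c.1 y| + 1), by positivity, ?_⟩
            rw [div_mul_eq_mul_div, div_le_iff₀ (by positivity)]
            gcongr
            exact (le_abs_self _).trans (by linarith)
        obtain ⟨δ, hδ, hδc⟩ := hδ
        refine ⟨min ε δ, lt_min hε hδ, ?_⟩
        have mono : ∀ (e a b : ℝ), 0 ≤ b → e * a ≤ b → 0 < min ε δ → min ε δ ≤ e →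
            min ε δ * a ≤ b := by
          intro e a b hb h h0 hle
          rcases le_total 0 a with ha | ha
          · exact (mul_le_mul_of_nonneg_right hle ha).trans h
          · exact (mul_nonpos_of_nonneg_of_nonpos h0.le ha).trans hb
        rintro c' (rfl | hc')
        · exact mono δ _ _ (sub_nonneg.2 (hzP _ hcs)) hδc (lt_min hε hδ) (min_le_right _ _)
        · exact mono ε _ _ (sub_nonneg.2 (hzP _ (hts (Or.inr hc')))) (hεt _ hc')
            (lt_min hε hδ) (min_le_left _ _)
    obtain ⟨ε, hε, hεs⟩ := hε s hs subset_rfl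
    have hmem : z + ε • (z - y) ∈ P := by
      intro c hc
      have := hεs c hc
      simp only [map_add, map_smul, map_sub, smul_eq_mul]
      linarith
    rw [hl] at hzF ⊢
    have h1 := hzF.2 _ hmem
    simp only [map_add, map_smul, map_sub, smul_eq_mul] at h1
    have h2 : l z ≤ l y := by
      by_contra hlt
      push Not at hlt
      have : 0 < ε * (l z - l y) := mul_pos hε (sub_pos.2 hlt)
      linarith
    exact ⟨hyP, fun w hw => (hzF.2 w hw).trans h2⟩
  have := hs.to_subtype
  refine Finite.of_injective (β := Set s) (fun F => {c | ∀ x ∈ F.1, c.1.1 x = c.1.2}) ?_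
  intro F G hFG
  have hFG' : ∀ c : s, (∀ x ∈ F.1, c.1.1 x = c.1.2) ↔ ∀ x ∈ G.1, c.1.1 x = c.1.2 :=
    fun c => Set.ext_iff.1 hFG c
  exact Subtype.ext (Set.Subset.antisymm
    (key G F fun c hc h => (hFG' ⟨c, hc⟩).2 h) (key F G fun c hc h => (hFG' ⟨c, hc⟩).1 h))

theorem isExposed_preimage (e : E ≃L[ℝ] E') {P F : Set E'} (h : IsExposed ℝ P F) :
    IsExposed ℝ (e ⁻¹' P) (e ⁻¹' F) := by
  rintro ⟨x, hx⟩
  obtain ⟨l, rfl⟩ := h ⟨e x, hx⟩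
  refine ⟨l.comp (e : E →L[ℝ] E'), ?_⟩
  ext y
  simp only [Set.mem_preimage, Set.mem_ofPred_eq, ContinuousLinearMap.comp_apply,
    ContinuousLinearEquiv.coe_coe]
  refine and_congr_right fun _ => ⟨fun h z hz => h _ hz, fun h z hz => ?_⟩
  simpa using h (e.symm z) (by simpa using hz)

/-- Linear isomorphisms preserve the face poset. -/
def faceCongr (e : E ≃L[ℝ] E') (P : Set E') : Face (e ⁻¹' P) ≃o Face P where
  toFun F := ⟨e.symm ⁻¹' F.1, F.2.1.preimage e.symm.surjective, by
    simpa [← Set.preimage_comp] using isExposed_preimage e.symm F.2.2⟩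
  invFun F := ⟨e ⁻¹' F.1, F.2.1.preimage e.surjective, isExposed_preimage e F.2.2⟩
  left_inv F := Subtype.ext (by simp [← Set.preimage_comp])
  right_inv F := Subtype.ext (by simp [← Set.preimage_comp])
  map_rel_iff' {F G} := Set.preimage_subset_preimage_iff (by simp)

theorem isExposed_prod {P F : Set E} {Q G : Set E'} (hF : IsExposed ℝ P F)
    (hG : IsExposed ℝ Q G) : IsExposed ℝ (P ×ˢ Q) (F ×ˢ G) := by
  rintro ⟨⟨x, y⟩, hx, hy⟩
  obtain ⟨l, rfl⟩ := hF ⟨x, hx⟩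
  obtain ⟨m, rfl⟩ := hG ⟨y, hy⟩
  refine ⟨l.comp (ContinuousLinearMap.fst ℝ E E') + m.comp (ContinuousLinearMap.snd ℝ E E'), ?_⟩
  ext ⟨u, v⟩
  simp only [Set.mem_prod, Set.mem_ofPred_eq, add_apply,
    ContinuousLinearMap.comp_apply, ContinuousLinearMap.coe_fst', ContinuousLinearMap.coe_snd',
    Prod.forall]
  constructor
  · rintro ⟨⟨hu, hu'⟩, hv, hv'⟩
    exact ⟨⟨hu, hv⟩, fun a b hab => add_le_add (hu' a hab.1) (hv' b hab.2)⟩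
  · rintro ⟨⟨hu, hv⟩, h⟩
    exact ⟨⟨hu, fun a ha => by simpa using h a v ⟨ha, hv⟩⟩,
      hv, fun b hb => by simpa using h u b ⟨hu, hb⟩⟩

theorem isExposed_of_prod {P : Set E} {Q : Set E'} {H : Set (E × E')} (hne : H.Nonempty)
    (hH : IsExposed ℝ (P ×ˢ Q) H) :
    IsExposed ℝ P (Prod.fst '' H) ∧ IsExposed ℝ Q (Prod.snd '' H) ∧
      (Prod.fst '' H) ×ˢ (Prod.snd '' H) = H := by
  obtain ⟨⟨x, y⟩, hxy⟩ := hne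
  obtain ⟨l, rfl⟩ := hH ⟨_, hxy⟩
  have split : ∀ a b, l (a, b) = l (a, 0) + l (0, b) := fun a b => by
    rw [← map_add]; simp
  have hmem : ∀ a b, (a, b) ∈ {p ∈ P ×ˢ Q | ∀ q ∈ P ×ˢ Q, l q ≤ l p} ↔
      (a ∈ P ∧ ∀ a' ∈ P, l (a', 0) ≤ l (a, 0)) ∧ (b ∈ Q ∧ ∀ b' ∈ Q, l (0, b') ≤ l (0, b)) := by
    intro a b
    simp only [Set.mem_ofPred_eq, Set.mem_prod, Prod.forall]
    constructor
    · rintro ⟨⟨ha, hb⟩, h⟩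
      refine ⟨⟨ha, fun a' ha' => ?_⟩, hb, fun b' hb' => ?_⟩
      · have := h a' b ⟨ha', hb⟩
        rw [split a' b, split a b] at this
        linarith
      · have := h a b' ⟨ha, hb'⟩
        rw [split a b', split a b] at this
        linarith
    · rintro ⟨⟨ha, ha'⟩, hb, hb'⟩
      refine ⟨⟨ha, hb⟩, fun a' b' h => ?_⟩
      rw [split a' b', split a b]
      exact add_le_add (ha' _ h.1) (hb' _ h.2)
  have hxy' := (hmem x y).1 hxy
  have h1 : Prod.fst '' {p ∈ P ×ˢ Q | ∀ q ∈ P ×ˢ Q, l q ≤ l p} =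
      {a ∈ P | ∀ a' ∈ P, l (a', 0) ≤ l (a, 0)} := by
    ext a
    constructor
    · rintro ⟨⟨a, b⟩, h, rfl⟩
      exact ((hmem a b).1 h).1
    · exact fun h => ⟨(a, y), (hmem a y).2 ⟨h, hxy'.2⟩, rfl⟩
  have h2 : Prod.snd '' {p ∈ P ×ˢ Q | ∀ q ∈ P ×ˢ Q, l q ≤ l p} =
      {b ∈ Q | ∀ b' ∈ Q, l (0, b') ≤ l (0, b)} := by
    ext b
    constructor
    · rintro ⟨⟨a, b⟩, h, rfl⟩
      exact ((hmem a b).1 h).2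
    · exact fun h => ⟨(x, b), (hmem x b).2 ⟨hxy'.1, h⟩, rfl⟩
  rw [h1, h2]
  refine ⟨fun _ => ⟨l.comp (ContinuousLinearMap.inl ℝ E E'), by simp⟩,
    fun _ => ⟨l.comp (ContinuousLinearMap.inr ℝ E E'), by simp⟩, ?_⟩
  ext ⟨a, b⟩
  exact (hmem a b).symm

/-- The nonempty faces of a product are the products of nonempty faces. -/
def faceProd (P : Set E) (Q : Set E') : Face (P ×ˢ Q) ≃o Face P × Face Q where
  toFun H := (⟨Prod.fst '' H.1, H.2.1.image _, (isExposed_of_prod H.2.1 H.2.2).1⟩,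
    ⟨Prod.snd '' H.1, H.2.1.image _, (isExposed_of_prod H.2.1 H.2.2).2.1⟩)
  invFun F := ⟨F.1.1 ×ˢ F.2.1, F.1.2.1.prod F.2.2.1, isExposed_prod F.1.2.2 F.2.2.2⟩
  left_inv H := Subtype.ext (isExposed_of_prod H.2.1 H.2.2).2.2
  right_inv F := Prod.ext (Subtype.ext (Set.fst_image_prod _ F.2.2.1))
    (Subtype.ext (Set.snd_image_prod F.1.2.1 _))
  map_rel_iff' {H K} := by
    constructor
    · rintro ⟨h1, h2⟩
      change H.1 ⊆ K.1
      rw [← (isExposed_of_prod H.2.1 H.2.2).2.2, ← (isExposed_of_prod K.2.1 K.2.2).2.2]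
      exact Set.prod_mono h1 h2
    · exact fun h => ⟨Set.image_mono h, Set.image_mono h⟩

/-- The product of two order isomorphisms. -/
def prodIso {α β γ δ : Type*} [LE α] [LE β] [LE γ] [LE δ] (e : α ≃o γ) (f : β ≃o δ) :
    α × β ≃o γ × δ where
  toEquiv := e.toEquiv.prodCongr f.toEquiv
  map_rel_iff' := and_congr e.le_iff_le f.le_iff_le

end Faces

/-! ### Convex polytopes and their combinatorial types -/

/-- A (nonempty) convex polytope in some `ℝᵐ`: a bounded intersection of finitely many closed
half-spaces. -/
structure Polytope where
  /-- the dimension `m` of the ambient space -/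
  ambient : ℕ
  /-- the underlying set of points -/
  carrier : Set (Fin ambient → ℝ)
  nonempty : carrier.Nonempty
  bounded : Bornology.IsBounded carrier
  polyhedron : IsPolyhedron carrier

namespace Polytope

/-- The dimension of a polytope is the dimension of its affine span. -/
noncomputable def dim (P : Polytope) : ℕ := Module.finrank ℝ (vectorSpan ℝ P.carrier)

/-- The set of nonempty faces of a polytope is finite. -/
noncomputable instance (P : Polytope) : Fintype (Face P.carrier) :=
  have := P.polyhedron.finite_face
  Fintype.ofFinite _

/-- A nonempty face of a polytope is a polytope. -/
def ofFace (P : Polytope) (F : Face P.carrier) : Polytope where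
  ambient := P.ambient
  carrier := F.1
  nonempty := F.2.1
  bounded := P.bounded.subset F.2.2.subset
  polyhedron := P.polyhedron.face F.2.2 F.2.1

/-- The codimension of a face `F` in `P`. -/
noncomputable def codim (P : Polytope) (F : Face P.carrier) : ℕ := P.dim - (P.ofFace F).dim

/-- The identification `ℝ^(m+n) = ℝᵐ × ℝⁿ`. -/
noncomputable def splitEquiv (m n : ℕ) :
    (Fin (m + n) → ℝ) ≃L[ℝ] (Fin m → ℝ) × (Fin n → ℝ) :=
  ((LinearEquiv.funCongrLeft ℝ ℝ (finSumFinEquiv (m := m) (n := n))).trans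
    (LinearEquiv.sumArrowLequivProdArrow (Fin m) (Fin n) ℝ ℝ)).toContinuousLinearEquiv

theorem splitEquiv_apply (m n : ℕ) (x : Fin (m + n) → ℝ) :
    splitEquiv m n x = (fun i => x (Fin.castAdd n i), fun j => x (Fin.natAdd m j)) := rfl

/-- The product polytope `P × Q ⊆ ℝᵐ × ℝⁿ = ℝ^(m+n)`. -/
noncomputable def prod (P Q : Polytope) : Polytope where
  ambient := P.ambient + Q.ambient
  carrier := splitEquiv P.ambient Q.ambient ⁻¹' (P.carrier ×ˢ Q.carrier)
  nonempty := (P.nonempty.prod Q.nonempty).preimage (splitEquiv _ _).surjective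
  bounded := by
    have h := (splitEquiv P.ambient Q.ambient).symm.lipschitz.isBounded_image
      (P.bounded.prod Q.bounded)
    rwa [ContinuousLinearEquiv.image_symm_eq_preimage] at h
  polyhedron := by
    have h1 := P.polyhedron.preimage ((ContinuousLinearMap.fst ℝ _ _).comp
      (splitEquiv P.ambient Q.ambient).toContinuousLinearMap)
    have h2 := Q.polyhedron.preimage ((ContinuousLinearMap.snd ℝ _ _).comp
      (splitEquiv P.ambient Q.ambient).toContinuousLinearMap)
    exact h1.inter h2

/-- The point, as a polytope in `ℝ⁰`. -/
def point : Polytope where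
  ambient := 0
  carrier := Set.univ
  nonempty := Set.univ_nonempty
  bounded := (Set.finite_univ).isBounded
  polyhedron := ⟨∅, Set.finite_empty, by simp⟩

/-- Two polytopes are combinatorially equivalent if their posets of (nonempty) faces are
isomorphic. -/
instance setoid : Setoid Polytope where
  r P Q := Nonempty (Face P.carrier ≃o Face Q.carrier)
  iseqv := ⟨fun _ => ⟨OrderIso.refl _⟩, fun ⟨e⟩ => ⟨e.symm⟩, fun ⟨e⟩ ⟨f⟩ => ⟨e.trans f⟩⟩

/-- The face poset of a product of polytopes. -/
noncomputable def faceProdIso (P Q : Polytope) :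
    Face (P.prod Q).carrier ≃o Face P.carrier × Face Q.carrier :=
  (faceCongr (splitEquiv P.ambient Q.ambient) (P.carrier ×ˢ Q.carrier)).trans
    (faceProd P.carrier Q.carrier)

instance : Unique (Face point.carrier) where
  default := ⟨Set.univ, Set.univ_nonempty, IsExposed.refl _⟩
  uniq F := Subtype.ext (by
    have : Subsingleton (Fin point.ambient → ℝ) := inferInstanceAs (Subsingleton (Fin 0 → ℝ))
    exact Subsingleton.eq_univ_of_nonempty F.2.1)

end Polytope

/-- Combinatorial polytopes: convex polytopes up to combinatorial equivalence. -/
def CombPolytope : Type := Quotient Polytope.setoid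

namespace CombPolytope

/-- The combinatorial type of a polytope. -/
def mk (P : Polytope) : CombPolytope := Quotient.mk _ P

/-- Combinatorial polytopes form a commutative monoid under the product of polytopes, the unit
being the point. -/
noncomputable instance : CommMonoid CombPolytope where
  mul := Quotient.map₂ Polytope.prod fun P P' ⟨e⟩ Q Q' ⟨f⟩ =>
    ⟨(Polytope.faceProdIso P Q).trans ((prodIso e f).trans (Polytope.faceProdIso P' Q').symm)⟩
  one := mk Polytope.point
  mul_assoc := by
    rintro ⟨P⟩ ⟨Q⟩ ⟨R⟩
    refine Quotient.sound ⟨?_⟩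
    exact (Polytope.faceProdIso _ _).trans
      ((prodIso (Polytope.faceProdIso P Q) (OrderIso.refl _)).trans
        ((OrderIso.prodAssoc _ _ _).trans
          ((prodIso (OrderIso.refl _) (Polytope.faceProdIso Q R).symm).trans
            (Polytope.faceProdIso _ _).symm)))
  one_mul := by
    rintro ⟨P⟩
    exact Quotient.sound ⟨(Polytope.faceProdIso _ _).trans
      { toEquiv := Equiv.uniqueProd _ _
        map_rel_iff' := fun {a b} => ⟨fun h => ⟨(Subsingleton.elim a.1 b.1).le, h⟩, fun h => h.2⟩ }⟩
  mul_one := by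
    rintro ⟨P⟩
    exact Quotient.sound ⟨(Polytope.faceProdIso _ _).trans
      { toEquiv := Equiv.prodUnique _ _
        map_rel_iff' := fun {a b} => ⟨fun h => ⟨h, (Subsingleton.elim a.2 b.2).le⟩, fun h => h.1⟩ }⟩
  mul_comm := by
    rintro ⟨P⟩ ⟨Q⟩
    exact Quotient.sound ⟨(Polytope.faceProdIso _ _).trans
      (OrderIso.prodComm.trans (Polytope.faceProdIso _ _).symm)⟩

theorem mk_mul_mk (P Q : Polytope) : mk P * mk Q = mk (P.prod Q) := rfl

theorem one_eq : (1 : CombPolytope) = mk Polytope.point := rfl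

end CombPolytope

/-- The polytopal ring with rational coefficients, `𝔓 ⊗ ℚ`: the `ℚ`-vector space with basis the
combinatorial polytopes, with multiplication induced by the product of polytopes. -/
abbrev PolytopeRing : Type := MonoidAlgebra ℚ CombPolytope

namespace Polytope

/-- A polytope as an element of the polytopal ring. -/
noncomputable def toRing (P : Polytope) : PolytopeRing :=
  MonoidAlgebra.single (CombPolytope.mk P) 1

/-- The face polynomial `F_P(t) = ∑ f * t ^ codim f`, the sum being over all nonempty faces `f`
of `P`, including `P` itself. -/
noncomputable def facePolynomial (P : Polytope) : Polynomial PolytopeRing :=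
  ∑ F : Face P.carrier, Polynomial.C (P.ofFace F).toRing * Polynomial.X ^ P.codim F

/-- The motivic interior `P° = F_P(-1)`. -/
noncomputable def motivicInterior (P : Polytope) : PolytopeRing := P.facePolynomial.eval (-1)

end Polytope

/-! ### Graph-associahedra -/

/-- The polytope
`{x ∈ ℝⁿ | ∑ xᵢ = 3ⁿ, and ∑_{i ∈ S} xᵢ ≥ 3^|S| for all S ≠ [n] inducing a connected subgraph of G}`
(connected subgraphs are nonempty). -/
def graphAssociahedronSet {n : ℕ} (G : SimpleGraph (Fin n)) : Set (Fin n → ℝ) :=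
  {x | ∑ i, x i = 3 ^ n ∧ ∀ S : Finset (Fin n), (G.induce (S : Set (Fin n))).Connected →
    S ≠ Finset.univ → 3 ^ S.card ≤ ∑ i ∈ S, x i}

theorem graphAssociahedronSet_nonempty {n : ℕ} [NeZero n] (G : SimpleGraph (Fin n)) :
    (graphAssociahedronSet G).Nonempty := by
  have hn : 0 < n := NeZero.pos n
  refine ⟨fun _ => 3 ^ n / n, ?_, ?_⟩
  · simp only [Finset.sum_const, Finset.card_univ, Fintype.card_fin, nsmul_eq_mul]
    field_simp
  · intro S hS _
    have hpos : 1 ≤ S.card := by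
      obtain ⟨⟨x, hx⟩⟩ := hS.nonempty
      exact Finset.card_pos.2 ⟨x, hx⟩
    have hle : S.card ≤ n := by simpa using Finset.card_le_univ S
    have key : ∀ k, S.card ≤ k → k * 3 ^ S.card ≤ S.card * 3 ^ k := by
      intro k hk
      induction k, hk using Nat.le_induction with
      | base => exact le_rfl
      | succ k hk ih =>
        calc (k + 1) * 3 ^ S.card ≤ 3 * (k * 3 ^ S.card) := by
              have : k + 1 ≤ 3 * k := by omega
              calc (k + 1) * 3 ^ S.card ≤ (3 * k) * 3 ^ S.card := Nat.mul_le_mul_right _ this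
                _ = _ := by ring
          _ ≤ 3 * (S.card * 3 ^ k) := Nat.mul_le_mul_left _ ih
          _ = _ := by ring
    have h := key n hle
    simp only [Finset.sum_const, nsmul_eq_mul]
    rw [mul_div_assoc', le_div_iff₀ (by exact_mod_cast hn)]
    have h' : (n : ℝ) * 3 ^ S.card ≤ S.card * 3 ^ n := by exact_mod_cast h
    linarith

theorem graphAssociahedronSet_bounded {n : ℕ} (G : SimpleGraph (Fin n)) :
    Bornology.IsBounded (graphAssociahedronSet G) := by
  refine (Metric.isBounded_Icc (0 : Fin n → ℝ) (fun _ => 3 ^ n)).subset ?_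
  rintro x ⟨hsum, hx⟩
  have h0 : ∀ i, 0 ≤ x i := by
    intro i
    by_cases h : ({i} : Finset (Fin n)) = Finset.univ
    · rw [← h] at hsum
      simp only [Finset.sum_singleton] at hsum
      rw [hsum]
      positivity
    · have h1 := hx {i} (by
        rw [Finset.coe_singleton]
        exact SimpleGraph.Connected.of_subsingleton) h
      simp only [Finset.card_singleton, Finset.sum_singleton] at h1
      linarith
  refine ⟨h0, fun i => ?_⟩
  change x i ≤ 3 ^ n
  rw [← hsum]
  exact Finset.single_le_sum (fun j _ => h0 j) (Finset.mem_univ i)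

theorem graphAssociahedronSet_polyhedron {n : ℕ} (G : SimpleGraph (Fin n)) :
    IsPolyhedron (graphAssociahedronSet G) := by
  let l : Finset (Fin n) → (Fin n → ℝ) →L[ℝ] ℝ := fun S =>
    ∑ i ∈ S, ContinuousLinearMap.proj (R := ℝ) (φ := fun _ : Fin n => ℝ) i
  have hl : ∀ S x, l S x = ∑ i ∈ S, x i := fun S x => by simp [l]
  have h := ((IsPolyhedron.halfSpace (l Finset.univ) (3 ^ n)).inter
    (IsPolyhedron.halfSpace (-l Finset.univ) (-3 ^ n))).inter
    (IsPolyhedron.iInter (ι := {S : Finset (Fin n) //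
      (G.induce (S : Set (Fin n))).Connected ∧ S ≠ Finset.univ})
      (fun S => IsPolyhedron.halfSpace (-l S.1) (-3 ^ S.1.card)))
  convert h using 1
  ext x
  simp only [graphAssociahedronSet, Set.mem_ofPred_eq, Set.mem_inter_iff, Set.mem_iInter,
    neg_apply, hl, neg_le_neg_iff, Subtype.forall, and_imp]
  rw [← le_antisymm_iff]

/-- The graph-associahedron of a graph with `n ≥ 1` vertices. -/
def graphAssociahedron {n : ℕ} [NeZero n] (G : SimpleGraph (Fin n)) : Polytope where
  ambient := n
  carrier := graphAssociahedronSet G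
  nonempty := graphAssociahedronSet_nonempty G
  bounded := graphAssociahedronSet_bounded G
  polyhedron := graphAssociahedronSet_polyhedron G

/-- The associahedron `𝔞ₙ`, `n ≥ 1`: the graph-associahedron of the path with `n` vertices. -/
def associahedron (n : ℕ) [NeZero n] : Polytope := graphAssociahedron (SimpleGraph.pathGraph n)

/-- The cyclohedron `Wₙ`, `n ≥ 1`: the graph-associahedron of the cycle with `n` vertices
(a single vertex for `n = 1`, two vertices joined by an edge for `n = 2`). -/
def cyclohedron (n : ℕ) [NeZero n] : Polytope := graphAssociahedron (SimpleGraph.cycleGraph n)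

/-! ### Generating series -/

open PowerSeries in
/-- `α(x) = x + ∑_{n ≥ 1} 𝔞ₙ xⁿ⁺¹`. -/
noncomputable def alphaSeries : PowerSeries PolytopeRing :=
  X + X ^ 2 * PowerSeries.mk fun k => (associahedron (k + 1)).toRing

open PowerSeries in
/-- `β(x) = x - ∑_{n ≥ 1} 𝔞ₙ° xⁿ⁺¹`. -/
noncomputable def betaSeries : PowerSeries PolytopeRing :=
  X - X ^ 2 * PowerSeries.mk fun k => (associahedron (k + 1)).motivicInterior

open PowerSeries in
/-- `W(x) = ∑_{n ≥ 1} Wₙ xⁿ / n`. -/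
noncomputable def cycloSeries : PowerSeries PolytopeRing :=
  X * PowerSeries.mk fun k => (1 / ((k : ℚ) + 1)) • (cyclohedron (k + 1)).toRing

open PowerSeries in
/-- `W°(x) = ∑_{n ≥ 1} Wₙ° xⁿ / n`. -/
noncomputable def cycloInteriorSeries : PowerSeries PolytopeRing :=
  X * PowerSeries.mk fun k => (1 / ((k : ℚ) + 1)) • (cyclohedron (k + 1)).motivicInterior

/-- Substitution of `α` into a power series is meaningful. -/
theorem hasSubst_alphaSeries : PowerSeries.HasSubst alphaSeries :=
  PowerSeries.HasSubst.of_constantCoeff_zero' (by simp [alphaSeries])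

/-- Substitution of `β` into a power series is meaningful. -/
theorem hasSubst_betaSeries : PowerSeries.HasSubst betaSeries :=
  PowerSeries.HasSubst.of_constantCoeff_zero' (by simp [betaSeries])

end PolytopeAlgebra

/-! For a connected graph, the faces of the graph-associahedron are indexed by tubings, with
inclusion reversed, and the codimension is the number of tubes (`tubingFaceIso`,
`finrank_vectorSpan_tubingFace`). The main point is that every tubing is exactly the set of tight
inequalities at some point (`exists_tightTubes_eq`). So the motivic interior is a signed sum over
tubings, where the class of a face depends only on the poset of tubings refining the given one
(`motivicInterior_graphAssociahedron`).

Tubes of the path are intervals. A tube splits the tubes compatible with it into those inside it and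
those of the graph with the tube contracted; hence a face class factors as a path class times a
class of the same kind on fewer vertices (`pathClass_insert`, `cycleClass_insert`).

Both series identities come from one recursion. In a tubing by intervals in `[p, n)`, either no
interval starts at `p`, or a longest one `[p, p + s)` does; then the tubing is glued from a proper
tubing `T` of `s` points and a tubing `U` of the rest, where the point `p + s` stays uncovered. If
`Φ` of a glued tubing is `-(Ψ s T * Φ (n - s) U)`, with `Ψ` the signed path class, iterating over
`p` gives `∑ₙ xⁿ⁺¹ ∑_W Φₙ(W) = ∑ₖ Φₖ(∅) β(x)ᵏ⁺¹` (`sum_intervalTubings_eq_coeff`), since `β = x(1 -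
∑ 𝔞ₙ° xⁿ)`.

With `Φ = pathTerm` this reads `x - β = α(β) - β`. For the cycle, a tubing always leaves some vertex
uncovered; averaging over its uncovered vertices and rotating one of them to the last position turns
`Wₙ°/n` into a sum over interval tubings, weighted by the reciprocal of the number of uncovered
vertices (`motivicInterior_cyclohedron`). Gluing preserves that number, so `Φ = cycleTerm` gives `W°
= W(β)`. Finally `β(α(x)) = x` follows from `α(β(x)) = x` because substituting `β` is injective. -/

namespace PolytopeAlgebra

/-! ### Flag complexes of a relation and the classes they carry -/

/-- The finite `r`-cliques inside `A` that contain `T`, ordered by inclusion. -/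
abbrev CliqueStar {α : Type*} (A : Set α) (r : α → α → Prop) (T : Finset α) : Type _ :=
  {X : Finset α // (∀ a ∈ X, a ∈ A) ∧ (X : Set α).Pairwise r ∧ T ⊆ X}

/-- The element of the polytopal ring with face poset `X`, or `0` if there is no such polytope. -/
noncomputable def posetClass (X : Type) [PartialOrder X] : PolytopeRing := by
  classical
  exact if h : ∃ P : Polytope, Nonempty (Face P.carrier ≃o X) then h.choose.toRing else 0

/-- The choice in `posetClass` is harmless: any two polytopes realizing the same poset have the same
combinatorial type. -/
theorem posetClass_eq {X : Type} [PartialOrder X] (P : Polytope) (e : Face P.carrier ≃o X) :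
    posetClass X = P.toRing := by
  have h : ∃ P : Polytope, Nonempty (Face P.carrier ≃o X) := ⟨P, ⟨e⟩⟩
  rw [posetClass, dif_pos h]
  obtain ⟨f⟩ := h.choose_spec
  have : CombPolytope.mk h.choose = CombPolytope.mk P := Quotient.sound ⟨f.trans e.symm⟩
  rw [Polytope.toRing, Polytope.toRing, this]

theorem posetClass_congr {X Y : Type} [PartialOrder X] [PartialOrder Y] (e : X ≃o Y) :
    posetClass X = posetClass Y := by
  by_cases h : ∃ P : Polytope, Nonempty (Face P.carrier ≃o X)
  · obtain ⟨P, ⟨f⟩⟩ := h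
    rw [posetClass_eq P f, posetClass_eq P (f.trans e)]
  · have h' : ¬ ∃ P : Polytope, Nonempty (Face P.carrier ≃o Y) :=
      fun ⟨P, ⟨f⟩⟩ => h ⟨P, ⟨f.trans e.symm⟩⟩
    rw [posetClass, posetClass, dif_neg h, dif_neg h']

/-- The order dual of a product is the product of the order duals. -/
def prodDualIso (X Y : Type*) [LE X] [LE Y] : (X × Y)ᵒᵈ ≃o Xᵒᵈ × Yᵒᵈ where
  toFun p := (OrderDual.toDual (OrderDual.ofDual p).1, OrderDual.toDual (OrderDual.ofDual p).2)
  invFun p := OrderDual.toDual (OrderDual.ofDual p.1, OrderDual.ofDual p.2)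
  left_inv _ := rfl
  right_inv _ := rfl
  map_rel_iff' := Iff.rfl

/-- The polytopes `P` and `Q` rule out the default value `0` for the factors; their product then
realizes `Zᵒᵈ`. -/
theorem posetClass_prod {X Y Z : Type} [PartialOrder X] [PartialOrder Y] [PartialOrder Z]
    (P Q : Polytope) (eP : Face P.carrier ≃o Xᵒᵈ) (eQ : Face Q.carrier ≃o Yᵒᵈ)
    (e : Z ≃o X × Y) : posetClass Zᵒᵈ = posetClass Xᵒᵈ * posetClass Yᵒᵈ := by
  rw [posetClass_eq P eP, posetClass_eq Q eQ, posetClass_eq (P.prod Q)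
    ((Polytope.faceProdIso P Q).trans ((prodIso eP eQ).trans
      ((prodDualIso X Y).symm.trans e.symm.dual))), Polytope.toRing, Polytope.toRing,
      Polytope.toRing, MonoidAlgebra.single_mul_single, one_mul, CombPolytope.mk_mul_mk]

section Transport

variable {α β γ : Type*}

/-- Relation-preserving bijections of the ground sets identify the clique posets. -/
theorem cliqueStar_image_iso {A : Set α} {B : Set β} {r : α → α → Prop} {s : β → β → Prop}
    [DecidableEq β] (f : α → β) (hinj : Set.InjOn f A) (himg : f '' A = B)
    (hr : ∀ a ∈ A, ∀ b ∈ A, r a b ↔ s (f a) (f b)) (T : Finset α) (hT : ∀ a ∈ T, a ∈ A) :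
    Nonempty (CliqueStar A r T ≃o CliqueStar B s (T.image f)) := by
  have hmem : ∀ X : CliqueStar A r T, (∀ b ∈ X.1.image f, b ∈ B) ∧
      ((X.1.image f : Finset β) : Set β).Pairwise s ∧ T.image f ⊆ X.1.image f := by
    rintro ⟨X, hXA, hXr, hTX⟩
    refine ⟨?_, ?_, Finset.image_subset_image hTX⟩
    · intro b hb
      obtain ⟨a, ha, rfl⟩ := Finset.mem_image.1 hb
      exact himg ▸ Set.mem_image_of_mem f (hXA a ha)
    · intro b hb b' hb' hne
      obtain ⟨a, ha, rfl⟩ := Finset.mem_image.1 (Finset.mem_coe.1 hb)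
      obtain ⟨a', ha', rfl⟩ := Finset.mem_image.1 (Finset.mem_coe.1 hb')
      exact (hr a (hXA a ha) a' (hXA a' ha')).1 (hXr ha ha' fun h => hne (h ▸ rfl))
  have hsub : ∀ X Y : Finset α, (∀ a ∈ X, a ∈ A) → (∀ a ∈ Y, a ∈ A) →
      (X.image f ⊆ Y.image f ↔ X ⊆ Y) := by
    intro X Y hX hY
    refine ⟨fun h a ha => ?_, Finset.image_subset_image⟩
    obtain ⟨b, hb, hab⟩ := Finset.mem_image.1 (h (Finset.mem_image_of_mem f ha))
    rwa [← hinj (hY b hb) (hX a ha) hab]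
  refine ⟨RelIso.ofSurjective (OrderEmbedding.ofMapLEIff
    (fun X => (⟨X.1.image f, hmem X⟩ : CliqueStar B s (T.image f)))
    fun X Y => hsub X.1 Y.1 X.2.1 Y.2.1) ?_⟩
  rintro ⟨Y, hYB, hYs, hTY⟩
  obtain ⟨X, hXA, rfl⟩ := Finset.subset_set_image_iff.1
    (show (Y : Set β) ⊆ f '' A from fun b hb => himg ▸ hYB b hb)
  refine ⟨⟨X, hXA, ?_, (hsub T X hT hXA).1 hTY⟩, rfl⟩
  intro a ha a' ha' hne
  exact (hr a (hXA ha) a' (hXA ha')).2 (hYs (Finset.mem_coe.2 (Finset.mem_image_of_mem f ha))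
    (Finset.mem_coe.2 (Finset.mem_image_of_mem f ha')) (hinj.ne (hXA ha) (hXA ha') hne))

/-- If the elements of `A` compatible with `m` split into two mutually compatible families, then
the cliques through `m` form a product. -/
theorem cliqueStar_join_iso [DecidableEq α] {A : Set α} {B : Set β} {C : Set γ} {r : α → α → Prop}
    {s : β → β → Prop} {t : γ → γ → Prop} (m : α) (f : β → α) (g : γ → α)
    (hm : m ∈ A) (hsymm : ∀ a b, r a b → r b a)
    (hf : Function.Injective f) (hg : Function.Injective g)
    (hfA : ∀ b ∈ B, f b ∈ A ∧ f b ≠ m ∧ r (f b) m) (hgA : ∀ c ∈ C, g c ∈ A ∧ g c ≠ m ∧ r (g c) m)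
    (hfg : ∀ b ∈ B, ∀ c ∈ C, f b ≠ g c ∧ r (f b) (g c))
    (hrf : ∀ b ∈ B, ∀ b' ∈ B, s b b' ↔ r (f b) (f b'))
    (hrg : ∀ c ∈ C, ∀ c' ∈ C, t c c' ↔ r (g c) (g c'))
    (hcover : ∀ a ∈ A, a ≠ m → r a m → (∃ b ∈ B, f b = a) ∨ ∃ c ∈ C, g c = a)
    (T : Finset β) (U : Finset γ) (hT : ∀ b ∈ T, b ∈ B) (hU : ∀ c ∈ U, c ∈ C) :
    Nonempty (CliqueStar A r (insert m (T.image f ∪ U.image g)) ≃o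
      CliqueStar B s T × CliqueStar C t U) := by
  classical
  have hmem : ∀ X : CliqueStar B s T × CliqueStar C t U,
      (∀ a ∈ insert m (X.1.1.image f ∪ X.2.1.image g), a ∈ A) ∧
      ((insert m (X.1.1.image f ∪ X.2.1.image g) : Finset α) : Set α).Pairwise r ∧
      insert m (T.image f ∪ U.image g) ⊆ insert m (X.1.1.image f ∪ X.2.1.image g) := by
    rintro ⟨⟨X, hXB, hXs, hTX⟩, Y, hYC, hYt, hUY⟩
    refine ⟨?_, ?_, Finset.insert_subset_insert _ (Finset.union_subset_union
      (Finset.image_subset_image hTX) (Finset.image_subset_image hUY))⟩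
    · intro a ha
      simp only [Finset.mem_insert, Finset.mem_union, Finset.mem_image] at ha
      rcases ha with rfl | ⟨b, hb, rfl⟩ | ⟨c, hc, rfl⟩
      · exact hm
      · exact (hfA b (hXB b hb)).1
      · exact (hgA c (hYC c hc)).1
    · intro a ha a' ha' hne
      simp only [Finset.coe_insert, Finset.coe_union, Finset.coe_image, Set.mem_insert_iff,
        Set.mem_union, Set.mem_image, Finset.mem_coe] at ha ha'
      rcases ha with rfl | ⟨b, hb, rfl⟩ | ⟨c, hc, rfl⟩ <;>
        rcases ha' with rfl | ⟨b', hb', rfl⟩ | ⟨c', hc', rfl⟩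
      · exact absurd rfl hne
      · exact hsymm _ _ (hfA b' (hXB b' hb')).2.2
      · exact hsymm _ _ (hgA c' (hYC c' hc')).2.2
      · exact (hfA b (hXB b hb)).2.2
      · exact (hrf b (hXB b hb) b' (hXB b' hb')).1 (hXs hb hb' fun h => hne (h ▸ rfl))
      · exact (hfg b (hXB b hb) c' (hYC c' hc')).2
      · exact (hgA c (hYC c hc)).2.2
      · exact hsymm _ _ (hfg b' (hXB b' hb') c (hYC c hc)).2
      · exact (hrg c (hYC c hc) c' (hYC c' hc')).1 (hYt hc hc' fun h => hne (h ▸ rfl))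
  have hfmem : ∀ (b : β) (X : Finset β) (Y : Finset γ), b ∈ B → (∀ c ∈ Y, c ∈ C) →
      (f b ∈ insert m (X.image f ∪ Y.image g) ↔ b ∈ X) := by
    intro b X Y hb hY
    simp only [Finset.mem_insert, Finset.mem_union, Finset.mem_image]
    constructor
    · rintro (h | ⟨b', hb', h⟩ | ⟨c, hc, h⟩)
      · exact absurd h (hfA b hb).2.1
      · exact hf h ▸ hb'
      · exact absurd h.symm (hfg b hb c (hY c hc)).1
    · exact fun h => Or.inr (Or.inl ⟨b, h, rfl⟩)
  have hgmem : ∀ (c : γ) (X : Finset β) (Y : Finset γ), c ∈ C → (∀ b ∈ X, b ∈ B) →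
      (g c ∈ insert m (X.image f ∪ Y.image g) ↔ c ∈ Y) := by
    intro c X Y hc hX
    simp only [Finset.mem_insert, Finset.mem_union, Finset.mem_image]
    constructor
    · rintro (h | ⟨b, hb, h⟩ | ⟨c', hc', h⟩)
      · exact absurd h (hgA c hc).2.1
      · exact absurd h (hfg b (hX b hb) c hc).1
      · exact hg h ▸ hc'
    · exact fun h => Or.inr (Or.inr ⟨c, h, rfl⟩)
  refine ⟨(RelIso.ofSurjective (OrderEmbedding.ofMapLEIff
    (fun X => (⟨_, hmem X⟩ : CliqueStar A r (insert m (T.image f ∪ U.image g)))) ?_) ?_).symm⟩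
  · rintro ⟨⟨X, hXB, hXs, hTX⟩, Y, hYC, hYt, hUY⟩ ⟨⟨X', hXB', hXs', hTX'⟩, Y', hYC', hYt', hUY'⟩
    constructor
    · intro h
      refine ⟨fun b hb => ?_, fun c hc => ?_⟩
      · exact (hfmem b X' Y' (hXB b hb) hYC').1 (h ((hfmem b X Y (hXB b hb) hYC).2 hb))
      · exact (hgmem c X' Y' (hYC c hc) hXB').1 (h ((hgmem c X Y (hYC c hc) hXB).2 hc))
    · rintro ⟨h1, h2⟩
      exact Finset.insert_subset_insert _ (Finset.union_subset_union
        (Finset.image_subset_image h1) (Finset.image_subset_image h2))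
  · rintro ⟨Z, hZA, hZr, hTZ⟩
    have hmZ : m ∈ Z := hTZ (Finset.mem_insert_self _ _)
    -- The inverse pulls a clique back along `f` and `g`. Filtering is needed because these maps are
    -- defined on the whole types but controlled only on `B` and `C`.
    refine ⟨⟨⟨(Z.preimage f hf.injOn).filter (· ∈ B), ?_, ?_, ?_⟩,
      ⟨(Z.preimage g hg.injOn).filter (· ∈ C), ?_, ?_, ?_⟩⟩, Subtype.ext ?_⟩
    · exact fun b hb => (Finset.mem_filter.1 hb).2
    · intro b hb b' hb' hne
      simp only [Finset.coe_filter, Finset.mem_preimage, Set.mem_ofPred_eq] at hb hb'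
      exact (hrf b hb.2 b' hb'.2).2 (hZr hb.1 hb'.1 (hf.ne hne))
    · intro b hb
      simp only [Finset.mem_filter, Finset.mem_preimage]
      exact ⟨hTZ ((hfmem b T U (hT b hb) hU).2 hb), hT b hb⟩
    · exact fun b hb => (Finset.mem_filter.1 hb).2
    · intro b hb b' hb' hne
      simp only [Finset.coe_filter, Finset.mem_preimage, Set.mem_ofPred_eq] at hb hb'
      exact (hrg b hb.2 b' hb'.2).2 (hZr hb.1 hb'.1 (hg.ne hne))
    · intro b hb
      simp only [Finset.mem_filter, Finset.mem_preimage]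
      exact ⟨hTZ ((hgmem b T U (hU b hb) hT).2 hb), hU b hb⟩
    · ext a
      simp only [OrderEmbedding.coe_ofMapLEIff, Finset.mem_insert, Finset.mem_union,
        Finset.mem_image, Finset.mem_filter, Finset.mem_preimage]
      constructor
      · rintro (rfl | ⟨b, hb, rfl⟩ | ⟨c, hc, rfl⟩)
        · exact hmZ
        · exact hb.1
        · exact hc.1
      · intro ha
        by_cases ham : a = m
        · exact Or.inl ham
        · rcases hcover a (hZA a ha) ham (hZr ha hmZ ham) with ⟨b, hb, rfl⟩ | ⟨c, hc, rfl⟩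
          · exact Or.inr (Or.inl ⟨b, ⟨ha, hb⟩, rfl⟩)
          · exact Or.inr (Or.inr ⟨c, ⟨ha, hc⟩, rfl⟩)

end Transport

/-! ### Laminar families -/

section Laminar

variable {V : Type*} [DecidableEq V]

/-- The elements of `t` lying in no smaller member of `L`. -/
def laminarCore (L : Finset (Finset V)) (t : Finset V) : Finset V :=
  t.filter fun i => ∀ u ∈ L, u ⊂ t → i ∉ u

theorem laminarCore_subset (L : Finset (Finset V)) (t : Finset V) : laminarCore L t ⊆ t :=
  Finset.filter_subset _ _

theorem mem_laminarCore {L : Finset (Finset V)} {t : Finset V} {i : V} :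
    i ∈ laminarCore L t ↔ i ∈ t ∧ ∀ u ∈ L, u ⊂ t → i ∉ u :=
  Finset.mem_filter

/-- The system is triangular with respect to cardinality: a set of largest size enters no equation
but its own, so its coefficient can be solved for last. -/
theorem exists_sum_subset_eq (L : Finset (Finset V)) (y : Finset V → ℝ) :
    ∃ c : Finset V → ℝ, ∀ t ∈ L, ∑ u ∈ L.filter (· ⊆ t), c u = y t := by
  induction L using Finset.induction_on_max_value (fun t : Finset V => t.card) with
  | empty => exact ⟨0, by simp⟩
  | insert a s has hmax ih =>
    obtain ⟨c, hc⟩ := ih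
    refine ⟨Function.update c a (y a - ∑ u ∈ s.filter (· ⊆ a), c u), ?_⟩
    have hupd : ∀ t, ∑ u ∈ s.filter (· ⊆ t),
        Function.update c a (y a - ∑ u ∈ s.filter (· ⊆ a), c u) u = ∑ u ∈ s.filter (· ⊆ t), c u :=
      fun t => Finset.sum_congr rfl fun u hu =>
        Function.update_of_ne (fun h : u = a => has (h ▸ (Finset.mem_filter.1 hu).1)) _ _
    intro t ht
    rcases Finset.mem_insert.1 ht with rfl | ht
    · rw [Finset.filter_insert, if_pos subset_rfl, Finset.sum_insert (by simp [has]), hupd,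
        Function.update_self]
      ring
    · have : ¬ a ⊆ t := fun h => has (Finset.eq_of_subset_of_card_le h (hmax t ht) ▸ ht)
      rw [Finset.filter_insert, if_neg this, hupd, hc t ht]

/-- The point that spreads the weight `c u` evenly over the core of each member `u` of `L`. -/
noncomputable def laminarPoint (L : Finset (Finset V)) (c : Finset V → ℝ) (i : V) : ℝ :=
  ∑ u ∈ L, if i ∈ laminarCore L u then c u / (laminarCore L u).card else 0

variable {L : Finset (Finset V)}

/-- By laminarity the core of `u` lies in `t` if `u ⊆ t` and misses `t` otherwise, so each weight
counts fully or not at all. -/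
theorem sum_laminarPoint (hL : ∀ s ∈ L, ∀ t ∈ L, s ⊆ t ∨ t ⊆ s ∨ Disjoint s t)
    (hne : ∀ t ∈ L, (laminarCore L t).Nonempty) (c : Finset V → ℝ) {t : Finset V} (ht : t ∈ L) :
    ∑ i ∈ t, laminarPoint L c i = ∑ u ∈ L.filter (· ⊆ t), c u := by
  unfold laminarPoint
  rw [Finset.sum_comm, Finset.sum_filter]
  refine Finset.sum_congr rfl fun u hu => ?_
  rw [← Finset.sum_filter, Finset.sum_const, nsmul_eq_mul]
  by_cases hut : u ⊆ t
  · have : t.filter (· ∈ laminarCore L u) = laminarCore L u := by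
      ext i
      simp only [Finset.mem_filter, and_iff_right_iff_imp]
      exact fun hi => hut (Finset.mem_filter.1 hi).1
    rw [if_pos hut, this]
    have : ((laminarCore L u).card : ℝ) ≠ 0 := by
      exact_mod_cast (Finset.card_pos.2 (hne u hu)).ne'
    field_simp
  · have : t.filter (· ∈ laminarCore L u) = ∅ := by
      refine Finset.filter_eq_empty_iff.2 fun i hi hiu => ?_
      rcases hL u hu t ht with h | h | h
      · exact hut h
      · exact (Finset.mem_filter.1 hiu).2 t ht (Finset.ssubset_iff_subset_ne.2
          ⟨h, fun h' => hut (h' ▸ subset_rfl)⟩) hi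
      · exact Finset.disjoint_left.1 h (Finset.mem_filter.1 hiu).1 hi
    rw [if_neg hut, this]
    simp

theorem exists_sum_eq (hL : ∀ s ∈ L, ∀ t ∈ L, s ⊆ t ∨ t ⊆ s ∨ Disjoint s t)
    (hne : ∀ t ∈ L, (laminarCore L t).Nonempty) (y : Finset V → ℝ) :
    ∃ x : V → ℝ, ∀ t ∈ L, ∑ i ∈ t, x i = y t := by
  obtain ⟨c, hc⟩ := exists_sum_subset_eq L y
  exact ⟨laminarPoint L c, fun t ht => by rw [sum_laminarPoint hL hne c ht, hc t ht]⟩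

/-- Peel off a member `u` of largest size: the weights below it total `3 ^ |u|`, the other members
are disjoint from `u`, and `3 ^ a + 3 ^ b ≤ 3 ^ (a + b)` for `a, b ≥ 1`. -/
theorem sum_le_three_pow_card (hL : ∀ s ∈ L, ∀ t ∈ L, s ⊆ t ∨ t ⊆ s ∨ Disjoint s t)
    (hne : ∀ t ∈ L, t.Nonempty) {c : Finset V → ℝ}
    (hc : ∀ t ∈ L, ∑ u ∈ L.filter (· ⊆ t), c u = 3 ^ t.card) (D : Finset (Finset V)) (hD : D ⊆ L)
    (hdown : ∀ u ∈ D, ∀ v ∈ L, v ⊆ u → v ∈ D) :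
    ∑ u ∈ D, c u ≤ 3 ^ (D.biUnion id).card := by
  induction D using Finset.strongInduction with
  | H D ih =>
    rcases D.eq_empty_or_nonempty with rfl | hDne
    · simp
    · obtain ⟨u, hu, hmax⟩ := D.exists_max_image Finset.card hDne
      have hcomp : ∀ w ∈ D, ¬ w ⊆ u → Disjoint u w := by
        intro w hw hwu
        rcases hL u (hD hu) w (hD hw) with h | h | h
        · exact absurd (Finset.eq_of_subset_of_card_le h (hmax w hw) ▸ subset_rfl) hwu
        · exact absurd h hwu
        · exact h
      have h1 : D.filter (· ⊆ u) = L.filter (· ⊆ u) := by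
        ext v
        simp only [Finset.mem_filter]
        exact ⟨fun h => ⟨hD h.1, h.2⟩, fun h => ⟨hdown u hu v h.1 h.2, h.2⟩⟩
      rw [← Finset.sum_filter_add_sum_filter_not D (· ⊆ u), h1, hc u (hD hu)]
      set D' := D.filter fun v => ¬ v ⊆ u
      have hD' : D' ⊆ D := Finset.filter_subset _ _
      have hlt : D' ⊂ D := Finset.ssubset_iff_subset_ne.2
        ⟨hD', fun h => (Finset.mem_filter.1 (h ▸ hu : u ∈ D')).2 subset_rfl⟩
      have hdisj : Disjoint u (D'.biUnion id) := by
        rw [Finset.disjoint_biUnion_right]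
        intro w hw
        exact hcomp w (Finset.mem_filter.1 hw).1 (Finset.mem_filter.1 hw).2
      have hcard : u.card + (D'.biUnion id).card ≤ (D.biUnion id).card := by
        rw [← Finset.card_union_of_disjoint hdisj]
        exact Finset.card_le_card (Finset.union_subset (Finset.subset_biUnion_of_mem id hu)
          (Finset.biUnion_subset_biUnion_of_subset_left _ hD'))
      rcases D'.eq_empty_or_nonempty with h0 | ⟨w, hw⟩
      · rw [h0, Finset.sum_empty, add_zero]
        exact pow_le_pow_right₀ (by norm_num) (by omega)
      · have h2 := ih D' hlt (hD'.trans hD) (by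
          intro w hw v hv hvw
          refine Finset.mem_filter.2 ⟨hdown w (hD' hw) v hv hvw, fun hvu => ?_⟩
          obtain ⟨i, hi⟩ := hne v hv
          exact Finset.disjoint_left.1 (hcomp w (hD' hw) (Finset.mem_filter.1 hw).2)
            (hvu hi) (hvw hi))
        have ha : (3 : ℝ) ^ 1 ≤ 3 ^ u.card :=
          pow_le_pow_right₀ (by norm_num) (Finset.card_pos.2 (hne u (hD hu)))
        have hb : (3 : ℝ) ^ 1 ≤ 3 ^ (D'.biUnion id).card := by
          refine pow_le_pow_right₀ (by norm_num) (Finset.card_pos.2 ?_)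
          obtain ⟨i, hi⟩ := hne w (hD (hD' hw))
          exact ⟨i, Finset.mem_biUnion.2 ⟨w, hw, hi⟩⟩
        have h3 : (3 : ℝ) ^ (u.card + (D'.biUnion id).card) ≤ 3 ^ (D.biUnion id).card :=
          pow_le_pow_right₀ (by norm_num) hcard
        rw [pow_add] at h3
        nlinarith

/-- A strengthening of the monotonicity of `3 ^ k / k`, with room for the `-1` in the lower bound
for the weights. -/
theorem mul_three_pow_lt {u w : ℕ} (hu : 1 ≤ u) (huw : u < w) :
    (w : ℝ) * 3 ^ u < u * (3 ^ w - 1) := by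
  have hu' : (1 : ℝ) ≤ u := by exact_mod_cast hu
  induction w, huw using Nat.le_induction with
  | base =>
    have h : (u : ℝ) < 3 ^ u := by exact_mod_cast Nat.lt_pow_self (by norm_num)
    push_cast
    rw [pow_succ]
    nlinarith
  | succ w hw ih =>
    have h : (3 : ℝ) ^ u ≤ 3 ^ w := pow_le_pow_right₀ (by norm_num) (by omega)
    have h0 : (0 : ℝ) < 3 ^ w := by positivity
    push_cast
    rw [pow_succ]
    nlinarith

/-- The members strictly below `t` cover exactly `t` minus its core, so they use at most `3` to that
size out of the total `3 ^ |t|`; the remainder is `c t`. -/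
theorem three_pow_card_le_of_mem (hL : ∀ s ∈ L, ∀ t ∈ L, s ⊆ t ∨ t ⊆ s ∨ Disjoint s t)
    (hne : ∀ t ∈ L, t.Nonempty) {c : Finset V → ℝ}
    (hc : ∀ t ∈ L, ∑ u ∈ L.filter (· ⊆ t), c u = 3 ^ t.card) {t : Finset V} (ht : t ∈ L) :
    3 ^ (t.card - (laminarCore L t).card) * (3 ^ (laminarCore L t).card - 1) ≤ c t := by
  have hsplit : L.filter (· ⊆ t) = insert t (L.filter (· ⊂ t)) := by
    ext u
    simp only [Finset.mem_filter, Finset.mem_insert]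
    constructor
    · rintro ⟨h1, h2⟩
      by_cases h : u = t
      · exact Or.inl h
      · exact Or.inr ⟨h1, Finset.ssubset_iff_subset_ne.2 ⟨h2, h⟩⟩
    · rintro (rfl | h)
      · exact ⟨ht, subset_rfl⟩
      · exact ⟨h.1, h.2.subset⟩
  have h1 := hc t ht
  rw [hsplit, Finset.sum_insert (by simp)] at h1
  have h2 := sum_le_three_pow_card hL hne hc (L.filter (· ⊂ t)) (Finset.filter_subset _ _)
    fun u hu v hv hvu => Finset.mem_filter.2 ⟨hv, hvu.trans_ssubset (Finset.mem_filter.1 hu).2⟩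
  have h3 : (L.filter (· ⊂ t)).biUnion id = t \ laminarCore L t := by
    ext i
    simp only [Finset.mem_biUnion, Finset.mem_filter, id, Finset.mem_sdiff, laminarCore, not_and,
      not_forall, not_not]
    constructor
    · rintro ⟨u, ⟨h, h'⟩, hi⟩
      exact ⟨h'.subset hi, fun _ => ⟨u, h, h', hi⟩⟩
    · rintro ⟨hi, h⟩
      obtain ⟨u, h1, h2, h3⟩ := h hi
      exact ⟨u, ⟨h1, h2⟩, h3⟩
  have hsub := laminarCore_subset L t
  rw [h3, Finset.card_sdiff_of_subset hsub] at h2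
  have h4 : (3 : ℝ) ^ t.card =
      3 ^ (t.card - (laminarCore L t).card) * 3 ^ (laminarCore L t).card := by
    rw [← pow_add, Nat.sub_add_cancel (Finset.card_le_card hsub)]
  rw [mul_sub, ← h4]
  linarith

theorem laminarPoint_nonneg (hL : ∀ s ∈ L, ∀ t ∈ L, s ⊆ t ∨ t ⊆ s ∨ Disjoint s t)
    (hne : ∀ t ∈ L, t.Nonempty) {c : Finset V → ℝ}
    (hc : ∀ t ∈ L, ∑ u ∈ L.filter (· ⊆ t), c u = 3 ^ t.card) :
    (∀ t ∈ L, 0 ≤ c t) ∧ ∀ i, 0 ≤ laminarPoint L c i := by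
  have h : ∀ t ∈ L, 0 ≤ c t := fun t ht =>
    (mul_nonneg (by positivity) (sub_nonneg.2 (one_le_pow₀ (by norm_num)))).trans
      (three_pow_card_le_of_mem hL hne hc ht)
  refine ⟨h, fun i => Finset.sum_nonneg fun u hu => ?_⟩
  split_ifs
  · exact div_nonneg (h u hu) (Nat.cast_nonneg _)
  · exact le_rfl

/-- The weights of `laminarPoint` strictly exceed `3 ^ |S|` away from the laminar family. -/
theorem three_pow_card_lt_sum (hL : ∀ s ∈ L, ∀ t ∈ L, s ⊆ t ∨ t ⊆ s ∨ Disjoint s t)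
    (hne : ∀ t ∈ L, t.Nonempty) {c : Finset V → ℝ}
    (hc : ∀ t ∈ L, ∑ u ∈ L.filter (· ⊆ t), c u = 3 ^ t.card) {S t : Finset V} (ht : t ∈ L)
    (hSt : S ⊂ t) (hcore : (S ∩ laminarCore L t).Nonempty) :
    3 ^ S.card < ∑ i ∈ S, laminarPoint L c i := by
  obtain ⟨hcnn, hxnn⟩ := laminarPoint_nonneg hL hne hc
  have hct := three_pow_card_le_of_mem hL hne hc ht
  have hsub := laminarCore_subset L t
  set R := laminarCore L t with hR
  have hx : ∀ i ∈ R, c t / R.card ≤ laminarPoint L c i := by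
    intro i hi
    have := Finset.single_le_sum (f := fun u => if i ∈ laminarCore L u then
      c u / ((laminarCore L u).card : ℝ) else 0) (fun u hu => by
        split_ifs
        · exact div_nonneg (hcnn u hu) (Nat.cast_nonneg _)
        · exact le_rfl) ht
    simpa [laminarPoint, ← hR, hi] using this
  have h1 : ((S ∩ R).card : ℝ) * (c t / R.card) ≤ ∑ i ∈ S, laminarPoint L c i := by
    calc _ = ∑ i ∈ S ∩ R, c t / R.card := by simp
      _ ≤ ∑ i ∈ S ∩ R, laminarPoint L c i :=
        Finset.sum_le_sum fun i hi => hx i (Finset.mem_inter.1 hi).2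
      _ ≤ _ := Finset.sum_le_sum_of_subset_of_nonneg Finset.inter_subset_left
        fun i _ _ => hxnn i
  refine lt_of_lt_of_le ?_ h1
  have hu1 : 1 ≤ (S ∩ R).card := Finset.card_pos.2 hcore
  have huw : (S ∩ R).card ≤ R.card := Finset.card_le_card Finset.inter_subset_right
  have hRpos : (0 : ℝ) < R.card := by exact_mod_cast hu1.trans huw
  have hSlt : S.card < t.card := Finset.card_lt_card hSt
  have hRle : R.card ≤ t.card := Finset.card_le_card hsub
  have hS : S.card ≤ (t.card - R.card) + (S ∩ R).card := by
    have h2 : S \ R ⊆ t \ R := Finset.sdiff_subset_sdiff hSt.subset subset_rfl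
    have h3 := Finset.card_le_card h2
    rw [Finset.card_sdiff_of_subset hsub] at h3
    have h4 := Finset.card_sdiff_add_card_inter S R
    omega
  rw [mul_div_assoc', lt_div_iff₀ hRpos]
  have h0 : (0 : ℝ) < 3 ^ (t.card - R.card) := by positivity
  have hu0 : (0 : ℝ) < (S ∩ R).card := by exact_mod_cast hu1
  refine lt_of_lt_of_le ?_ (mul_le_mul_of_nonneg_left hct hu0.le)
  -- If `S` misses part of the core, `mul_three_pow_lt` gives strictness. If `S` contains the whole
  -- core, it omits some other point of `t`, and the strictness comes from `|S| ≤ |t| - 1`.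
  rcases huw.lt_or_eq with huw | huw
  · have h2 := mul_three_pow_lt hu1 huw
    have h3 : (3 : ℝ) ^ S.card ≤ 3 ^ (t.card - R.card) * 3 ^ (S ∩ R).card := by
      rw [← pow_add]
      exact pow_le_pow_right₀ (by norm_num) hS
    calc (3 : ℝ) ^ S.card * R.card ≤ 3 ^ (t.card - R.card) * 3 ^ (S ∩ R).card * R.card :=
          mul_le_mul_of_nonneg_right h3 hRpos.le
      _ = 3 ^ (t.card - R.card) * (R.card * 3 ^ (S ∩ R).card) := by ring
      _ < 3 ^ (t.card - R.card) * ((S ∩ R).card * (3 ^ R.card - 1)) :=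
          mul_lt_mul_of_pos_left h2 h0
      _ = _ := by ring
  · rw [huw, mul_comm]
    refine mul_lt_mul_of_pos_left ?_ hRpos
    have h2 : (3 : ℝ) ^ S.card ≤ 3 ^ (t.card - R.card) * 3 ^ (R.card - 1) := by
      rw [← pow_add]
      exact pow_le_pow_right₀ (by norm_num) (by omega)
    refine lt_of_le_of_lt h2 (mul_lt_mul_of_pos_left ?_ h0)
    obtain ⟨k, hk⟩ : ∃ k, R.card = k + 1 := ⟨R.card - 1, by omega⟩
    rw [hk, Nat.add_sub_cancel, pow_succ]
    have : (1 : ℝ) ≤ 3 ^ k := one_le_pow₀ (by norm_num)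
    linarith

end Laminar

/-! ### Tubings of a graph -/

section Tubings

variable {V : Type*} {G : SimpleGraph V}

/-- Connectedness as a propagation principle: a property holding somewhere and passing along edges
holds everywhere. The later connectivity arguments can then choose a property instead of handling
walks. -/
theorem induce_connected_iff (S : Set V) :
    (G.induce S).Connected ↔ S.Nonempty ∧ ∀ p : V → Prop, (∃ x ∈ S, p x) →
      (∀ y ∈ S, ∀ z ∈ S, G.Adj y z → p y → p z) → ∀ z ∈ S, p z := by
  constructor
  · intro h
    obtain ⟨⟨x0, hx0⟩⟩ := h.nonempty
    refine ⟨⟨x0, hx0⟩, ?_⟩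
    rintro p ⟨x, hx, hpx⟩ hstep z hz
    obtain ⟨w⟩ := h.preconnected ⟨x, hx⟩ ⟨z, hz⟩
    have key : ∀ a b : S, (G.induce S).Walk a b → p a → p b := by
      intro a b w
      induction w with
      | nil => exact id
      | cons hadj _ ih => exact fun ha => ih (hstep _ (Subtype.coe_prop _) _
          (Subtype.coe_prop _) (by simpa using hadj) ha)
    exact key _ _ w hpx
  · rintro ⟨⟨x, hx⟩, h⟩
    have hreach : ∀ z ∈ S, ∃ hz : z ∈ S, (G.induce S).Reachable ⟨x, hx⟩ ⟨z, hz⟩ := by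
      refine h (fun z => ∃ hz : z ∈ S, (G.induce S).Reachable ⟨x, hx⟩ ⟨z, hz⟩)
        ⟨x, hx, hx, SimpleGraph.Reachable.refl _⟩ ?_
      rintro y hy z hz hyz ⟨hy', hr⟩
      exact ⟨hz, hr.trans (SimpleGraph.Adj.reachable (by simpa using hyz))⟩
    have : Nonempty S := ⟨⟨x, hx⟩⟩
    refine SimpleGraph.Connected.mk fun a b => ?_
    obtain ⟨_, ha⟩ := hreach a a.2
    obtain ⟨_, hb⟩ := hreach b b.2
    exact ha.symm.trans hb

/-- A tube of `G`: a proper set of vertices inducing a connected subgraph. -/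
def IsTube [Fintype V] (G : SimpleGraph V) (S : Finset V) : Prop :=
  (G.induce (S : Set V)).Connected ∧ S ≠ Finset.univ

/-- Two tubes are compatible if they are nested, or disjoint and not joined by an edge. -/
def TubeCompat (G : SimpleGraph V) (S T : Finset V) : Prop :=
  S ⊆ T ∨ T ⊆ S ∨ ∀ x ∈ S, ∀ y ∈ T, x ≠ y ∧ ¬ G.Adj x y

/-- A tubing of `G`: a set of pairwise compatible tubes. -/
def IsTubing [Fintype V] (G : SimpleGraph V) (T : Finset (Finset V)) : Prop :=
  (∀ S ∈ T, S ∈ {S | IsTube G S}) ∧ (T : Set (Finset V)).Pairwise (TubeCompat G)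

theorem TubeCompat.symm {S T : Finset V} (h : TubeCompat G S T) : TubeCompat G T S := by
  rcases h with h | h | h
  · exact Or.inr (Or.inl h)
  · exact Or.inl h
  · exact Or.inr (Or.inr fun x hx y hy => ⟨(h y hy x hx).1.symm, fun hxy => (h y hy x hx).2 hxy.symm⟩)

theorem TubeCompat.nested_or_disjoint {S T : Finset V} (h : TubeCompat G S T) :
    S ⊆ T ∨ T ⊆ S ∨ Disjoint S T := by
  rcases h with h | h | h
  · exact Or.inl h
  · exact Or.inr (Or.inl h)
  · exact Or.inr (Or.inr (Finset.disjoint_left.2 fun x hx hx' => (h x hx x hx').1 rfl))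

theorem univ_connected [Fintype V] (hG : G.Connected) :
    (G.induce ((Finset.univ : Finset V) : Set V)).Connected := by
  rw [Finset.coe_univ]
  exact (SimpleGraph.induceUnivIso G).connected_iff.2 hG

variable [DecidableEq V]

/-- Only the failure of the third alternative matters: the sets share a vertex or an edge joins
them, and a property propagates across that contact. -/
theorem induce_union_connected_of_not_compat {S T : Finset V}
    (hS : (G.induce (S : Set V)).Connected) (hT : (G.induce (T : Set V)).Connected)
    (h : ¬ TubeCompat G S T) : (G.induce ((S ∪ T : Finset V) : Set V)).Connected := by
  rw [induce_connected_iff] at hS hT ⊢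
  have h3 : ∃ x ∈ S, ∃ y ∈ T, x = y ∨ G.Adj x y := by
    by_contra h'
    push Not at h'
    exact h (Or.inr (Or.inr h'))
  obtain ⟨x, hx, y, hy, hxy⟩ := h3
  refine ⟨⟨x, by simp [hx]⟩, fun p hp hstep => ?_⟩
  have hstepS := fun y hy z hz => hstep y (Finset.mem_coe.2 (Finset.mem_union_left T hy)) z
    (Finset.mem_coe.2 (Finset.mem_union_left T hz))
  have hstepT := fun y hy z hz => hstep y (Finset.mem_coe.2 (Finset.mem_union_right S hy)) z
    (Finset.mem_coe.2 (Finset.mem_union_right S hz))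
  have hST : (∀ z ∈ S, p z) ∧ ∀ z ∈ T, p z := by
    obtain ⟨z, hz, hpz⟩ := hp
    rcases Finset.mem_union.1 (Finset.mem_coe.1 hz) with hz | hz
    · have h1 := hS.2 p ⟨z, hz, hpz⟩ hstepS
      refine ⟨h1, hT.2 p ⟨y, hy, ?_⟩ hstepT⟩
      rcases hxy with rfl | hxy
      · exact h1 x hx
      · exact hstep x (by simp [hx]) y (by simp [hy]) hxy (h1 x hx)
    · have h1 := hT.2 p ⟨z, hz, hpz⟩ hstepT
      refine ⟨hS.2 p ⟨x, hx, ?_⟩ hstepS, h1⟩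
      rcases hxy with rfl | hxy
      · exact h1 x hy
      · exact hstep y (by simp [hy]) x (by simp [hx]) hxy.symm (h1 y hy)
  intro z hz
  rcases Finset.mem_union.1 (Finset.mem_coe.1 hz) with hz | hz
  · exact hST.1 z hz
  · exact hST.2 z hz

/-- A connected set covered by pairwise compatible sets lies in one of them. -/
theorem exists_subset_of_subset_biUnion {D : Finset (Finset V)}
    (hD : (D : Set (Finset V)).Pairwise (TubeCompat G)) {S : Finset V}
    (hS : (G.induce (S : Set V)).Connected) (hcov : ∀ x ∈ S, ∃ d ∈ D, x ∈ d) : ∃ d ∈ D, S ⊆ d := by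
  rw [induce_connected_iff] at hS
  obtain ⟨⟨x, hx⟩, hS⟩ := hS
  obtain ⟨d0, hd0, hxd0⟩ := hcov x hx
  -- A largest member meeting `S` cannot be left along an edge inside `S`: the member covering the
  -- other endpoint would be larger or, if not nested with it, nonadjacent.
  obtain ⟨d, hd, hmax⟩ := (D.filter fun d => (d ∩ S).Nonempty).exists_max_image Finset.card
    ⟨d0, Finset.mem_filter.2 ⟨hd0, x, Finset.mem_inter.2 ⟨hxd0, hx⟩⟩⟩
  obtain ⟨hdD, y, hy⟩ := Finset.mem_filter.1 hd
  refine ⟨d, hdD, hS (· ∈ d) ⟨y, (Finset.mem_inter.1 hy).2, (Finset.mem_inter.1 hy).1⟩ ?_⟩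
  intro u hu v hv huv hud
  obtain ⟨d', hd', hvd'⟩ := hcov v hv
  by_cases hdd : d = d'
  · exact hdd ▸ hvd'
  rcases hD hdD hd' hdd with h | h | h
  · have := hmax d' (Finset.mem_filter.2 ⟨hd', v, Finset.mem_inter.2 ⟨hvd', hv⟩⟩)
    exact absurd (Finset.eq_of_subset_of_card_le h this) hdd
  · exact h hvd'
  · exact absurd huv (h u hud v hvd').2

variable [Fintype V]

theorem IsTubing.laminar {T : Finset (Finset V)} (hT : IsTubing G T) :
    ∀ s ∈ insert Finset.univ T, ∀ t ∈ insert Finset.univ T, s ⊆ t ∨ t ⊆ s ∨ Disjoint s t := by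
  intro s hs t ht
  rcases Finset.mem_insert.1 hs with rfl | hs
  · exact Or.inr (Or.inl (Finset.subset_univ _))
  rcases Finset.mem_insert.1 ht with rfl | ht
  · exact Or.inl (Finset.subset_univ _)
  by_cases h : s = t
  · exact Or.inl h.subset
  · exact (hT.2 hs ht h).nested_or_disjoint

/-- If `S` avoided the core of `t`, the tubes strictly inside `t` would cover it. Being connected,
it would lie in one of them, against minimality of `t`. -/
theorem IsTubing.core_inter_nonempty {T : Finset (Finset V)} (hT : IsTubing G T) {S t : Finset V}
    (hS : (G.induce (S : Set V)).Connected) (hSt : S ⊆ t)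
    (hmin : ∀ u ∈ insert Finset.univ T, u ⊂ t → ¬ S ⊆ u) :
    (S ∩ laminarCore (insert Finset.univ T) t).Nonempty := by
  by_contra hne
  rw [Finset.not_nonempty_iff_eq_empty, Finset.eq_empty_iff_forall_notMem] at hne
  obtain ⟨d, hd, hSd⟩ := exists_subset_of_subset_biUnion (D := T.filter (· ⊂ t))
    (hT.2.mono fun u hu => (Finset.mem_filter.1 hu).1) hS (by
      intro x hx
      have := hne x
      simp only [Finset.mem_inter, laminarCore, Finset.mem_filter, not_and, not_forall,
        not_not] at this
      obtain ⟨u, hu, hut, hxu⟩ := this hx (hSt hx)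
      refine ⟨u, Finset.mem_filter.2 ⟨?_, hut⟩, hxu⟩
      rcases Finset.mem_insert.1 hu with rfl | hu
      · exact absurd (Finset.subset_univ t) hut.2
      · exact hu)
  obtain ⟨h1, h2⟩ := Finset.mem_filter.1 hd
  exact hmin d (Finset.mem_insert_of_mem h1) h2 hSd

theorem IsTubing.connected (hG : G.Connected) {T : Finset (Finset V)} (hT : IsTubing G T) :
    ∀ t ∈ insert Finset.univ T, (G.induce (t : Set V)).Connected := by
  intro t ht
  rcases Finset.mem_insert.1 ht with rfl | ht
  · exact univ_connected hG
  · exact (hT.1 t ht).1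

theorem IsTubing.core_nonempty (hG : G.Connected) {T : Finset (Finset V)} (hT : IsTubing G T) :
    ∀ t ∈ insert Finset.univ T, (laminarCore (insert Finset.univ T) t).Nonempty := by
  intro t ht
  exact (hT.core_inter_nonempty (hT.connected hG t ht) subset_rfl fun u _ hut => hut.2).mono
    Finset.inter_subset_right

end Tubings

/-! ### Faces of graph-associahedra -/

section Faces

variable {n : ℕ} {G : SimpleGraph (Fin n)}

/-- The points of the graph-associahedron on which the inequalities of the tubes in `T` are
equalities. -/
def tubingFace (G : SimpleGraph (Fin n)) (T : Finset (Finset (Fin n))) : Set (Fin n → ℝ) :=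
  {x | x ∈ graphAssociahedronSet G ∧ ∀ S ∈ T, ∑ i ∈ S, x i = 3 ^ S.card}

/-- The tubes whose inequalities are equalities at `x`. -/
noncomputable def tightTubes (G : SimpleGraph (Fin n)) (x : Fin n → ℝ) : Finset (Finset (Fin n)) := by
  classical
  exact Finset.univ.filter fun S => IsTube G S ∧ ∑ i ∈ S, x i = 3 ^ S.card

theorem mem_tightTubes {x : Fin n → ℝ} {S : Finset (Fin n)} :
    S ∈ tightTubes G x ↔ IsTube G S ∧ ∑ i ∈ S, x i = 3 ^ S.card := by
  simp [tightTubes]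

theorem graphAssociahedronSet_nonneg {x : Fin n → ℝ} (hx : x ∈ graphAssociahedronSet G)
    (i : Fin n) : 0 ≤ x i := by
  by_cases h : ({i} : Finset (Fin n)) = Finset.univ
  · have h1 := hx.1
    rw [← h, Finset.sum_singleton] at h1
    rw [h1]
    positivity
  · have h1 := hx.2 {i} (by
      rw [Finset.coe_singleton]
      exact SimpleGraph.Connected.of_subsingleton) h
    simp only [Finset.card_singleton, Finset.sum_singleton] at h1
    linarith

/-- This is where the bounds `3 ^ |S|` matter. For incompatible tight tubes the union is connected,
so its coordinate sum is at least `3 ^ |S ∪ T|`. By nonnegativity of the coordinates the sum is also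
at most `3 ^ |S| + 3 ^ |T| ≤ 2 * 3 ^ (|S ∪ T| - 1)`, which is smaller. -/
theorem isTubing_tightTubes {x : Fin n → ℝ} (hx : x ∈ graphAssociahedronSet G) :
    IsTubing G (tightTubes G x) := by
  refine ⟨fun S hS => (mem_tightTubes.1 hS).1, ?_⟩
  intro S hS T hT _
  obtain ⟨⟨hSc, hSu⟩, hS⟩ := mem_tightTubes.1 (Finset.mem_coe.1 hS)
  obtain ⟨⟨hTc, hTu⟩, hT⟩ := mem_tightTubes.1 (Finset.mem_coe.1 hT)
  by_contra hcompat
  have hU := induce_union_connected_of_not_compat hSc hTc hcompat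
  have hge : (3 : ℝ) ^ (S ∪ T).card ≤ ∑ i ∈ S ∪ T, x i := by
    by_cases h : S ∪ T = Finset.univ
    · rw [h, hx.1]
      simp
    · exact hx.2 _ hU h
  have hle : ∑ i ∈ S ∪ T, x i ≤ 3 ^ S.card + 3 ^ T.card := by
    rw [← hS, ← hT, ← Finset.sum_union_inter]
    have := Finset.sum_nonneg fun i (_ : i ∈ S ∩ T) => graphAssociahedronSet_nonneg hx i
    linarith
  have hlt1 : S.card < (S ∪ T).card := Finset.card_lt_card
    (Finset.ssubset_iff_subset_ne.2 ⟨Finset.subset_union_left, fun h =>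
      hcompat (Or.inr (Or.inl (h ▸ Finset.subset_union_right)))⟩)
  have hlt2 : T.card < (S ∪ T).card := Finset.card_lt_card
    (Finset.ssubset_iff_subset_ne.2 ⟨Finset.subset_union_right, fun h =>
      hcompat (Or.inl (h ▸ Finset.subset_union_left))⟩)
  obtain ⟨k, hk⟩ : ∃ k, (S ∪ T).card = k + 1 := ⟨(S ∪ T).card - 1, by omega⟩
  rw [hk] at hge hlt1 hlt2
  have h1 : (3 : ℝ) ^ S.card ≤ 3 ^ k := pow_le_pow_right₀ (by norm_num) (by omega)
  have h2 : (3 : ℝ) ^ T.card ≤ 3 ^ k := pow_le_pow_right₀ (by norm_num) (by omega)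
  have h3 : (0 : ℝ) < 3 ^ k := by positivity
  rw [pow_succ] at hge
  linarith

/-- Every tubing is the set of tight tubes of some point. -/
theorem exists_tightTubes_eq (hG : G.Connected) {T : Finset (Finset (Fin n))}
    (hT : IsTubing G T) : ∃ x ∈ graphAssociahedronSet G, tightTubes G x = T := by
  obtain ⟨c, hc⟩ := exists_sum_subset_eq (insert Finset.univ T) fun t => (3 : ℝ) ^ t.card
  have hL := hT.laminar
  have hcore := hT.core_nonempty hG
  have hne : ∀ t ∈ insert Finset.univ T, t.Nonempty := fun t ht =>
    (hcore t ht).mono (laminarCore_subset _ _)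
  have hsum : ∀ t ∈ insert Finset.univ T,
      ∑ i ∈ t, laminarPoint (insert Finset.univ T) c i = 3 ^ t.card := fun t ht => by
    rw [sum_laminarPoint hL hcore c ht, hc t ht]
  have hlt : ∀ S : Finset (Fin n), (G.induce (S : Set (Fin n))).Connected → S ∉ insert Finset.univ T →
      (3 : ℝ) ^ S.card < ∑ i ∈ S, laminarPoint (insert Finset.univ T) c i := by
    intro S hS hST
    -- Minimality of `t` among the members containing `S` forces `S` to meet the core of `t`, as the
    -- strict estimate requires.
    obtain ⟨t, ht, hmin⟩ := ((insert Finset.univ T).filter (S ⊆ ·)).exists_min_image Finset.card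
      ⟨Finset.univ, by simp⟩
    obtain ⟨ht, hSt⟩ := Finset.mem_filter.1 ht
    refine three_pow_card_lt_sum hL hne hc ht
      (Finset.ssubset_iff_subset_ne.2 ⟨hSt, fun h => hST (h ▸ ht)⟩)
      (hT.core_inter_nonempty hS hSt fun u hu hut hSu => ?_)
    have := hmin u (Finset.mem_filter.2 ⟨hu, hSu⟩)
    exact absurd (Finset.card_lt_card hut) (not_lt.2 this)
  refine ⟨laminarPoint (insert Finset.univ T) c, ⟨?_, ?_⟩, ?_⟩
  · simpa using hsum Finset.univ (Finset.mem_insert_self _ _)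
  · intro S hS _
    by_cases h : S ∈ insert Finset.univ T
    · exact (hsum S h).ge
    · exact (hlt S hS h).le
  · ext S
    rw [mem_tightTubes]
    constructor
    · rintro ⟨⟨hS, hSu⟩, h⟩
      by_contra hST
      exact (hlt S hS (by simp [hSu, hST])).ne' h
    · exact fun h => ⟨hT.1 S h, hsum S (Finset.mem_insert_of_mem h)⟩

theorem mem_tubingFace_iff {T : Finset (Finset (Fin n))} (hT : ∀ S ∈ T, IsTube G S)
    {x : Fin n → ℝ} :
    x ∈ tubingFace G T ↔ x ∈ graphAssociahedronSet G ∧ T ⊆ tightTubes G x :=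
  and_congr_right fun _ => ⟨fun h S hS => mem_tightTubes.2 ⟨hT S hS, h S hS⟩,
    fun h _ hS => (mem_tightTubes.1 (h hS)).2⟩

/-- From a point of a tubing face with only these tight tubes one can move a little in every
direction preserving the corresponding equalities. -/
theorem exists_add_smul_mem {T : Finset (Finset (Fin n))} {z v : Fin n → ℝ}
    (hz : z ∈ graphAssociahedronSet G) (hzT : tightTubes G z = T) (hv0 : ∑ i, v i = 0)
    (hv : ∀ S ∈ T, ∑ i ∈ S, v i = 0) : ∃ ε : ℝ, 0 < ε ∧ z + ε • v ∈ tubingFace G T := by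
  have hsum : ∀ (ε : ℝ) (S : Finset (Fin n)),
      ∑ i ∈ S, (z + ε • v) i = ∑ i ∈ S, z i + ε * ∑ i ∈ S, v i := by
    intro ε S
    simp [Finset.sum_add_distrib, Finset.mul_sum]
  have hev : ∀ᶠ ε : ℝ in nhds 0, ∀ S : Finset (Fin n), IsTube G S → S ∉ T →
      3 ^ S.card < ∑ i ∈ S, (z + ε • v) i := by
    rw [Filter.eventually_all]
    intro S
    by_cases hS : IsTube G S ∧ S ∉ T
    · have hlt : 3 ^ S.card < ∑ i ∈ S, z i := by
        refine lt_of_le_of_ne (hz.2 S hS.1.1 hS.1.2) fun h => hS.2 ?_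
        rw [← hzT, mem_tightTubes]
        exact ⟨hS.1, h.symm⟩
      have hcont : Continuous fun ε : ℝ => ∑ i ∈ S, z i + ε * ∑ i ∈ S, v i := by fun_prop
      have h0 := hcont.tendsto 0
      simp only [zero_mul, add_zero] at h0
      filter_upwards [h0.eventually (lt_mem_nhds hlt)] with ε hε _ _
      rw [hsum]
      exact hε
    · exact Filter.Eventually.of_forall fun ε h1 h2 => absurd ⟨h1, h2⟩ hS
  obtain ⟨ε, hε, hpos⟩ := ((hev.filter_mono nhdsWithin_le_nhds).and
    (self_mem_nhdsWithin : Set.Ioi (0 : ℝ) ∈ nhdsWithin 0 (Set.Ioi 0))).exists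
  have heq : ∀ S ∈ T, ∑ i ∈ S, (z + ε • v) i = 3 ^ S.card := by
    intro S hS
    rw [hsum, hv S hS, mul_zero, add_zero]
    rw [← hzT] at hS
    exact (mem_tightTubes.1 hS).2
  refine ⟨ε, hpos, ⟨?_, ?_⟩, heq⟩
  · rw [hsum, hv0, mul_zero, add_zero, hz.1]
  · intro S hS hSu
    by_cases h : S ∈ T
    · exact (heq S h).ge
    · exact (hε S ⟨hS, hSu⟩ h).le

theorem tubingFace_subset {T U : Finset (Finset (Fin n))} (h : T ⊆ U) :
    tubingFace G U ⊆ tubingFace G T :=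
  fun _ hx => ⟨hx.1, fun S hS => hx.2 S (h hS)⟩

theorem tubingFace_nonempty (hG : G.Connected) {T : Finset (Finset (Fin n))} (hT : IsTubing G T) :
    (tubingFace G T).Nonempty := by
  obtain ⟨x, hx, hxT⟩ := exists_tightTubes_eq hG hT
  exact ⟨x, (mem_tubingFace_iff hT.1).2 ⟨hx, hxT.ge⟩⟩

/-- Minus the sum of all tube sums over `U` exposes the face: every summand is bounded below, so the
minimum total is reached only when all these inequalities are tight. -/
theorem isExposed_tubingFace {T U : Finset (Finset (Fin n))} (hTU : T ⊆ U) (hU : IsTubing G U) :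
    IsExposed ℝ (tubingFace G T) (tubingFace G U) := by
  rintro ⟨x0, hx0⟩
  let l : (Fin n → ℝ) →L[ℝ] ℝ := -∑ S ∈ U, ∑ i ∈ S,
    ContinuousLinearMap.proj (R := ℝ) (φ := fun _ : Fin n => ℝ) i
  have hl : ∀ x, l x = -∑ S ∈ U, ∑ i ∈ S, x i := fun x => by simp [l]
  have hle : ∀ x ∈ graphAssociahedronSet G, ∀ S ∈ U, (3 : ℝ) ^ S.card ≤ ∑ i ∈ S, x i :=
    fun x hx S hS => hx.2 S (hU.1 S hS).1 (hU.1 S hS).2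
  refine ⟨l, ?_⟩
  ext x
  simp only [Set.mem_ofPred_eq, hl, neg_le_neg_iff]
  constructor
  · refine fun hx => ⟨tubingFace_subset hTU hx, fun y hy => ?_⟩
    rw [Finset.sum_congr rfl hx.2]
    exact Finset.sum_le_sum (hle y hy.1)
  · rintro ⟨hx, hmin⟩
    have h1 := hmin x0 (tubingFace_subset hTU hx0)
    rw [Finset.sum_congr rfl hx0.2] at h1
    have h2 := (Finset.sum_eq_sum_iff_of_le (hle x hx.1)).1
      (le_antisymm (Finset.sum_le_sum (hle x hx.1)) h1)
    exact ⟨hx.1, fun S hS => (h2 S hS).symm⟩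

/-- A point whose tight tubes are exactly `U` detects which tubing faces contain the face of `U`. -/
theorem tubingFace_le_iff (hG : G.Connected) {T U : Finset (Finset (Fin n))} (hT : IsTubing G T)
    (hU : IsTubing G U) : tubingFace G U ⊆ tubingFace G T ↔ T ⊆ U := by
  refine ⟨fun h => ?_, tubingFace_subset⟩
  obtain ⟨x, hx, hxU⟩ := exists_tightTubes_eq hG hU
  have := h ((mem_tubingFace_iff hU.1).2 ⟨hx, hxU.ge⟩)
  rw [mem_tubingFace_iff hT.1, hxU] at this
  exact this.2

theorem convex_tubingFace (T : Finset (Finset (Fin n))) : Convex ℝ (tubingFace G T) := by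
  intro x hx y hy a b ha hb hab
  have hsum : ∀ S : Finset (Fin n), ∑ i ∈ S, (a • x + b • y) i =
      a * ∑ i ∈ S, x i + b * ∑ i ∈ S, y i := by
    intro S
    simp [Finset.sum_add_distrib, Finset.mul_sum]
  have hab' : ∀ r : ℝ, a * r + b * r = r := fun r => by rw [← add_mul, hab, one_mul]
  refine ⟨⟨?_, fun S hS hSu => ?_⟩, fun S hS => ?_⟩
  · rw [hsum, hx.1.1, hy.1.1, hab']
  · rw [hsum, ← hab' (3 ^ S.card)]
    exact add_le_add (mul_le_mul_of_nonneg_left (hx.1.2 S hS hSu) ha)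
      (mul_le_mul_of_nonneg_left (hy.1.2 S hS hSu) hb)
  · rw [hsum, hx.2 S hS, hy.2 S hS, hab']

/-- Every face of a tubing face is a tubing face. -/
theorem exists_eq_tubingFace {T : Finset (Finset (Fin n))} (hT : IsTubing G T)
    (F : Face (tubingFace G T)) : ∃ U, IsTubing G U ∧ T ⊆ U ∧ F.1 = tubingFace G U := by
  obtain ⟨F, ⟨x0, hx0⟩, hexp⟩ := F
  have hconv : Convex ℝ F := hexp.convex (convex_tubingFace T)
  have hFP : ∀ x ∈ F, x ∈ graphAssociahedronSet G := fun x hx => (hexp.subset hx).1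
  -- Such a `z` plays the role of a relative interior point of `F`. At a midpoint of `z` and `w`
  -- only tubes tight at both are tight, so minimality makes every tube tight at `z` tight on all of
  -- `F`.
  obtain ⟨z, hzF, hzmin⟩ : ∃ z ∈ F, ∀ w ∈ F, (tightTubes G z).card ≤ (tightTubes G w).card := by
    have hne : ((fun z => (tightTubes G z).card) '' F).Nonempty := ⟨_, x0, hx0, rfl⟩
    obtain ⟨z, hz, hzeq⟩ := Nat.sInf_mem hne
    exact ⟨z, hz, fun w hw => hzeq.trans_le (Nat.sInf_le ⟨w, hw, rfl⟩)⟩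
  have htight : ∀ w ∈ F, tightTubes G z ⊆ tightTubes G w := by
    intro w hw S hS
    set u : Fin n → ℝ := (1 / 2 : ℝ) • z + (1 / 2 : ℝ) • w
    have huF : u ∈ F := hconv hzF hw (by norm_num) (by norm_num) (by norm_num)
    have hsum : ∀ S : Finset (Fin n), ∑ i ∈ S, u i =
        (1 / 2) * ∑ i ∈ S, z i + (1 / 2) * ∑ i ∈ S, w i := by
      intro S
      simp [u, Finset.sum_add_distrib, Finset.mul_sum]
    have hboth : ∀ S ∈ tightTubes G u, S ∈ tightTubes G z ∧ S ∈ tightTubes G w := by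
      intro S hS
      obtain ⟨h1, h2⟩ := mem_tightTubes.1 hS
      rw [hsum] at h2
      have h3 := (hFP z hzF).2 S h1.1 h1.2
      have h4 := (hFP w hw).2 S h1.1 h1.2
      exact ⟨mem_tightTubes.2 ⟨h1, by linarith⟩, mem_tightTubes.2 ⟨h1, by linarith⟩⟩
    have heq := Finset.eq_of_subset_of_card_le (fun S hS => (hboth S hS).1) (hzmin u huF)
    exact (hboth S (heq ▸ hS)).2
  refine ⟨tightTubes G z, isTubing_tightTubes (hFP z hzF),
    ((mem_tubingFace_iff hT.1).1 (hexp.subset hzF)).2, Set.Subset.antisymm ?_ ?_⟩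
  · exact fun w hw => (mem_tubingFace_iff (isTubing_tightTubes (hFP z hzF)).1).2
      ⟨hFP w hw, htight w hw⟩
  · intro y hy
    have hTz : T ⊆ tightTubes G z := ((mem_tubingFace_iff hT.1).1 (hexp.subset hzF)).2
    -- Moving from `z` slightly away from `y` stays in the polytope; since the functional exposing
    -- `F` is maximal at `z`, it cannot be smaller at `y`.
    obtain ⟨ε, hε, hmem⟩ := exists_add_smul_mem (v := z - y) (hFP z hzF) rfl
      (by simp [Finset.sum_sub_distrib, (hFP z hzF).1, hy.1.1])
      (by
        intro S hS
        simp [Finset.sum_sub_distrib, (mem_tightTubes.1 hS).2, hy.2 S hS])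
    obtain ⟨l, hl⟩ := hexp ⟨x0, hx0⟩
    change y ∈ F
    rw [hl] at hzF ⊢
    have h1 := hzF.2 _ (tubingFace_subset hTz hmem)
    simp only [map_add, map_smul, map_sub, smul_eq_mul] at h1
    have h2 : l z ≤ l y := by
      by_contra hlt
      push Not at hlt
      have : 0 < ε * (l z - l y) := mul_pos hε (sub_pos.2 hlt)
      linarith
    exact ⟨tubingFace_subset hTz hy, fun w hw => (hzF.2 w hw).trans h2⟩

/-- The faces of a tubing face correspond to the tubings refining the given one. -/
noncomputable def tubingFaceIso (hG : G.Connected) {T : Finset (Finset (Fin n))}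
    (hT : IsTubing G T) :
    (CliqueStar {S | IsTube G S} (TubeCompat G) T)ᵒᵈ ≃o Face (tubingFace G T) :=
  RelIso.ofSurjective (OrderEmbedding.ofMapLEIff
    (fun X : (CliqueStar {S | IsTube G S} (TubeCompat G) T)ᵒᵈ =>
      (⟨tubingFace G (OrderDual.ofDual X).1,
        tubingFace_nonempty hG ⟨(OrderDual.ofDual X).2.1, (OrderDual.ofDual X).2.2.1⟩,
        isExposed_tubingFace (OrderDual.ofDual X).2.2.2
          ⟨(OrderDual.ofDual X).2.1, (OrderDual.ofDual X).2.2.1⟩⟩ : Face (tubingFace G T)))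
    fun X Y => tubingFace_le_iff hG ⟨(OrderDual.ofDual Y).2.1, (OrderDual.ofDual Y).2.2.1⟩
      ⟨(OrderDual.ofDual X).2.1, (OrderDual.ofDual X).2.2.1⟩)
    fun F => by
      obtain ⟨U, hU, hTU, hF⟩ := exists_eq_tubingFace hT F
      exact ⟨OrderDual.toDual ⟨U, hU.1, hU.2, hTU⟩, Subtype.ext hF.symm⟩

/-- The direction space is the kernel of the sums over the tubes and over all vertices: a point with
no other tight tubes can move in every such direction. These `|T| + 1` functionals are independent
because every core is nonempty, so rank-nullity gives the dimension. -/
theorem finrank_vectorSpan_tubingFace (hG : G.Connected) {T : Finset (Finset (Fin n))}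
    (hT : IsTubing G T) : Module.finrank ℝ (vectorSpan ℝ (tubingFace G T)) + (T.card + 1) = n := by
  set L := insert Finset.univ T with hLdef
  let f : (Fin n → ℝ) →ₗ[ℝ] (L → ℝ) := LinearMap.pi fun t => ∑ i ∈ t.1, LinearMap.proj i
  have hf : ∀ x t, f x t = ∑ i ∈ t.1, x i := fun x t => by simp [f]
  have hsurj : Function.Surjective f := by
    intro y
    obtain ⟨x, hx⟩ := exists_sum_eq hT.laminar (hT.core_nonempty hG)
      (fun t => if h : t ∈ L then y ⟨t, h⟩ else 0)
    refine ⟨x, funext fun t => ?_⟩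
    rw [hf, hx t.1 t.2, dif_pos t.2]
  have hker : vectorSpan ℝ (tubingFace G T) = LinearMap.ker f := by
    apply le_antisymm
    · rw [vectorSpan_def, Submodule.span_le]
      rintro _ ⟨x, hx, y, hy, rfl⟩
      rw [SetLike.mem_coe, LinearMap.mem_ker]
      funext t
      rw [hf]
      rcases Finset.mem_insert.1 t.2 with ht | ht
      · simp [ht, Finset.sum_sub_distrib, hx.1.1, hy.1.1]
      · simp [Finset.sum_sub_distrib, hx.2 _ ht, hy.2 _ ht]
    · intro v hv
      have hv' : ∀ t ∈ L, ∑ i ∈ t, v i = 0 := fun t ht => by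
        have := congrFun (LinearMap.mem_ker.1 hv) ⟨t, ht⟩
        rwa [hf] at this
      obtain ⟨z, hz, hzT⟩ := exists_tightTubes_eq hG hT
      obtain ⟨ε, hε, hmem⟩ := exists_add_smul_mem hz hzT
        (hv' Finset.univ (Finset.mem_insert_self _ _))
        fun S hS => hv' S (Finset.mem_insert_of_mem hS)
      have h1 := vsub_mem_vectorSpan ℝ hmem ((mem_tubingFace_iff hT.1).2 ⟨hz, hzT.ge⟩)
      rw [vsub_eq_sub, add_sub_cancel_left] at h1
      simpa [smul_smul, inv_mul_cancel₀ hε.ne'] using Submodule.smul_mem _ ε⁻¹ h1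
  have hrank := LinearMap.finrank_range_add_finrank_ker f
  rw [LinearMap.range_eq_top.2 hsurj, finrank_top, ← hker] at hrank
  have hLcard : L.card = T.card + 1 :=
    Finset.card_insert_of_notMem fun h => (hT.1 _ h).2 rfl
  simp only [Module.finrank_fintype_fun_eq_card, Fintype.card_coe, Fintype.card_fin, hLcard] at hrank
  omega

end Faces

/-! ### Motivic interiors as signed sums over tubings -/

section MotivicInterior

variable {n : ℕ} {G : SimpleGraph (Fin n)}

/-- The set of tubings of `G`. -/
noncomputable def tubings (G : SimpleGraph (Fin n)) : Finset (Finset (Finset (Fin n))) := by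
  classical
  exact Finset.univ.filter (IsTubing G)

theorem mem_tubings {T : Finset (Finset (Fin n))} : T ∈ tubings G ↔ IsTubing G T := by
  simp [tubings]

theorem isTubing_empty : IsTubing G ∅ := ⟨by simp, by simp⟩

theorem tubingFace_empty : tubingFace G ∅ = graphAssociahedronSet G := by
  ext x
  simp [tubingFace]

variable [NeZero n]

/-- The face of the graph-associahedron defined by a tubing. -/
def tubingFaceOf (hG : G.Connected) {T : Finset (Finset (Fin n))} (hT : IsTubing G T) :
    Face (graphAssociahedron G).carrier :=
  ⟨tubingFace G T, tubingFace_nonempty hG hT,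
    by
      have := isExposed_tubingFace (Finset.empty_subset T) hT
      rwa [tubingFace_empty] at this⟩

/-- The class in the polytopal ring of the face defined by a tubing. -/
noncomputable def tubingClass (G : SimpleGraph (Fin n)) (T : Finset (Finset (Fin n))) :
    PolytopeRing :=
  posetClass (CliqueStar {S | IsTube G S} (TubeCompat G) T)ᵒᵈ

theorem exists_polytope_of_isTubing (hG : G.Connected) {T : Finset (Finset (Fin n))}
    (hT : IsTubing G T) : ∃ P : Polytope,
      Nonempty (Face P.carrier ≃o (CliqueStar {S | IsTube G S} (TubeCompat G) T)ᵒᵈ) :=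
  ⟨(graphAssociahedron G).ofFace (tubingFaceOf hG hT), ⟨(tubingFaceIso hG hT).symm⟩⟩

theorem tubingClass_eq (hG : G.Connected) {T : Finset (Finset (Fin n))} (hT : IsTubing G T) :
    tubingClass G T = ((graphAssociahedron G).ofFace (tubingFaceOf hG hT)).toRing :=
  posetClass_eq ((graphAssociahedron G).ofFace (tubingFaceOf hG hT)) (tubingFaceIso hG hT).symm

theorem tubingClass_empty (hG : G.Connected) :
    tubingClass G ∅ = (graphAssociahedron G).toRing := by
  have h : Nonempty (Face (graphAssociahedron G).carrier ≃o
      (CliqueStar {S | IsTube G S} (TubeCompat G) ∅)ᵒᵈ) := by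
    change Nonempty (Face (graphAssociahedronSet G) ≃o _)
    rw [← tubingFace_empty]
    exact ⟨(tubingFaceIso hG isTubing_empty).symm⟩
  obtain ⟨e⟩ := h
  exact posetClass_eq _ e

theorem codim_tubingFaceOf (hG : G.Connected) {T : Finset (Finset (Fin n))} (hT : IsTubing G T) :
    (graphAssociahedron G).codim (tubingFaceOf hG hT) = T.card := by
  have h1 := finrank_vectorSpan_tubingFace hG hT
  have h2 := finrank_vectorSpan_tubingFace hG (isTubing_empty (G := G))
  rw [tubingFace_empty, Finset.card_empty] at h2
  change Module.finrank ℝ (vectorSpan ℝ (graphAssociahedronSet G)) -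
    Module.finrank ℝ (vectorSpan ℝ (tubingFace G T)) = T.card
  omega

/-- The motivic interior of a graph-associahedron as a sum over tubings. -/
theorem motivicInterior_graphAssociahedron (hG : G.Connected) :
    (graphAssociahedron G).motivicInterior =
      ∑ T ∈ tubings G, (-1) ^ T.card * tubingClass G T := by
  rw [Polytope.motivicInterior, Polytope.facePolynomial, Polynomial.eval_finsetSum]
  symm
  refine Finset.sum_bij (fun T hT => tubingFaceOf hG (mem_tubings.1 hT))
    (fun _ _ => Finset.mem_univ _) ?_ ?_ ?_
  · intro T hT U hU h
    have h' : tubingFace G T = tubingFace G U := congrArg Subtype.val h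
    exact Finset.Subset.antisymm
      ((tubingFace_le_iff hG (mem_tubings.1 hT) (mem_tubings.1 hU)).1 h'.ge)
      ((tubingFace_le_iff hG (mem_tubings.1 hU) (mem_tubings.1 hT)).1 h'.le)
  · intro F _
    have hsurj : ∀ F : Face (graphAssociahedronSet G), ∃ U, IsTubing G U ∧ F.1 = tubingFace G U := by
      rw [← tubingFace_empty]
      intro F
      obtain ⟨U, hU, -, hFU⟩ := exists_eq_tubingFace isTubing_empty F
      exact ⟨U, hU, hFU⟩
    obtain ⟨U, hU, hFU⟩ := hsurj F
    exact ⟨U, mem_tubings.2 hU, Subtype.ext hFU.symm⟩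
  · intro T hT
    rw [tubingClass_eq hG (mem_tubings.1 hT), ← codim_tubingFaceOf hG (mem_tubings.1 hT)]
    rw [Polynomial.eval_mul, Polynomial.eval_C, Polynomial.eval_pow, Polynomial.eval_X, mul_comm]

end MotivicInterior

/-! ### Tubes of paths and cycles in coordinates -/

section Coordinates

/-- The pair `(i, j)` stands for the interval `[i, j)`; two intervals are separated if they are
nested or have a gap between them. -/
def IntervalCompat (t u : ℕ × ℕ) : Prop :=
  (u.1 ≤ t.1 ∧ t.2 ≤ u.2) ∨ (t.1 ≤ u.1 ∧ u.2 ≤ t.2) ∨ t.2 < u.1 ∨ u.2 < t.1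

/-- The proper nonempty intervals in `[0, n)`. -/
def pathTubes (n : ℕ) : Set (ℕ × ℕ) := {t | t.1 < t.2 ∧ t.2 ≤ n ∧ ¬ (t.1 = 0 ∧ t.2 = n)}

/-- Proper arcs of the cycle on `0, …, N`: `inl (i, j)` is the arc `[i, j)` and `inr (i, j)` is its
complement, where `[i, j)` is a nonempty interval in `[0, N)`. -/
def cycleTubes (N : ℕ) : Set (ℕ × ℕ ⊕ ℕ × ℕ) :=
  {t | (Sum.elim id id t).1 < (Sum.elim id id t).2 ∧ (Sum.elim id id t).2 ≤ N}

/-- Compatibility of arcs of a cycle. -/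
def ArcCompat : ℕ × ℕ ⊕ ℕ × ℕ → ℕ × ℕ ⊕ ℕ × ℕ → Prop
  | .inl t, .inl u => IntervalCompat t u
  | .inl t, .inr u => t.2 ≤ u.1 ∨ u.2 ≤ t.1 ∨ (u.1 < t.1 ∧ t.2 < u.2)
  | .inr t, .inl u => u.2 ≤ t.1 ∨ t.2 ≤ u.1 ∨ (t.1 < u.1 ∧ u.2 < t.2)
  | .inr t, .inr u => (u.1 ≤ t.1 ∧ t.2 ≤ u.2) ∨ (t.1 ≤ u.1 ∧ u.2 ≤ t.2)

/-- The vertices in an interval. -/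
def intervalFinset (n : ℕ) (t : ℕ × ℕ) : Finset (Fin n) :=
  Finset.univ.filter fun x => t.1 ≤ x.1 ∧ x.1 < t.2

/-- The vertices in an arc. -/
def arcFinset (N : ℕ) : ℕ × ℕ ⊕ ℕ × ℕ → Finset (Fin (N + 1)) :=
  Sum.elim (intervalFinset (N + 1)) fun t => (intervalFinset (N + 1) t)ᶜ

theorem mem_intervalFinset {n : ℕ} {t : ℕ × ℕ} {x : Fin n} :
    x ∈ intervalFinset n t ↔ t.1 ≤ x.1 ∧ x.1 < t.2 := by
  simp [intervalFinset]

theorem intervalFinset_subset {n : ℕ} {t u : ℕ × ℕ} (ht : t.1 < t.2) (htn : t.2 ≤ n) :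
    intervalFinset n t ⊆ intervalFinset n u ↔ u.1 ≤ t.1 ∧ t.2 ≤ u.2 := by
  constructor
  · intro h
    have h1 := mem_intervalFinset.1 (@h ⟨t.1, by omega⟩ (mem_intervalFinset.2 ⟨le_rfl, ht⟩))
    have h2 := mem_intervalFinset.1 (@h ⟨t.2 - 1, by omega⟩
      (mem_intervalFinset.2 ⟨by simp only; omega, by simp only; omega⟩))
    simp only at h1 h2
    omega
  · intro h x hx
    rw [mem_intervalFinset] at hx ⊢
    omega

theorem exists_eq_intervalFinset {n : ℕ} {S : Finset (Fin n)} (hne : S.Nonempty)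
    (hS : ∀ x ∈ S, ∀ z ∈ S, ∀ y, x < y → y < z → y ∈ S) :
    ∃ t : ℕ × ℕ, t.1 < t.2 ∧ t.2 = (S.max' hne).1 + 1 ∧ intervalFinset n t = S := by
  refine ⟨((S.min' hne).1, (S.max' hne).1 + 1), ?_, rfl, ?_⟩
  · have := S.min'_le_max' hne
    exact Nat.lt_succ_of_le this
  · ext x
    rw [mem_intervalFinset]
    constructor
    · rintro ⟨h1, h2⟩
      rcases (show S.min' hne ≤ x from h1).eq_or_lt with h | h
      · exact h ▸ S.min'_mem hne
      rcases (show x ≤ S.max' hne from Nat.lt_succ_iff.1 h2).eq_or_lt with h' | h'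
      · exact h' ▸ S.max'_mem hne
      · exact hS _ (S.min'_mem hne) _ (S.max'_mem hne) x h h'
    · exact fun hx => ⟨S.min'_le x hx, Nat.lt_succ_of_le (S.le_max' x hx)⟩

/-- Only the edges between consecutive vertices are required, so this serves both the path and the
cycle. -/
theorem intervalFinset_connected {n : ℕ} {G : SimpleGraph (Fin n)}
    (hG : ∀ u v : Fin n, u.1 + 1 = v.1 → G.Adj u v) {t : ℕ × ℕ} (ht : t.1 < t.2) (htn : t.2 ≤ n) :
    (G.induce (intervalFinset n t : Set (Fin n))).Connected := by
  rw [induce_connected_iff]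
  refine ⟨⟨⟨t.1, by omega⟩, Finset.mem_coe.2 (mem_intervalFinset.2 ⟨le_rfl, ht⟩)⟩, ?_⟩
  rintro p ⟨x, hx, hpx⟩ hstep
  have hx' := mem_intervalFinset.1 (Finset.mem_coe.1 hx)
  have hmem : ∀ k (hk : k < n), t.1 ≤ k → k < t.2 →
      (⟨k, hk⟩ : Fin n) ∈ (intervalFinset n t : Set (Fin n)) :=
    fun k hk h1 h2 => Finset.mem_coe.2 (mem_intervalFinset.2 ⟨h1, h2⟩)
  have hup : ∀ k, x.1 ≤ k → k < t.2 → ∀ hk : k < n, p ⟨k, hk⟩ := by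
    intro k hk
    induction k, hk using Nat.le_induction with
    | base => exact fun _ _ => hpx
    | succ k hk ih =>
      intro hkt hkn
      exact hstep ⟨k, by omega⟩ (hmem k _ (by omega) (by omega)) _ (hmem (k + 1) hkn (by omega) hkt)
        (hG _ _ rfl) (ih (by omega) _)
  have hdown : ∀ d, d ≤ x.1 - t.1 → ∀ hk : x.1 - d < n, p ⟨x.1 - d, hk⟩ := by
    intro d
    induction d with
    | zero => exact fun _ _ => hpx
    | succ d ih =>
      intro hd hk
      exact hstep ⟨x.1 - d, by omega⟩ (hmem _ _ (by omega) (by omega)) _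
        (hmem _ hk (by omega) (by omega)) (hG _ _ (by simp only; omega)).symm (ih (by omega) _)
  intro z hz
  have hz' := mem_intervalFinset.1 (Finset.mem_coe.1 hz)
  rcases le_total x.1 z.1 with h | h
  · exact hup z.1 h hz'.2 z.2
  · have := hdown (x.1 - z.1) (by omega) (by omega)
    have hzz : (⟨x.1 - (x.1 - z.1), by omega⟩ : Fin n) = z := Fin.ext (by simp only; omega)
    rwa [hzz] at this

/-- Adjacency is prescribed only between the two intervals, so the statement also applies to a cycle
when both avoid the last vertex, where the closing edge cannot occur. -/
theorem intervalFinset_nonadj {n : ℕ} {G : SimpleGraph (Fin n)} {t u : ℕ × ℕ}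
    (hG : ∀ x ∈ intervalFinset n t, ∀ y ∈ intervalFinset n u,
      G.Adj x y ↔ x.1 + 1 = y.1 ∨ y.1 + 1 = x.1)
    (ht : t.1 < t.2) (htn : t.2 ≤ n) (hu : u.1 < u.2) (hun : u.2 ≤ n) :
    (∀ x ∈ intervalFinset n t, ∀ y ∈ intervalFinset n u, x ≠ y ∧ ¬ G.Adj x y) ↔
      t.2 < u.1 ∨ u.2 < t.1 := by
  constructor
  · intro h
    have h' : ∀ a b (_ : a < n) (_ : b < n), t.1 ≤ a → a < t.2 → u.1 ≤ b → b < u.2 →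
        a ≠ b ∧ a + 1 ≠ b ∧ b + 1 ≠ a := by
      intro a b ha hb h1 h2 h3 h4
      have hx : (⟨a, ha⟩ : Fin n) ∈ intervalFinset n t := mem_intervalFinset.2 ⟨h1, h2⟩
      have hy : (⟨b, hb⟩ : Fin n) ∈ intervalFinset n u := mem_intervalFinset.2 ⟨h3, h4⟩
      have := h _ hx _ hy
      rw [hG _ hx _ hy] at this
      simp only [ne_eq, Fin.mk.injEq, not_or] at this
      exact ⟨this.1, this.2.1, this.2.2⟩
    by_contra hcon
    rcases lt_or_ge u.1 t.2 with h1 | h1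
    · rcases lt_or_ge t.1 u.2 with h2 | h2
      · have := h' (max t.1 u.1) (max t.1 u.1) (by omega) (by omega) (by omega) (by omega)
          (by omega) (by omega)
        omega
      · have := h' t.1 (u.2 - 1) (by omega) (by omega) (by omega) (by omega) (by omega) (by omega)
        omega
    · have := h' (t.2 - 1) u.1 (by omega) (by omega) (by omega) (by omega) (by omega) (by omega)
      omega
  · intro h x hx y hy
    rw [hG x hx y hy]
    rw [mem_intervalFinset] at hx hy
    refine ⟨fun hxy => ?_, by omega⟩
    rw [hxy] at hx
    omega

theorem intervalFinset_injOn (n : ℕ) : Set.InjOn (intervalFinset n) {t | t.1 < t.2 ∧ t.2 ≤ n} := by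
  rintro t ⟨ht, htn⟩ u ⟨hu, hun⟩ h
  have h1 := (intervalFinset_subset ht htn).1 h.subset
  have h2 := (intervalFinset_subset hu hun).1 h.symm.subset
  exact Prod.ext (by omega) (by omega)

/-! ### Tubes of the path -/

theorem path_adj {n : ℕ} {u v : Fin n} :
    (SimpleGraph.pathGraph n).Adj u v ↔ u.1 + 1 = v.1 ∨ v.1 + 1 = u.1 :=
  SimpleGraph.pathGraph_adj

theorem intervalFinset_eq_univ {n : ℕ} {t : ℕ × ℕ} (ht : t.1 < t.2) (htn : t.2 ≤ n) :
    intervalFinset n t = Finset.univ ↔ t.1 = 0 ∧ t.2 = n := by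
  have h0 : intervalFinset n (0, n) = Finset.univ := by
    ext x
    simp [mem_intervalFinset]
  constructor
  · intro h
    have := (intervalFinset_subset (n := n) (t := (0, n)) (u := t) (by simp only; omega) le_rfl).1
      (by rw [h]; exact Finset.subset_univ _)
    simp only at this
    omega
  · rintro ⟨h1, h2⟩
    rw [← h0, ← h1, ← h2]

theorem image_pathTubes (n : ℕ) :
    intervalFinset n '' pathTubes n = {S | IsTube (SimpleGraph.pathGraph n) S} := by
  ext S
  constructor
  · rintro ⟨t, ⟨h1, h2, h3⟩, rfl⟩
    exact ⟨intervalFinset_connected (fun u v h => path_adj.2 (Or.inl h)) h1 h2,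
      fun h => h3 ((intervalFinset_eq_univ h1 h2).1 h)⟩
  · rintro ⟨hS, hSu⟩
    rw [induce_connected_iff] at hS
    obtain ⟨hne, hS⟩ := hS
    obtain ⟨t, h1, h2, h3⟩ := exists_eq_intervalFinset (S := S) (by simpa using hne) (by
      intro x hx z hz y hxy hyz
      by_contra hy
      -- If `y` were missing from `S`, lying below `y` would propagate along the edges of `S`, since
      -- steps have length one, and would reach `z`.
      have := hS (· < y) ⟨x, hx, hxy⟩ (by
        intro a ha b hb hab hay
        rcases lt_trichotomy b y with h | h | h
        · exact h
        · exact absurd (h ▸ hb) hy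
        · rw [path_adj] at hab
          simp only [Fin.lt_def] at *
          omega) z hz
      exact absurd hyz (not_lt.2 this.le))
    have h4 : t.2 ≤ n := by
      rw [h2]
      exact Fin.is_lt _
    exact ⟨t, ⟨h1, h4, fun h => hSu (h3 ▸ (intervalFinset_eq_univ h1 h4).2 h)⟩, h3⟩

theorem intervalCompat_iff {n : ℕ} : ∀ t ∈ pathTubes n, ∀ u ∈ pathTubes n, IntervalCompat t u ↔
    TubeCompat (SimpleGraph.pathGraph n) (intervalFinset n t) (intervalFinset n u) := by
  rintro t ⟨ht, htn, -⟩ u ⟨hu, hun, -⟩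
  rw [TubeCompat, intervalFinset_subset ht htn, intervalFinset_subset hu hun,
    intervalFinset_nonadj (fun x _ y _ => path_adj) ht htn hu hun]
  rfl

/-! ### Tubes of the cycle, cut at its last vertex -/

theorem cycle_adj {N : ℕ} {u v : Fin (N + 1)} :
    (SimpleGraph.cycleGraph (N + 1)).Adj u v ↔ u.1 + 1 = v.1 ∨ v.1 + 1 = u.1 ∨
      (u.1 = 0 ∧ v.1 = N ∧ N ≠ 0) ∨ (v.1 = 0 ∧ u.1 = N ∧ N ≠ 0) := by
  rw [SimpleGraph.cycleGraph_adj', Fin.sub_def, Fin.sub_def]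
  obtain ⟨u, hu⟩ := u
  obtain ⟨v, hv⟩ := v
  simp only
  rcases lt_trichotomy u v with h | rfl | h
  · rw [show N + 1 - v + u = N + 1 - (v - u) by omega,
      show N + 1 - u + v = (N + 1) + (v - u) by omega, Nat.add_mod_left,
      Nat.mod_eq_of_lt (show N + 1 - (v - u) < N + 1 by omega),
      Nat.mod_eq_of_lt (show v - u < N + 1 by omega)]
    omega
  · rw [show N + 1 - u + u = N + 1 by omega, Nat.mod_self]
    omega
  · rw [show N + 1 - u + v = N + 1 - (u - v) by omega,
      show N + 1 - v + u = (N + 1) + (u - v) by omega, Nat.add_mod_left,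
      Nat.mod_eq_of_lt (show N + 1 - (u - v) < N + 1 by omega),
      Nat.mod_eq_of_lt (show u - v < N + 1 by omega)]
    omega

/-- The complement consists of a final interval and a possibly empty initial one, joined by the
closing edge between `N` and `0`. -/
theorem compl_intervalFinset_connected {N : ℕ} {t : ℕ × ℕ} (ht : t.1 < t.2) (htn : t.2 ≤ N) :
    ((SimpleGraph.cycleGraph (N + 1)).induce
      (((intervalFinset (N + 1) t)ᶜ : Finset (Fin (N + 1))) : Set (Fin (N + 1)))).Connected := by
  have hG : ∀ u v : Fin (N + 1), u.1 + 1 = v.1 → (SimpleGraph.cycleGraph (N + 1)).Adj u v :=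
    fun u v h => cycle_adj.2 (Or.inl h)
  have h1 := intervalFinset_connected hG (t := (t.2, N + 1)) (by simp only; omega) le_rfl
  rcases Nat.eq_zero_or_pos t.1 with h0 | h0
  · have heq : (intervalFinset (N + 1) t)ᶜ = intervalFinset (N + 1) (t.2, N + 1) := by
      ext x
      simp only [Finset.mem_compl, mem_intervalFinset]
      omega
    rwa [heq]
  · have h2 := intervalFinset_connected hG (t := (0, t.1)) h0 (by simp only; omega)
    have h3 := induce_union_connected_of_not_compat h1 h2 (by
      rw [TubeCompat,
        intervalFinset_subset (n := N + 1) (t := (t.2, N + 1)) (by simp only; omega) le_rfl,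
        intervalFinset_subset (n := N + 1) (t := (0, t.1)) h0 (by simp only; omega)]
      rintro (h | h | h)
      · simp only at h
        omega
      · simp only at h
        omega
      · exact (h ⟨N, by omega⟩ (mem_intervalFinset.2 ⟨htn, by simp⟩) ⟨0, by omega⟩
          (mem_intervalFinset.2 ⟨le_rfl, h0⟩)).2 
          (cycle_adj.2 (Or.inr (Or.inr (Or.inr ⟨rfl, rfl, by omega⟩)))))
    have heq : (intervalFinset (N + 1) t)ᶜ =
        intervalFinset (N + 1) (t.2, N + 1) ∪ intervalFinset (N + 1) (0, t.1) := by
      ext x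
      simp only [Finset.mem_compl, Finset.mem_union, mem_intervalFinset]
      omega
    rwa [heq]

theorem last_notMem_intervalFinset {N : ℕ} {t : ℕ × ℕ} (htn : t.2 ≤ N) :
    Fin.last N ∉ intervalFinset (N + 1) t := by
  rw [mem_intervalFinset, Fin.val_last]
  omega

theorem image_cycleTubes (N : ℕ) :
    arcFinset N '' cycleTubes N = {S | IsTube (SimpleGraph.cycleGraph (N + 1)) S} := by
  ext S
  constructor
  · rintro ⟨t | t, ⟨h1, h2⟩, rfl⟩
    · simp only [Sum.elim_inl, id] at h1 h2
      refine ⟨intervalFinset_connected (fun u v h => cycle_adj.2 (Or.inl h)) h1 (by omega), ?_⟩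
      exact fun h => last_notMem_intervalFinset h2 (by
        have : intervalFinset (N + 1) t = Finset.univ := h
        simp [this])
    · simp only [Sum.elim_inr, id] at h1 h2
      refine ⟨compl_intervalFinset_connected h1 h2, fun h => ?_⟩
      have h' : (⟨t.1, by omega⟩ : Fin (N + 1)) ∈ (intervalFinset (N + 1) t)ᶜ :=
        (show (intervalFinset (N + 1) t)ᶜ = Finset.univ from h) ▸ Finset.mem_univ _
      exact Finset.mem_compl.1 h' (mem_intervalFinset.2 ⟨le_rfl, h1⟩)
  · rintro ⟨hS, hSu⟩
    rw [induce_connected_iff] at hS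
    obtain ⟨hne, hS⟩ := hS
    by_cases hN : Fin.last N ∈ S
    · have hne' : (Sᶜ : Finset (Fin (N + 1))).Nonempty := by
        rw [Finset.nonempty_iff_ne_empty]
        exact fun h => hSu (Finset.compl_eq_empty_iff S |>.1 h)
      obtain ⟨t, h1, h2, h3⟩ := exists_eq_intervalFinset (S := Sᶜ) hne' (by
        intro x hx z hz y hxy hyz
        by_contra hy
        have hy' : y ∈ S := by simpa using hy
        -- A tube containing the last vertex has a convex complement: otherwise the part of the tube
        -- strictly between the missing vertices `x` and `z` would be closed under adjacency, yet it
        -- would have to reach the last vertex.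
        have := hS (fun w => x < w ∧ w < z) ⟨y, hy', hxy, hyz⟩ (by
          intro a ha b hb hab hay
          have hbx : b ≠ x := fun h => Finset.mem_compl.1 hx (h ▸ hb)
          have hbz : b ≠ z := fun h => Finset.mem_compl.1 hz (h ▸ hb)
          rw [cycle_adj] at hab
          rw [ne_eq, Fin.ext_iff] at hbx hbz
          simp only [Fin.lt_def] at *
          omega) _ hN
        exact absurd this.2 (not_lt.2 (Fin.le_last z)))
      refine ⟨Sum.inr t, ⟨h1, ?_⟩, ?_⟩
      · have hmem := Sᶜ.max'_mem hne'
        have hlast : Sᶜ.max' hne' ≠ Fin.last N := fun h => Finset.mem_compl.1 hmem (h ▸ hN)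
        simp only [Sum.elim_inr, id, h2]
        have := Fin.val_lt_last hlast
        omega
      · change (intervalFinset (N + 1) t)ᶜ = S
        rw [h3, compl_compl]
    · obtain ⟨t, h1, h2, h3⟩ := exists_eq_intervalFinset (S := S) (by simpa using hne) (by
        intro x hx z hz y hxy hyz
        by_contra hy
        -- Without the last vertex the closing edge is unavailable, and the path argument applies.
        have := hS (· < y) ⟨x, hx, hxy⟩ (by
          intro a ha b hb hab hay
          have hby : b ≠ y := fun h => hy (h ▸ hb)
          have haN : a ≠ Fin.last N := fun h => hN (h ▸ ha)
          have hbN : b ≠ Fin.last N := fun h => hN (h ▸ hb)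
          rw [cycle_adj] at hab
          rw [ne_eq, Fin.ext_iff, Fin.val_last] at haN hbN
          rw [ne_eq, Fin.ext_iff] at hby
          simp only [Fin.lt_def] at *
          omega) z hz
        exact absurd hyz (not_lt.2 this.le))
      refine ⟨Sum.inl t, ⟨h1, ?_⟩, h3⟩
      have hmem := S.max'_mem (by simpa using hne)
      have hlast : S.max' (by simpa using hne) ≠ Fin.last N := fun h => hN (h ▸ hmem)
      simp only [Sum.elim_inl, id, h2]
      have := Fin.val_lt_last hlast
      omega

theorem arcFinset_injOn (N : ℕ) : Set.InjOn (arcFinset N) (cycleTubes N) := by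
  have hne : ∀ t u : ℕ × ℕ, t.2 ≤ N → u.2 ≤ N →
      intervalFinset (N + 1) t ≠ (intervalFinset (N + 1) u)ᶜ := by
    intro t u ht hu h
    have : Fin.last N ∈ (intervalFinset (N + 1) u)ᶜ :=
      Finset.mem_compl.2 (last_notMem_intervalFinset hu)
    exact last_notMem_intervalFinset ht (h ▸ this)
  rintro (t | t) ⟨ht, htN⟩ (u | u) ⟨hu, huN⟩ h
  · exact congrArg Sum.inl (intervalFinset_injOn (N + 1) ⟨ht, htN.trans (Nat.le_succ N)⟩
      ⟨hu, huN.trans (Nat.le_succ N)⟩ h)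
  · exact absurd h (hne t u htN huN)
  · exact absurd h.symm (hne u t huN htN)
  · exact congrArg Sum.inr (intervalFinset_injOn (N + 1) ⟨ht, htN.trans (Nat.le_succ N)⟩
      ⟨hu, huN.trans (Nat.le_succ N)⟩ (compl_injective h))

theorem arcCompat_symm : ∀ t u, ArcCompat t u → ArcCompat u t := by
  rintro (t | t) (u | u) h <;> simp only [ArcCompat, IntervalCompat] at h ⊢ <;> omega

theorem arcCompat_inl_inr {N : ℕ} {t u : ℕ × ℕ} (ht : t.1 < t.2) (htN : t.2 ≤ N) (hu : u.1 < u.2)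
    (huN : u.2 ≤ N) : ArcCompat (.inl t) (.inr u) ↔
    TubeCompat (SimpleGraph.cycleGraph (N + 1)) (intervalFinset (N + 1) t)
      (intervalFinset (N + 1) u)ᶜ := by
  have hsub : intervalFinset (N + 1) t ⊆ (intervalFinset (N + 1) u)ᶜ ↔ t.2 ≤ u.1 ∨ u.2 ≤ t.1 := by
    constructor
    · intro h
      by_contra hcon
      have h1 := @h ⟨max t.1 u.1, by omega⟩
        (mem_intervalFinset.2 ⟨by simp only; omega, by simp only; omega⟩)
      rw [Finset.mem_compl, mem_intervalFinset] at h1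
      simp only at h1
      omega
    · intro h x hx
      rw [Finset.mem_compl]
      rw [mem_intervalFinset] at hx ⊢
      omega
  have hnot : ¬ (intervalFinset (N + 1) u)ᶜ ⊆ intervalFinset (N + 1) t := fun h =>
    last_notMem_intervalFinset htN (h (Finset.mem_compl.2 (last_notMem_intervalFinset huN)))
  rw [TubeCompat, hsub, ArcCompat, or_iff_right hnot, or_assoc]
  refine or_congr_right (or_congr_right ⟨fun h x hx y hy => ?_, fun h => ?_⟩)
  · rw [mem_intervalFinset] at hx
    rw [Finset.mem_compl, mem_intervalFinset] at hy
    refine ⟨fun hxy => ?_, ?_⟩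
    · rw [hxy] at hx
      omega
    · rw [cycle_adj]
      omega
  · have h' : ∀ a b (ha : a < N + 1) (hb : b < N + 1), t.1 ≤ a → a < t.2 → (b < u.1 ∨ u.2 ≤ b) →
        a ≠ b ∧ ¬ (a + 1 = b ∨ b + 1 = a ∨ (a = 0 ∧ b = N ∧ N ≠ 0) ∨ (b = 0 ∧ a = N ∧ N ≠ 0)) := by
      intro a b ha hb h1 h2 h3
      have h4 := h ⟨a, ha⟩ (mem_intervalFinset.2 ⟨h1, h2⟩) ⟨b, hb⟩ (by
        rw [Finset.mem_compl, mem_intervalFinset]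
        simp only
        omega)
      rw [cycle_adj] at h4
      simpa using h4
    -- The test pairs compare the endpoints of `t` with themselves and with their outer neighbours.
    -- The pair with `N` accounts for the closing edge when `t.1 = 0`.
    have h1 := h' t.1 t.1 (by omega) (by omega) le_rfl ht
    have h2 := h' (t.2 - 1) (t.2 - 1) (by omega) (by omega) (by omega) (by omega)
    have h3 := h' t.1 (t.1 - 1) (by omega) (by omega) le_rfl ht
    have h4 := h' t.1 N (by omega) (by omega) le_rfl ht
    have h5 := h' (t.2 - 1) t.2 (by omega) (by omega) (by omega) (by omega)
    omega

/-- Intervals avoid the last vertex, so two of them behave as on a path. Two complements share the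
last vertex, so they can only be compatible by nesting. -/
theorem arcCompat_iff {N : ℕ} : ∀ t ∈ cycleTubes N, ∀ u ∈ cycleTubes N, ArcCompat t u ↔
    TubeCompat (SimpleGraph.cycleGraph (N + 1)) (arcFinset N t) (arcFinset N u) := by
  rintro (t | t) ⟨ht, htN⟩ (u | u) ⟨hu, huN⟩ <;>
    simp only [Sum.elim_inl, Sum.elim_inr, id] at ht htN hu huN
  · change _ ↔ TubeCompat _ (intervalFinset (N + 1) t) (intervalFinset (N + 1) u)
    rw [TubeCompat, intervalFinset_subset ht (by omega), intervalFinset_subset hu (by omega),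
      intervalFinset_nonadj (fun x hx y hy => ?_) ht (by omega) hu (by omega)]
    · rfl
    · rw [mem_intervalFinset] at hx hy
      rw [cycle_adj]
      omega
  · exact arcCompat_inl_inr ht htN hu huN
  · have h := arcCompat_inl_inr hu huN ht htN
    exact ⟨fun h' => (h.1 (arcCompat_symm _ _ h')).symm,
      fun h' => arcCompat_symm _ _ (h.2 h'.symm)⟩
  · change _ ↔ TubeCompat _ (intervalFinset (N + 1) t)ᶜ (intervalFinset (N + 1) u)ᶜ
    rw [TubeCompat, Finset.compl_subset_compl, Finset.compl_subset_compl,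
      intervalFinset_subset ht (by omega), intervalFinset_subset hu (by omega),
      or_iff_left (b := ∀ x ∈ _, _) ?_, ArcCompat]
    · omega
    · intro h
      exact (h (Fin.last N) (Finset.mem_compl.2 (last_notMem_intervalFinset htN)) (Fin.last N)
        (Finset.mem_compl.2 (last_notMem_intervalFinset huN))).1 rfl

end Coordinates

/-! ### Classes of faces in coordinates -/

section Classes

/-- The class of the face of the associahedron given by a set of intervals. -/
noncomputable def pathClass (n : ℕ) (T : Finset (ℕ × ℕ)) : PolytopeRing :=
  posetClass (CliqueStar (pathTubes n) IntervalCompat T)ᵒᵈ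

/-- The class of the face of the cyclohedron given by a set of arcs. -/
noncomputable def cycleClass (N : ℕ) (T : Finset (ℕ × ℕ ⊕ ℕ × ℕ)) : PolytopeRing :=
  posetClass (CliqueStar (cycleTubes N) ArcCompat T)ᵒᵈ

theorem intervalCompat_symm (t u : ℕ × ℕ) (h : IntervalCompat t u) : IntervalCompat u t := by
  simp only [IntervalCompat] at h ⊢
  omega

theorem isTubing_image {α V : Type*} [DecidableEq V] [Fintype V] {G : SimpleGraph V} {A : Set α}
    {r : α → α → Prop} {f : α → Finset V} (himg : f '' A = {S | IsTube G S})
    (hr : ∀ a ∈ A, ∀ b ∈ A, r a b ↔ TubeCompat G (f a) (f b)) {T : Finset α}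
    (hT : ∀ t ∈ T, t ∈ A) (hTr : (T : Set α).Pairwise r) : IsTubing G (T.image f) := by
  refine ⟨fun S hS => ?_, ?_⟩
  · obtain ⟨t, ht, rfl⟩ := Finset.mem_image.1 hS
    exact himg ▸ Set.mem_image_of_mem f (hT t ht)
  · intro S hS S' hS' hne
    obtain ⟨t, ht, rfl⟩ := Finset.mem_image.1 (Finset.mem_coe.1 hS)
    obtain ⟨t', ht', rfl⟩ := Finset.mem_image.1 (Finset.mem_coe.1 hS')
    exact (hr t (hT t ht) t' (hT t' ht')).1 (hTr ht ht' fun h => hne (h ▸ rfl))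

variable {n N : ℕ}

theorem intervalFinset_injOn_pathTubes (n : ℕ) : Set.InjOn (intervalFinset n) (pathTubes n) :=
  (intervalFinset_injOn n).mono (show pathTubes n ⊆ {t | t.1 < t.2 ∧ t.2 ≤ n} from
    fun _ ht => ⟨ht.1, ht.2.1⟩)

theorem pathClass_eq {T : Finset (ℕ × ℕ)} (hT : ∀ t ∈ T, t ∈ pathTubes n) :
    pathClass n T = tubingClass (SimpleGraph.pathGraph n) (T.image (intervalFinset n)) := by
  obtain ⟨e⟩ := cliqueStar_image_iso (intervalFinset n)
    (intervalFinset_injOn_pathTubes n) (image_pathTubes n)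
    intervalCompat_iff T hT
  exact posetClass_congr e.dual

theorem cycleClass_eq {T : Finset (ℕ × ℕ ⊕ ℕ × ℕ)} (hT : ∀ t ∈ T, t ∈ cycleTubes N) :
    cycleClass N T = tubingClass (SimpleGraph.cycleGraph (N + 1)) (T.image (arcFinset N)) := by
  obtain ⟨e⟩ := cliqueStar_image_iso (arcFinset N) (arcFinset_injOn N) (image_cycleTubes N)
    arcCompat_iff T hT
  exact posetClass_congr e.dual

theorem pathGraph_connected [NeZero n] : (SimpleGraph.pathGraph n).Connected := by
  obtain ⟨k, rfl⟩ : ∃ k, n = k + 1 := ⟨n - 1, by have := NeZero.pos n; omega⟩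
  exact SimpleGraph.pathGraph_connected k

theorem cycleGraph_connected : (SimpleGraph.cycleGraph (N + 1)).Connected :=
  (SimpleGraph.pathGraph_connected N).mono SimpleGraph.pathGraph_le_cycleGraph

/-- Realizability is what `posetClass_prod` needs for the factors in the product formulas. -/
theorem exists_polytope_path [NeZero n] {T : Finset (ℕ × ℕ)} (hT : ∀ t ∈ T, t ∈ pathTubes n)
    (hTr : (T : Set (ℕ × ℕ)).Pairwise IntervalCompat) :
    ∃ P : Polytope, Nonempty (Face P.carrier ≃o
      (CliqueStar (pathTubes n) IntervalCompat T)ᵒᵈ) := by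
  obtain ⟨e⟩ := cliqueStar_image_iso (intervalFinset n)
    (intervalFinset_injOn_pathTubes n) (image_pathTubes n)
    intervalCompat_iff T hT
  obtain ⟨P, ⟨f⟩⟩ := exists_polytope_of_isTubing pathGraph_connected
    (isTubing_image (image_pathTubes n) intervalCompat_iff hT hTr)
  exact ⟨P, ⟨f.trans e.symm.dual⟩⟩

theorem exists_polytope_cycle {T : Finset (ℕ × ℕ ⊕ ℕ × ℕ)} (hT : ∀ t ∈ T, t ∈ cycleTubes N)
    (hTr : (T : Set (ℕ × ℕ ⊕ ℕ × ℕ)).Pairwise ArcCompat) :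
    ∃ P : Polytope, Nonempty (Face P.carrier ≃o (CliqueStar (cycleTubes N) ArcCompat T)ᵒᵈ) := by
  obtain ⟨e⟩ := cliqueStar_image_iso (arcFinset N) (arcFinset_injOn N) (image_cycleTubes N)
    arcCompat_iff T hT
  obtain ⟨P, ⟨f⟩⟩ := exists_polytope_of_isTubing cycleGraph_connected
    (isTubing_image (image_cycleTubes N) arcCompat_iff hT hTr)
  exact ⟨P, ⟨f.trans e.symm.dual⟩⟩

/-! ### Factorization of face classes by contracting an interval -/

/-- Translation of an interval. -/
def shiftInterval (d : ℕ) (t : ℕ × ℕ) : ℕ × ℕ := (t.1 + d, t.2 + d)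

/-- Insert `s` new points at position `p`, included in every interval that touches the position. -/
def expandInterval (p s : ℕ) (t : ℕ × ℕ) : ℕ × ℕ :=
  (if t.1 ≤ p then t.1 else t.1 + s, if t.2 < p then t.2 else t.2 + s)

/-- Insert `s` new points at position `p`, excluded from the complementary interval of an arc
unless they lie in its interior. -/
def expandArc (p s : ℕ) : ℕ × ℕ ⊕ ℕ × ℕ → ℕ × ℕ ⊕ ℕ × ℕ :=
  Sum.map (expandInterval p s)
    fun t => (if t.1 < p then t.1 else t.1 + s, if t.2 ≤ p then t.2 else t.2 + s)

theorem shiftInterval_injective (d : ℕ) : Function.Injective (shiftInterval d) := by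
  rintro ⟨i, j⟩ ⟨i', j'⟩ h
  simp only [shiftInterval, Prod.mk.injEq] at h ⊢
  omega

theorem expandInterval_injective (p s : ℕ) : Function.Injective (expandInterval p s) := by
  rintro ⟨i, j⟩ ⟨i', j'⟩ h
  simp only [expandInterval, Prod.mk.injEq] at h ⊢
  split_ifs at h <;> omega

theorem expandArc_injective (p s : ℕ) : Function.Injective (expandArc p s) := by
  refine (expandInterval_injective p s).sumMap ?_
  rintro ⟨i, j⟩ ⟨i', j'⟩ h
  simp only [Prod.mk.injEq] at h ⊢
  split_ifs at h <;> omega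

/-- The intervals in `[p, n)`, `[p, n)` itself allowed, form a tubing. -/
def IsIntervalTubing (p n : ℕ) (T : Finset (ℕ × ℕ)) : Prop :=
  (∀ t ∈ T, p ≤ t.1 ∧ t.1 < t.2 ∧ t.2 ≤ n) ∧ (T : Set (ℕ × ℕ)).Pairwise IntervalCompat

/-- Intervals starting after `p` are merely translated. Gluing can therefore be written with shifts,
while the isomorphism of clique posets needs the expansion of all tubes. -/
theorem image_expandInterval {p s n : ℕ} {T : Finset (ℕ × ℕ)} (hT : IsIntervalTubing (p + 1) n T) :
    T.image (expandInterval p s) = T.image (shiftInterval s) := by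
  refine Finset.image_congr fun t ht => ?_
  have := hT.1 t ht
  simp only [expandInterval, shiftInterval]
  rw [if_neg (by omega), if_neg (by omega)]

/-- A tube compatible with `[p, p + s)` lies inside it or is the expansion of a tube of the
contracted path on `n - s` vertices. The two kinds are always compatible, so the poset is a product.
-/
theorem pathClass_insert {p s : ℕ} (hs : 1 ≤ s) (hps : p + s ≤ n) (hsn : s < n)
    {T U : Finset (ℕ × ℕ)} (hT : ∀ t ∈ T, t ∈ pathTubes s)
    (hTr : (T : Set (ℕ × ℕ)).Pairwise IntervalCompat) (hU : IsIntervalTubing (p + 1) (n - s) U) :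
    pathClass n (insert (p, p + s) (T.image (shiftInterval p) ∪ U.image (shiftInterval s))) =
      pathClass s T * pathClass (n - s) U := by
  have : NeZero s := ⟨by omega⟩
  have : NeZero (n - s) := ⟨by omega⟩
  -- Left endpoints are at least `p + 1`, so no member is the whole contracted path.
  have hU' : ∀ t ∈ U, t ∈ pathTubes (n - s) := fun t ht => by
    have := hU.1 t ht
    exact ⟨this.2.1, this.2.2, by omega⟩
  obtain ⟨P, ⟨eP⟩⟩ := exists_polytope_path hT hTr
  obtain ⟨Q, ⟨eQ⟩⟩ := exists_polytope_path hU' hU.2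
  rw [← image_expandInterval hU]
  obtain ⟨e⟩ := cliqueStar_join_iso (A := pathTubes n) (r := IntervalCompat) (B := pathTubes s)
    (C := pathTubes (n - s)) (s := IntervalCompat) (t := IntervalCompat) (p, p + s)
    (shiftInterval p) (expandInterval p s) ⟨by simp only; omega, hps, by simp only; omega⟩
    intervalCompat_symm (shiftInterval_injective p) (expandInterval_injective p s)
    (by
      rintro ⟨i, j⟩ ⟨h1, h2, h3⟩
      simp only [shiftInterval, pathTubes, Set.mem_ofPred_eq, ne_eq, Prod.mk.injEq,
        IntervalCompat] at *
      omega)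
    (by
      rintro ⟨i, j⟩ ⟨h1, h2, h3⟩
      simp only [expandInterval, pathTubes, Set.mem_ofPred_eq, ne_eq, Prod.mk.injEq,
        IntervalCompat] at *
      split_ifs <;> omega)
    (by
      rintro ⟨i, j⟩ ⟨h1, h2, h3⟩ ⟨i', j'⟩ ⟨h1', h2', h3'⟩
      simp only [shiftInterval, expandInterval, ne_eq, Prod.mk.injEq, IntervalCompat] at *
      split_ifs <;> omega)
    (by
      rintro ⟨i, j⟩ ⟨h1, h2, h3⟩ ⟨i', j'⟩ ⟨h1', h2', h3'⟩
      simp only [shiftInterval, IntervalCompat] at *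
      omega)
    (by
      rintro ⟨i, j⟩ ⟨h1, h2, h3⟩ ⟨i', j'⟩ ⟨h1', h2', h3'⟩
      simp only [expandInterval, IntervalCompat] at *
      split_ifs <;> omega)
    (by
      rintro ⟨i, j⟩ ⟨h1, h2, h3⟩ hne hc
      simp only [ne_eq, Prod.mk.injEq, IntervalCompat] at h1 h2 h3 hne hc
      by_cases hin : p ≤ i ∧ j ≤ p + s
      · refine Or.inl ⟨(i - p, j - p), ⟨by simp only; omega, by simp only; omega,
          by simp only; omega⟩, ?_⟩
        simp only [shiftInterval, Prod.mk.injEq]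
        omega
      -- This inverts the expansion: a compatible tube not inside `[p, p + s)` has `i ≤ p` or `p + s
      -- < i`, and `j < p` or `p + s ≤ j`.
      · refine Or.inr ⟨(if i ≤ p then i else i - s, if j < p then j else j - s), ⟨?_, ?_, ?_⟩, ?_⟩
        · simp only
          split_ifs <;> omega
        · simp only
          split_ifs <;> omega
        · simp only
          split_ifs <;> omega
        · simp only [expandInterval, Prod.mk.injEq]
          constructor <;> split_ifs <;> omega)
    T U hT hU'
  exact posetClass_prod P Q eP eQ e

/-- The tubes inside the interval still form a path, while contracting the interval leaves a cycle
on `N - s + 1` vertices. All arcs of that cycle are needed in the second factor, including those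
through the last vertex. -/
theorem cycleClass_insert {p s : ℕ} (hs : 1 ≤ s) (hps : p + s ≤ N)
    {T U : Finset (ℕ × ℕ)} (hT : ∀ t ∈ T, t ∈ pathTubes s)
    (hTr : (T : Set (ℕ × ℕ)).Pairwise IntervalCompat) (hU : IsIntervalTubing (p + 1) (N - s) U) :
    cycleClass N ((insert (p, p + s)
        (T.image (shiftInterval p) ∪ U.image (shiftInterval s))).image Sum.inl) =
      pathClass s T * cycleClass (N - s) (U.image Sum.inl) := by
  have : NeZero s := ⟨by omega⟩
  have hU' : ∀ t ∈ U.image (Sum.inl (β := ℕ × ℕ)), t ∈ cycleTubes (N - s) := fun t ht => by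
    obtain ⟨u, hu, rfl⟩ := Finset.mem_image.1 ht
    exact (hU.1 u hu).2
  have hUr : ((U.image (Sum.inl (β := ℕ × ℕ)) : Finset (ℕ × ℕ ⊕ ℕ × ℕ)) :
      Set (ℕ × ℕ ⊕ ℕ × ℕ)).Pairwise ArcCompat := by
    intro t ht t' ht' hne
    obtain ⟨u, hu, rfl⟩ := Finset.mem_image.1 (Finset.mem_coe.1 ht)
    obtain ⟨u', hu', rfl⟩ := Finset.mem_image.1 (Finset.mem_coe.1 ht')
    exact hU.2 hu hu' fun h => hne (h ▸ rfl)
  obtain ⟨P, ⟨eP⟩⟩ := exists_polytope_path hT hTr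
  obtain ⟨Q, ⟨eQ⟩⟩ := exists_polytope_cycle hU' hUr
  have hset : (insert (p, p + s) (T.image (shiftInterval p) ∪ U.image (shiftInterval s))).image
      (Sum.inl (β := ℕ × ℕ)) = insert (Sum.inl (p, p + s)) (T.image (Sum.inl ∘ shiftInterval p) ∪
        (U.image Sum.inl).image (expandArc p s)) := by
    rw [Finset.image_insert, Finset.image_union, Finset.image_image, ← image_expandInterval hU,
      Finset.image_image, Finset.image_image]
    rfl
  rw [hset]
  obtain ⟨e⟩ := cliqueStar_join_iso (A := cycleTubes N) (r := ArcCompat) (B := pathTubes s)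
    (C := cycleTubes (N - s)) (s := IntervalCompat) (t := ArcCompat) (Sum.inl (p, p + s))
    (Sum.inl ∘ shiftInterval p) (expandArc p s) ⟨by simp only [Sum.elim_inl, id]; omega, hps⟩
    arcCompat_symm (Sum.inl_injective.comp (shiftInterval_injective p)) (expandArc_injective p s)
    (by
      rintro ⟨i, j⟩ ⟨h1, h2, h3⟩
      simp only [shiftInterval, cycleTubes, Set.mem_ofPred_eq, ne_eq, Prod.mk.injEq, ArcCompat,
        IntervalCompat, Function.comp, Sum.elim_inl, id, Sum.inl.injEq] at *
      omega)
    (by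
      rintro (⟨i, j⟩ | ⟨i, j⟩) ⟨h1, h2⟩ <;>
        simp only [expandArc, expandInterval, Sum.map_inl, Sum.map_inr, cycleTubes,
          Set.mem_ofPred_eq, ne_eq, Prod.mk.injEq, ArcCompat, IntervalCompat, Sum.elim_inl,
          Sum.elim_inr, id, Sum.inl.injEq, reduceCtorEq, not_false_eq_true, true_and] at * <;>
        split_ifs <;> omega)
    (by
      rintro ⟨i, j⟩ ⟨h1, h2, h3⟩ (⟨i', j'⟩ | ⟨i', j'⟩) ⟨h1', h2'⟩ <;>
        simp only [shiftInterval, expandArc, expandInterval, Sum.map_inl, Sum.map_inr, ne_eq,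
          Prod.mk.injEq, ArcCompat, IntervalCompat, Sum.elim_inl, Function.comp,
          Sum.elim_inr, id, Sum.inl.injEq, reduceCtorEq, not_false_eq_true, true_and] at * <;>
        split_ifs <;> omega)
    (by
      rintro ⟨i, j⟩ ⟨h1, h2, h3⟩ ⟨i', j'⟩ ⟨h1', h2', h3'⟩
      simp only [shiftInterval, IntervalCompat, ArcCompat, Function.comp] at *
      omega)
    (by
      rintro (⟨i, j⟩ | ⟨i, j⟩) ⟨h1, h2⟩ (⟨i', j'⟩ | ⟨i', j'⟩) ⟨h1', h2'⟩ <;>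
        simp only [expandArc, expandInterval, Sum.map_inl, Sum.map_inr, ArcCompat, IntervalCompat,
          Sum.elim_inl, Sum.elim_inr, id] at * <;>
        split_ifs <;> omega)
    (by
      rintro (⟨i, j⟩ | ⟨i, j⟩) ⟨h1, h2⟩ hne hc
      · simp only [ne_eq, Prod.mk.injEq, IntervalCompat, ArcCompat, Sum.inl.injEq, Sum.elim_inl,
          id] at h1 h2 hne hc
        by_cases hin : p ≤ i ∧ j ≤ p + s
        · refine Or.inl ⟨(i - p, j - p), ⟨by simp only; omega, by simp only; omega,
            by simp only; omega⟩, ?_⟩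
          simp only [shiftInterval, Function.comp, Sum.inl.injEq, Prod.mk.injEq]
          omega
        · refine Or.inr ⟨Sum.inl (if i ≤ p then i else i - s, if j < p then j else j - s),
            ⟨?_, ?_⟩, ?_⟩
          · simp only [Sum.elim_inl, id]
            split_ifs <;> omega
          · simp only [Sum.elim_inl, id]
            split_ifs <;> omega
          · simp only [expandArc, Sum.map_inl, expandInterval, Sum.inl.injEq, Prod.mk.injEq]
            constructor <;> split_ifs <;> omega
      · simp only [ArcCompat, Sum.elim_inr, id] at h1 h2 hc
        refine Or.inr ⟨Sum.inr (if i < p + s then i else i - s, if j ≤ p then j else j - s),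
          ⟨?_, ?_⟩, ?_⟩
        · simp only [Sum.elim_inr, id]
          split_ifs <;> omega
        · simp only [Sum.elim_inr, id]
          split_ifs <;> omega
        · simp only [expandArc, Sum.map_inr, Sum.inr.injEq, Prod.mk.injEq]
          constructor <;> split_ifs <;> omega)
    T (U.image Sum.inl) hT hU'
  exact posetClass_prod P Q eP eQ e

end Classes

/-! ### Sums over interval tubings -/

section IntervalTubings

/-- The tubings by intervals in `[p, n)`, the interval `[p, n)` itself being allowed. -/
noncomputable def intervalTubings (p n : ℕ) : Finset (Finset (ℕ × ℕ)) := by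
  classical
  exact ((Finset.Icc p n ×ˢ Finset.Icc p n).powerset).filter (IsIntervalTubing p n)

theorem mem_intervalTubings {p n : ℕ} {T : Finset (ℕ × ℕ)} :
    T ∈ intervalTubings p n ↔ IsIntervalTubing p n T := by
  simp only [intervalTubings, Finset.mem_filter, Finset.mem_powerset, and_iff_right_iff_imp]
  intro hT t ht
  have := hT.1 t ht
  simp only [Finset.mem_product, Finset.mem_Icc]
  omega

/-- The tubings by proper intervals in `[0, n)`. -/
noncomputable def properTubings (n : ℕ) : Finset (Finset (ℕ × ℕ)) :=
  (intervalTubings 0 n).filter fun T => (0, n) ∉ T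

theorem mem_properTubings {n : ℕ} {T : Finset (ℕ × ℕ)} :
    T ∈ properTubings n ↔ (∀ t ∈ T, t ∈ pathTubes n) ∧
      (T : Set (ℕ × ℕ)).Pairwise IntervalCompat := by
  rw [properTubings, Finset.mem_filter, mem_intervalTubings]
  constructor
  · rintro ⟨⟨h1, h2⟩, h3⟩
    refine ⟨fun t ht => ⟨(h1 t ht).2.1, (h1 t ht).2.2, fun h => h3 ?_⟩, h2⟩
    rwa [show ((0, n) : ℕ × ℕ) = t from Prod.ext h.1.symm h.2.symm]
  · rintro ⟨h1, h2⟩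
    exact ⟨⟨fun t ht => ⟨Nat.zero_le _, (h1 t ht).1, (h1 t ht).2.1⟩, h2⟩,
      fun h => (h1 _ h).2.2 ⟨rfl, rfl⟩⟩

/-- Glue a tubing of `[p, p + s)` and a tubing of the points beyond it to the interval
`[p, p + s)`. -/
def glueTubing (p s : ℕ) (T U : Finset (ℕ × ℕ)) : Finset (ℕ × ℕ) :=
  insert (p, p + s) (T.image (shiftInterval p) ∪ U.image (shiftInterval s))

theorem mem_glueTubing {p s : ℕ} {T U : Finset (ℕ × ℕ)} {q : ℕ × ℕ} :
    q ∈ glueTubing p s T U ↔ q = (p, p + s) ∨ (∃ t ∈ T, shiftInterval p t = q) ∨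
      ∃ u ∈ U, shiftInterval s u = q := by
  simp [glueTubing]

theorem isIntervalTubing_glueTubing {n p s : ℕ} (hs : 1 ≤ s) (hps : p + s ≤ n)
    {T U : Finset (ℕ × ℕ)} (hT : T ∈ properTubings s) (hU : U ∈ intervalTubings (p + 1) (n - s)) :
    IsIntervalTubing p n (glueTubing p s T U) := by
  rw [mem_properTubings] at hT
  rw [mem_intervalTubings] at hU
  constructor
  · intro q hq
    rcases mem_glueTubing.1 hq with rfl | ⟨t, ht, rfl⟩ | ⟨u, hu, rfl⟩
    · exact ⟨le_rfl, by simp only; omega, hps⟩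
    · have := hT.1 t ht
      simp only [pathTubes, Set.mem_ofPred_eq] at this
      simp only [shiftInterval]
      omega
    · have := hU.1 u hu
      simp only [shiftInterval]
      omega
  · intro q hq q' hq' hne
    have hT1 : ∀ t ∈ T, t.1 < t.2 ∧ t.2 ≤ s := fun t ht => ⟨(hT.1 t ht).1, (hT.1 t ht).2.1⟩
    have key : ∀ q q' : ℕ × ℕ, IntervalCompat q q' → IntervalCompat q' q := intervalCompat_symm
    have h1 : ∀ t ∈ T, IntervalCompat (shiftInterval p t) (p, p + s) := fun t ht => by
      have := hT1 t ht
      simp only [IntervalCompat, shiftInterval]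
      omega
    have h2 : ∀ u ∈ U, IntervalCompat (shiftInterval s u) (p, p + s) := fun u hu => by
      have := hU.1 u hu
      simp only [IntervalCompat, shiftInterval]
      omega
    have h3 : ∀ t ∈ T, ∀ u ∈ U, IntervalCompat (shiftInterval p t) (shiftInterval s u) :=
      fun t ht u hu => by
        have := hT1 t ht
        have := hU.1 u hu
        simp only [IntervalCompat, shiftInterval]
        omega
    have h4 : ∀ d t u, IntervalCompat t u →
        IntervalCompat (shiftInterval d t) (shiftInterval d u) := fun d t u h => by
      simp only [IntervalCompat, shiftInterval] at h ⊢
      omega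
    rcases mem_glueTubing.1 (Finset.mem_coe.1 hq) with rfl | ⟨t, ht, rfl⟩ | ⟨u, hu, rfl⟩ <;>
      rcases mem_glueTubing.1 (Finset.mem_coe.1 hq') with rfl | ⟨t', ht', rfl⟩ | ⟨u', hu', rfl⟩
    · exact absurd rfl hne
    · exact key _ _ (h1 t' ht')
    · exact key _ _ (h2 u' hu')
    · exact h1 t ht
    · exact h4 _ _ _ (hT.2 ht ht' fun h => hne (h ▸ rfl))
    · exact h3 t ht u' hu'
    · exact h2 u hu
    · exact key _ _ (h3 t' ht' u hu)
    · exact h4 _ _ _ (hU.2 hu hu' fun h => hne (h ▸ rfl))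

/-- The glued tubing determines `s`, since `[p, p + s)` is its longest member starting at `p`. The
other members separate into those ending by `p + s` and those starting beyond it. -/
theorem glueTubing_injective {n n' p s s' : ℕ} {T U T' U' : Finset (ℕ × ℕ)}
    (hT : T ∈ properTubings s) (hU : U ∈ intervalTubings (p + 1) n)
    (hT' : T' ∈ properTubings s') (hU' : U' ∈ intervalTubings (p + 1) n')
    (h : glueTubing p s T U = glueTubing p s' T' U') : s = s' ∧ T = T' ∧ U = U' := by
  have hle : ∀ {n s s' : ℕ} {T U T' U' : Finset (ℕ × ℕ)}, T' ∈ properTubings s' →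
      U' ∈ intervalTubings (p + 1) n → glueTubing p s T U = glueTubing p s' T' U' → s ≤ s' := by
    intro n s s' T U T' U' hT' hU' h
    have hm : (p, p + s) ∈ glueTubing p s' T' U' := h ▸ mem_glueTubing.2 (Or.inl rfl)
    rcases mem_glueTubing.1 hm with h | ⟨t, ht, h⟩ | ⟨u, hu, h⟩
    · rw [Prod.mk.injEq] at h
      omega
    · have := (mem_properTubings.1 hT').1 t ht
      simp only [pathTubes, Set.mem_ofPred_eq] at this
      simp only [shiftInterval, Prod.mk.injEq] at h
      omega
    · have := (mem_intervalTubings.1 hU').1 u hu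
      simp only [shiftInterval, Prod.mk.injEq] at h
      omega
  obtain rfl : s = s' := le_antisymm (hle hT' hU' h) (hle hT hU h.symm)
  have hsub : ∀ {n n' : ℕ} {T U T' U' : Finset (ℕ × ℕ)}, T ∈ properTubings s →
      U ∈ intervalTubings (p + 1) n → T' ∈ properTubings s → U' ∈ intervalTubings (p + 1) n' →
      glueTubing p s T U = glueTubing p s T' U' → T ⊆ T' ∧ U ⊆ U' := by
    intro n n' T U T' U' hT hU hT' hU' h
    have h1 := fun t ht => (mem_properTubings.1 hT).1 t ht
    have h2 := fun t ht => (mem_intervalTubings.1 hU).1 t ht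
    have h1' := fun t ht => (mem_properTubings.1 hT').1 t ht
    have h2' := fun t ht => (mem_intervalTubings.1 hU').1 t ht
    simp only [pathTubes, Set.mem_ofPred_eq] at h1 h1'
    refine ⟨fun t ht => ?_, fun u hu => ?_⟩
    · have hm : shiftInterval p t ∈ glueTubing p s T' U' :=
        h ▸ mem_glueTubing.2 (Or.inr (Or.inl ⟨t, ht, rfl⟩))
      have h3 := h1 t ht
      rcases mem_glueTubing.1 hm with h | ⟨t', ht', h⟩ | ⟨u', hu', h⟩
      · simp only [shiftInterval, Prod.mk.injEq] at h
        omega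
      · exact shiftInterval_injective p h ▸ ht'
      · have := h2' u' hu'
        simp only [shiftInterval, Prod.mk.injEq] at h
        omega
    · have hm : shiftInterval s u ∈ glueTubing p s T' U' :=
        h ▸ mem_glueTubing.2 (Or.inr (Or.inr ⟨u, hu, rfl⟩))
      have h3 := h2 u hu
      rcases mem_glueTubing.1 hm with h | ⟨t', ht', h⟩ | ⟨u', hu', h⟩
      · simp only [shiftInterval, Prod.mk.injEq] at h
        omega
      · have := h1' t' ht'
        simp only [shiftInterval, Prod.mk.injEq] at h
        omega
      · exact shiftInterval_injective s h ▸ hu'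
  have h1 := hsub hT hU hT' hU' h
  have h2 := hsub hT' hU' hT hU h.symm
  exact ⟨rfl, Finset.Subset.antisymm h1.1 h2.1, Finset.Subset.antisymm h1.2 h2.2⟩

theorem exists_eq_glueTubing {n p : ℕ} {W : Finset (ℕ × ℕ)} (hW : IsIntervalTubing p n W)
    (hp : ∃ t ∈ W, t.1 = p) : ∃ s, 1 ≤ s ∧ p + s ≤ n ∧ ∃ T ∈ properTubings s,
      ∃ U ∈ intervalTubings (p + 1) (n - s), glueTubing p s T U = W := by
  obtain ⟨t0, ht0, ht0p⟩ := hp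
  obtain ⟨m, hm, hmax⟩ := (W.filter fun t => t.1 = p).exists_max_image Prod.snd
    ⟨t0, Finset.mem_filter.2 ⟨ht0, ht0p⟩⟩
  obtain ⟨hmW, hmp⟩ := Finset.mem_filter.1 hm
  have hmW' := hW.1 m hmW
  obtain ⟨s, hs⟩ : ∃ s, m.2 = p + s := ⟨m.2 - p, by omega⟩
  obtain rfl : m = (p, p + s) := Prod.ext hmp hs
  simp only at hmW' hmax
  -- Maximality of `m` handles the intervals starting at `p`. The others start later, so
  -- compatibility puts them inside `m` or beyond it with a gap.
  have hcases : ∀ q ∈ W, q ≠ (p, p + s) → q.2 ≤ p + s ∨ p + s < q.1 := by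
    intro q hq hne
    have h1 := hW.2 hq hmW hne
    have h2 := hW.1 q hq
    simp only [IntervalCompat] at h1
    by_cases hqp : q.1 = p
    · exact Or.inl (hmax q (Finset.mem_filter.2 ⟨hq, hqp⟩))
    · omega
  have hcompat : ∀ d (q q' : ℕ × ℕ), d ≤ q.1 → d ≤ q'.1 → q.1 < q.2 → q'.1 < q'.2 →
      IntervalCompat q q' → IntervalCompat (q.1 - d, q.2 - d) (q'.1 - d, q'.2 - d) := by
    intro d q q' h1 h2 h3 h4 h
    simp only [IntervalCompat] at h ⊢
    omega
  refine ⟨s, by omega, hmW'.2.2,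
    (W.filter fun q => q.2 ≤ p + s ∧ q ≠ (p, p + s)).image fun q => (q.1 - p, q.2 - p), ?_,
    (W.filter fun q => p + s < q.1).image fun q => (q.1 - s, q.2 - s), ?_, ?_⟩
  · rw [mem_properTubings]
    constructor
    · intro t ht
      obtain ⟨q, hq, rfl⟩ := Finset.mem_image.1 ht
      obtain ⟨hqW, hq1, hq2⟩ := Finset.mem_filter.1 hq
      have := hW.1 q hqW
      rw [ne_eq, Prod.ext_iff] at hq2
      simp only [pathTubes, Set.mem_ofPred_eq] at *
      omega
    · intro t ht t' ht' hne
      obtain ⟨q, hq, rfl⟩ := Finset.mem_image.1 (Finset.mem_coe.1 ht)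
      obtain ⟨q', hq', rfl⟩ := Finset.mem_image.1 (Finset.mem_coe.1 ht')
      have h1 := (Finset.mem_filter.1 hq).1
      have h2 := (Finset.mem_filter.1 hq').1
      exact hcompat p q q' (hW.1 q h1).1 (hW.1 q' h2).1 (hW.1 q h1).2.1 (hW.1 q' h2).2.1
        (hW.2 h1 h2 fun h => hne (h ▸ rfl))
  · rw [mem_intervalTubings]
    constructor
    · intro t ht
      obtain ⟨q, hq, rfl⟩ := Finset.mem_image.1 ht
      obtain ⟨hqW, hq1⟩ := Finset.mem_filter.1 hq
      have := hW.1 q hqW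
      simp only
      omega
    · intro t ht t' ht' hne
      obtain ⟨q, hq, rfl⟩ := Finset.mem_image.1 (Finset.mem_coe.1 ht)
      obtain ⟨q', hq', rfl⟩ := Finset.mem_image.1 (Finset.mem_coe.1 ht')
      obtain ⟨h1, h1'⟩ := Finset.mem_filter.1 hq
      obtain ⟨h2, h2'⟩ := Finset.mem_filter.1 hq'
      exact hcompat s q q' (by omega) (by omega) (hW.1 q h1).2.1 (hW.1 q' h2).2.1
        (hW.2 h1 h2 fun h => hne (h ▸ rfl))
  · ext q
    rw [mem_glueTubing]
    constructor
    · rintro (rfl | ⟨t, ht, rfl⟩ | ⟨t, ht, rfl⟩)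
      · exact hmW
      · obtain ⟨q, hq, rfl⟩ := Finset.mem_image.1 ht
        have h1 := (Finset.mem_filter.1 hq).1
        have h2 := hW.1 q h1
        rwa [show shiftInterval p (q.1 - p, q.2 - p) = q from
          Prod.ext (by simp only [shiftInterval]; omega) (by simp only [shiftInterval]; omega)]
      · obtain ⟨q, hq, rfl⟩ := Finset.mem_image.1 ht
        obtain ⟨h1, h1'⟩ := Finset.mem_filter.1 hq
        have h2 := hW.1 q h1
        rwa [show shiftInterval s (q.1 - s, q.2 - s) = q from
          Prod.ext (by simp only [shiftInterval]; omega) (by simp only [shiftInterval]; omega)]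
    · intro hq
      have h2 := hW.1 q hq
      by_cases hqm : q = (p, p + s)
      · exact Or.inl hqm
      · rcases hcases q hq hqm with h | h
        · refine Or.inr (Or.inl ⟨_, Finset.mem_image_of_mem _
            (Finset.mem_filter.2 ⟨hq, h, hqm⟩), ?_⟩)
          exact Prod.ext (by simp only [shiftInterval]; omega) (by simp only [shiftInterval]; omega)
        · refine Or.inr (Or.inr ⟨_, Finset.mem_image_of_mem _
            (Finset.mem_filter.2 ⟨hq, h⟩), ?_⟩)
          exact Prod.ext (by simp only [shiftInterval]; omega) (by simp only [shiftInterval]; omega)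

theorem intervalTubings_succ_self (p : ℕ) : intervalTubings (p + 1) p = {∅} := by
  ext T
  rw [mem_intervalTubings, Finset.mem_singleton]
  constructor
  · intro h
    refine Finset.eq_empty_of_forall_notMem fun t ht => ?_
    have := h.1 t ht
    omega
  · rintro rfl
    exact ⟨by simp, by simp⟩

variable {R : Type*} [CommRing R] {Φ Ψ : ℕ → Finset (ℕ × ℕ) → R}

/-- Split according to whether some interval starts at `p`; if one does, the tubing is glued in a
unique way. -/
theorem sum_intervalTubings (hmul : ∀ n p s, 1 ≤ s → p + s ≤ n → ∀ T ∈ properTubings s,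
      ∀ U ∈ intervalTubings (p + 1) (n - s),
        Φ n (glueTubing p s T U) = -(Ψ s T * Φ (n - s) U)) (p n : ℕ) :
    ∑ W ∈ intervalTubings p n, Φ n W = ∑ W ∈ intervalTubings (p + 1) n, Φ n W -
      ∑ s ∈ Finset.Icc 1 (n - p), (∑ T ∈ properTubings s, Ψ s T) *
        ∑ U ∈ intervalTubings (p + 1) (n - s), Φ (n - s) U := by
  have hbij : ∑ W ∈ (intervalTubings p n).filter (fun W => ∃ t ∈ W, t.1 = p), Φ n W =
      ∑ x ∈ (Finset.Icc 1 (n - p)).sigma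
        fun s => properTubings s ×ˢ intervalTubings (p + 1) (n - s),
        -(Ψ x.1 x.2.1 * Φ (n - x.1) x.2.2) := by
    symm
    refine Finset.sum_bij (fun x _ => glueTubing p x.1 x.2.1 x.2.2) ?_ ?_ ?_ ?_
    · rintro ⟨s, T, U⟩ hx
      simp only [Finset.mem_sigma, Finset.mem_product, Finset.mem_Icc] at hx
      obtain ⟨hs, hT, hU⟩ := hx
      exact Finset.mem_filter.2 ⟨mem_intervalTubings.2
        (isIntervalTubing_glueTubing hs.1 (by omega) hT hU), (p, p + s),
        mem_glueTubing.2 (Or.inl rfl), rfl⟩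
    · rintro ⟨s, T, U⟩ hx ⟨s', T', U'⟩ hx' h
      simp only [Finset.mem_sigma, Finset.mem_product, Finset.mem_Icc] at hx hx'
      obtain ⟨rfl, rfl, rfl⟩ := glueTubing_injective hx.2.1 hx.2.2 hx'.2.1 hx'.2.2 h
      rfl
    · intro W hW
      obtain ⟨hW, hp⟩ := Finset.mem_filter.1 hW
      obtain ⟨s, hs, hps, T, hT, U, hU, h⟩ := exists_eq_glueTubing (mem_intervalTubings.1 hW) hp
      refine ⟨⟨s, T, U⟩, ?_, h⟩
      simp only [Finset.mem_sigma, Finset.mem_product, Finset.mem_Icc]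
      exact ⟨⟨hs, by omega⟩, hT, hU⟩
    · rintro ⟨s, T, U⟩ hx
      simp only [Finset.mem_sigma, Finset.mem_product, Finset.mem_Icc] at hx
      exact (hmul n p s hx.1.1 (by omega) T hx.2.1 U hx.2.2).symm
  have hnot : (intervalTubings p n).filter (fun W => ¬ ∃ t ∈ W, t.1 = p) =
      intervalTubings (p + 1) n := by
    ext W
    rw [Finset.mem_filter, mem_intervalTubings, mem_intervalTubings]
    constructor
    · rintro ⟨⟨h1, h2⟩, h3⟩
      refine ⟨fun t ht => ⟨?_, (h1 t ht).2⟩, h2⟩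
      have := (h1 t ht).1
      have : t.1 ≠ p := fun h => h3 ⟨t, ht, h⟩
      omega
    · rintro ⟨h1, h2⟩
      refine ⟨⟨fun t ht => ⟨?_, (h1 t ht).2⟩, h2⟩, ?_⟩
      · have := (h1 t ht).1
        omega
      · rintro ⟨t, ht, h⟩
        have := (h1 t ht).1
        omega
  rw [← Finset.sum_filter_add_sum_filter_not _ (fun W => ∃ t ∈ W, t.1 = p), hnot, hbij,
    Finset.sum_sigma, add_comm, sub_eq_add_neg, ← Finset.sum_neg_distrib]
  congr 1
  refine Finset.sum_congr rfl fun s _ => ?_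
  rw [Finset.sum_mul_sum, Finset.sum_product, ← Finset.sum_neg_distrib]
  simp only [Finset.sum_neg_distrib]

open PowerSeries in
/-- Sums of multiplicative functions over interval tubings. -/
theorem sum_intervalTubings_eq_coeff (hmul : ∀ n p s, 1 ≤ s → p + s ≤ n →
      ∀ T ∈ properTubings s, ∀ U ∈ intervalTubings (p + 1) (n - s),
        Φ n (glueTubing p s T U) = -(Ψ s T * Φ (n - s) U)) (n : ℕ) :
    ∑ W ∈ intervalTubings 0 n, Φ n W = ∑ k ∈ Finset.range (n + 1), Φ k ∅ * coeff n (X ^ k *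
      (1 - X * PowerSeries.mk fun i => ∑ T ∈ properTubings (i + 1), Ψ (i + 1) T) ^ (k + 1)) := by
  set G : PowerSeries R :=
    1 - X * PowerSeries.mk fun i => ∑ T ∈ properTubings (i + 1), Ψ (i + 1) T with hG
  have hG0 : coeff 0 G = 1 := by simp [hG]
  have hGs : ∀ s, 1 ≤ s → coeff s G = -∑ T ∈ properTubings s, Ψ s T := by
    intro s hs
    obtain ⟨k, rfl⟩ : ∃ k, s = k + 1 := ⟨s - 1, by omega⟩
    simp [hG, coeff_succ_X_mul, coeff_one]
  -- The cutoff `p ≤ n` makes `F p` divisible by `X ^ p` and turns the restricted sum over `s` into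
  -- a full convolution with `G`.
  let F : ℕ → PowerSeries R := fun p => PowerSeries.mk fun n =>
    if p ≤ n then ∑ W ∈ intervalTubings (p + 1) n, Φ n W else 0
  have hF : ∀ p n, coeff n (F p) =
      if p ≤ n then ∑ W ∈ intervalTubings (p + 1) n, Φ n W else 0 := fun p n => coeff_mk _ _
  have hrec : ∀ p n, p ≤ n → ∑ W ∈ intervalTubings p n, Φ n W = coeff n (G * F p) := by
    intro p n hpn
    have h1 : ∑ s ∈ Finset.range n, coeff (s + 1) G * coeff (n - (s + 1)) (F p) =
        ∑ s ∈ Finset.range (n - p), coeff (s + 1) G * coeff (n - (s + 1)) (F p) := by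
      refine (Finset.sum_subset (Finset.range_subset_range.2 (Nat.sub_le n p)) ?_).symm
      intro s hs hs'
      rw [Finset.mem_range] at hs hs'
      rw [hF, if_neg (by omega), mul_zero]
    have h2 : Finset.Icc 1 (n - p) = Finset.Ico (0 + 1) (n - p + 1) := by
      ext s
      simp only [Finset.mem_Icc, Finset.mem_Ico]
      omega
    have h3 : ∑ s ∈ Finset.range (n - p), coeff (s + 1) G * coeff (n - (s + 1)) (F p) =
        -∑ s ∈ Finset.Icc 1 (n - p), (∑ T ∈ properTubings s, Ψ s T) *
          ∑ U ∈ intervalTubings (p + 1) (n - s), Φ (n - s) U := by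
      rw [h2, ← Finset.sum_Ico_add', ← Finset.range_eq_Ico, ← Finset.sum_neg_distrib]
      refine Finset.sum_congr rfl fun s hs => ?_
      rw [Finset.mem_range] at hs
      rw [hGs (s + 1) (by omega), hF, if_pos (by omega), neg_mul]
    rw [sum_intervalTubings hmul, coeff_mul, Finset.Nat.sum_antidiagonal_eq_sum_range_succ
      (fun i j => coeff i G * coeff j (F p)), Finset.sum_range_succ', h1, h3, hG0, Nat.sub_zero,
      hF, if_pos hpn, one_mul, neg_add_eq_sub]
  have hF0 : ∀ p n, n < p → coeff n (F p) = 0 := fun p n h => by rw [hF, if_neg (by omega)]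
  have hdvd : ∀ p, X ^ p ∣ F p := fun p => X_pow_dvd_iff.2 (hF0 p)
  have hstep : ∀ p, F p = C (Φ p ∅) * X ^ p + G * F (p + 1) := by
    intro p
    ext n
    rw [map_add, coeff_C_mul, coeff_X_pow, hF]
    rcases lt_trichotomy n p with h | rfl | h
    · rw [if_neg (by omega), if_neg (by omega), X_pow_dvd_iff.1 ((hdvd (p + 1)).mul_left G) n
        (by omega)]
      simp
    · rw [if_pos le_rfl, if_pos rfl, intervalTubings_succ_self, X_pow_dvd_iff.1
        ((hdvd (n + 1)).mul_left G) n (by omega)]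
      simp
    · rw [if_pos h.le, if_neg h.ne', hrec (p + 1) n h]
      simp
  -- Iterating `F p = Φ p ∅ * X ^ p + G * F (p + 1)` leaves a remainder divisible by `X ^ K`, which
  -- does not affect the coefficient of degree `n` once `K = n + 1`.
  have hsum : ∀ K, G * F 0 =
      ∑ k ∈ Finset.range K, C (Φ k ∅) * (X ^ k * G ^ (k + 1)) + G ^ (K + 1) * F K := by
    intro K
    induction K with
    | zero => simp
    | succ K ih =>
      rw [ih, Finset.sum_range_succ, hstep K]
      ring
  rw [hrec 0 n (Nat.zero_le n), hsum (n + 1), map_add, X_pow_dvd_iff.1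
    ((hdvd (n + 1)).mul_left _) n (by omega), add_zero, map_sum]
  exact Finset.sum_congr rfl fun k _ => coeff_C_mul _ _ _

end IntervalTubings

/-! ### Motivic interiors as sums over interval tubings -/

section MotivicSums

theorem card_glueTubing {p s n : ℕ} {T U : Finset (ℕ × ℕ)} (hT : T ∈ properTubings s)
    (hU : U ∈ intervalTubings (p + 1) n) : (glueTubing p s T U).card = T.card + U.card + 1 := by
  rw [mem_properTubings] at hT
  rw [mem_intervalTubings] at hU
  rw [glueTubing, Finset.card_insert_of_notMem, Finset.card_union_of_disjoint,
    Finset.card_image_of_injective _ (shiftInterval_injective p),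
    Finset.card_image_of_injective _ (shiftInterval_injective s)]
  · rw [Finset.disjoint_left]
    intro q hq hq'
    obtain ⟨t, ht, rfl⟩ := Finset.mem_image.1 hq
    obtain ⟨u, hu, h⟩ := Finset.mem_image.1 hq'
    have h1 := hT.1 t ht
    have h2 := hU.1 u hu
    simp only [pathTubes, Set.mem_ofPred_eq] at h1
    simp only [shiftInterval, Prod.mk.injEq] at h
    omega
  · intro hq
    rcases Finset.mem_union.1 hq with hq | hq
    · obtain ⟨t, ht, h⟩ := Finset.mem_image.1 hq
      have h1 := hT.1 t ht
      simp only [pathTubes, Set.mem_ofPred_eq] at h1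
      simp only [shiftInterval, Prod.mk.injEq] at h
      omega
    · obtain ⟨u, hu, h⟩ := Finset.mem_image.1 hq
      have h2 := hU.1 u hu
      simp only [shiftInterval, Prod.mk.injEq] at h
      omega

theorem sum_image_eq {α V M : Type*} [AddCommMonoid M] [DecidableEq V] {G : SimpleGraph V}
    {A : Set α} {r : α → α → Prop} (f : α → Finset V) (hinj : Set.InjOn f A)
    (hr : ∀ a ∈ A, ∀ b ∈ A, r a b ↔ TubeCompat G (f a) (f b)) {𝒯 : Finset (Finset α)}
    (h𝒯 : ∀ T, T ∈ 𝒯 ↔ (∀ t ∈ T, t ∈ A) ∧ (T : Set α).Pairwise r) {𝒮 : Finset (Finset (Finset V))}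
    (h𝒮 : ∀ T, T ∈ 𝒮 ↔ (∀ S ∈ T, S ∈ f '' A) ∧ (T : Set (Finset V)).Pairwise (TubeCompat G))
    (h : Finset (Finset V) → M) : ∑ S ∈ 𝒮, h S = ∑ T ∈ 𝒯, h (T.image f) := by
  symm
  refine Finset.sum_bij (fun T _ => T.image f) ?_ ?_ ?_ fun _ _ => rfl
  · intro T hT
    obtain ⟨hTA, hTr⟩ := (h𝒯 T).1 hT
    refine (h𝒮 _).2 ⟨fun S hS => ?_, ?_⟩
    · obtain ⟨t, ht, rfl⟩ := Finset.mem_image.1 hS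
      exact Set.mem_image_of_mem f (hTA t ht)
    · intro S hS S' hS' hne
      obtain ⟨t, ht, rfl⟩ := Finset.mem_image.1 (Finset.mem_coe.1 hS)
      obtain ⟨t', ht', rfl⟩ := Finset.mem_image.1 (Finset.mem_coe.1 hS')
      exact (hr t (hTA t ht) t' (hTA t' ht')).1 (hTr ht ht' fun h => hne (h ▸ rfl))
  · intro T hT T' hT' heq
    have := congrArg (fun X : Finset (Finset V) => (X : Set (Finset V))) heq
    simp only [Finset.coe_image] at this
    exact Finset.coe_injective ((hinj.image_eq_image_iff ((h𝒯 T).1 hT).1 ((h𝒯 T').1 hT').1).1 this)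
  · intro S hS
    obtain ⟨hSA, hSr⟩ := (h𝒮 S).1 hS
    obtain ⟨T, hTA, rfl⟩ := Finset.subset_set_image_iff.1
      (show (S : Set (Finset V)) ⊆ f '' A from hSA)
    refine ⟨T, (h𝒯 T).2 ⟨hTA, fun t ht t' ht' hne => ?_⟩, rfl⟩
    exact (hr t (hTA ht) t' (hTA ht')).2 (hSr (Finset.mem_coe.2 (Finset.mem_image_of_mem f ht))
      (Finset.mem_coe.2 (Finset.mem_image_of_mem f ht')) (hinj.ne (hTA ht) (hTA ht') hne))

theorem motivicInterior_associahedron (n : ℕ) [NeZero n] :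
    (associahedron n).motivicInterior =
      ∑ T ∈ properTubings n, (-1) ^ T.card * pathClass n T := by
  rw [associahedron, motivicInterior_graphAssociahedron pathGraph_connected,
    sum_image_eq (intervalFinset n) (intervalFinset_injOn_pathTubes n) intervalCompat_iff
      (fun T => mem_properTubings) (fun T => by rw [mem_tubings, image_pathTubes]; rfl)]
  refine Finset.sum_congr rfl fun T hT => ?_
  have hTA := (mem_properTubings.1 hT).1
  rw [pathClass_eq hTA, Finset.card_image_of_injOn ((intervalFinset_injOn_pathTubes n).mono hTA)]

theorem pathClass_empty (n : ℕ) [NeZero n] : pathClass n ∅ = (associahedron n).toRing := by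
  rw [pathClass_eq (by simp), Finset.image_empty, tubingClass_empty pathGraph_connected]
  rfl

theorem cycleClass_empty (N : ℕ) : cycleClass N ∅ = (cyclohedron (N + 1)).toRing := by
  rw [cycleClass_eq (by simp), Finset.image_empty, tubingClass_empty cycleGraph_connected]
  rfl

/-- The summand of a tubing by intervals in the motivic interior of the associahedron. -/
noncomputable def pathTerm (n : ℕ) (T : Finset (ℕ × ℕ)) : PolytopeRing :=
  -- The value `0` on tubings containing the whole path leaves only proper tubings in the sum. The
  -- value `0` at `n = 0` keeps the gluing rule valid when the glued interval is the whole path.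
  if n = 0 ∨ (0, n) ∈ T then 0 else (-1) ^ T.card * pathClass n T

theorem pathTerm_glueTubing (n p s : ℕ) (hs : 1 ≤ s) (hps : p + s ≤ n) (T : Finset (ℕ × ℕ))
    (hT : T ∈ properTubings s) (U : Finset (ℕ × ℕ)) (hU : U ∈ intervalTubings (p + 1) (n - s)) :
    pathTerm n (glueTubing p s T U) =
      -((-1) ^ T.card * pathClass s T * pathTerm (n - s) U) := by
  have hU' := mem_intervalTubings.1 hU
  have hT' := mem_properTubings.1 hT
  rcases (show s ≤ n by omega).lt_or_eq with hsn | rfl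
  · have h1 : ¬ (n - s = 0 ∨ (0, n - s) ∈ U) := by
      rintro (h | h)
      · omega
      · have := (hU'.1 _ h).1
        simp only at this
        omega
    have h2 : ¬ (n = 0 ∨ (0, n) ∈ glueTubing p s T U) := by
      rintro (h | h)
      · omega
      · rcases mem_glueTubing.1 h with h | ⟨t, ht, h⟩ | ⟨u, hu, h⟩
        · simp only [Prod.mk.injEq] at h
          omega
        · have := hT'.1 t ht
          simp only [pathTubes, Set.mem_ofPred_eq] at this
          simp only [shiftInterval, Prod.mk.injEq] at h
          omega
        · have := hU'.1 u hu
          simp only [shiftInterval, Prod.mk.injEq] at h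
          omega
    rw [pathTerm, pathTerm, if_neg h1, if_neg h2, card_glueTubing hT hU, glueTubing,
      pathClass_insert hs hps hsn hT'.1 hT'.2 hU']
    ring
  · obtain rfl : p = 0 := by omega
    rw [pathTerm, pathTerm, if_pos (Or.inr (mem_glueTubing.2 (Or.inl (by simp)))),
      if_pos (Or.inl (by omega)), mul_zero, neg_zero]

theorem sum_pathTerm (n : ℕ) [NeZero n] :
    ∑ T ∈ intervalTubings 0 n, pathTerm n T = (associahedron n).motivicInterior := by
  rw [motivicInterior_associahedron, properTubings, Finset.sum_filter]
  refine Finset.sum_congr rfl fun T _ => ?_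
  rw [pathTerm]
  by_cases h : (0, n) ∈ T
  · rw [if_pos (Or.inr h), if_neg (not_not.2 h)]
  · rw [if_neg (by simp [h, NeZero.ne n]), if_pos h]

/-- The number of the vertices `0, …, N` that lie in no interval of `T`. -/
def uncoveredCard (N : ℕ) (T : Finset (ℕ × ℕ)) : ℕ :=
  ((Finset.range (N + 1)).filter fun x => ∀ t ∈ T, ¬ (t.1 ≤ x ∧ x < t.2)).card

/-- All points of `[p, p + s)` are covered. Deleting them matches the remaining uncovered points
with those of `U`. -/
theorem uncoveredCard_glueTubing {N p s : ℕ} (hps : p + s ≤ N) {T U : Finset (ℕ × ℕ)}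
    (hT : T ∈ properTubings s) (hU : U ∈ intervalTubings (p + 1) (N - s)) :
    uncoveredCard N (glueTubing p s T U) = uncoveredCard (N - s) U := by
  have hT' : ∀ t ∈ T, t.1 < t.2 ∧ t.2 ≤ s := fun t ht =>
    ⟨((mem_properTubings.1 hT).1 t ht).1, ((mem_properTubings.1 hT).1 t ht).2.1⟩
  have hU' := (mem_intervalTubings.1 hU).1
  refine Finset.card_nbij' (fun y => if y < p then y else y - s)
    (fun x => if x < p then x else x + s) ?_ ?_ ?_ ?_
  · intro y hy
    simp only [Finset.coe_filter, Finset.mem_range, Set.mem_ofPred_eq] at hy ⊢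
    obtain ⟨hy1, hy2⟩ := hy
    have hm := hy2 (p, p + s) (mem_glueTubing.2 (Or.inl rfl))
    simp only at hm
    refine ⟨by split_ifs <;> omega, fun u hu h => ?_⟩
    have h1 := hy2 (shiftInterval s u) (mem_glueTubing.2 (Or.inr (Or.inr ⟨u, hu, rfl⟩)))
    have h2 := hU' u hu
    simp only [shiftInterval] at h1
    split_ifs at h <;> omega
  · intro x hx
    simp only [Finset.coe_filter, Finset.mem_range, Set.mem_ofPred_eq] at hx ⊢
    obtain ⟨hx1, hx2⟩ := hx
    refine ⟨by split_ifs <;> omega, fun q hq h => ?_⟩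
    rcases mem_glueTubing.1 hq with rfl | ⟨t, ht, rfl⟩ | ⟨u, hu, rfl⟩
    · simp only at h
      split_ifs at h <;> omega
    · have := hT' t ht
      simp only [shiftInterval] at h
      split_ifs at h <;> omega
    · have h1 := hx2 u hu
      have h2 := hU' u hu
      simp only [shiftInterval] at h
      split_ifs at h <;> omega
  · intro y hy
    simp only [Finset.coe_filter, Finset.mem_range, Set.mem_ofPred_eq] at hy
    have hm := hy.2 (p, p + s) (mem_glueTubing.2 (Or.inl rfl))
    simp only at hm ⊢
    split_ifs <;> omega
  · intro x hx
    simp only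
    split_ifs <;> omega

/-- The summand of a tubing by intervals in the motivic interior of the cyclohedron, weighted by the
number of the uncovered vertices. -/
noncomputable def cycleTerm (N : ℕ) (T : Finset (ℕ × ℕ)) : PolytopeRing :=
  (1 / (uncoveredCard N T : ℚ)) • ((-1) ^ T.card * cycleClass N (T.image Sum.inl))

/-- No exceptional case arises: the last vertex `N` is never absorbed, so even for `s = N` a
one-vertex cycle remains. -/
theorem cycleTerm_glueTubing (N p s : ℕ) (hs : 1 ≤ s) (hps : p + s ≤ N) (T : Finset (ℕ × ℕ))
    (hT : T ∈ properTubings s) (U : Finset (ℕ × ℕ)) (hU : U ∈ intervalTubings (p + 1) (N - s)) :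
    cycleTerm N (glueTubing p s T U) =
      -((-1) ^ T.card * pathClass s T * cycleTerm (N - s) U) := by
  have hT' := mem_properTubings.1 hT
  rw [cycleTerm, cycleTerm, uncoveredCard_glueTubing hps hT hU, card_glueTubing hT hU, glueTubing,
    cycleClass_insert hs hps hT'.1 hT'.2 (mem_intervalTubings.1 hU), mul_smul_comm, ← smul_neg]
  congr 1
  ring

theorem cycleTerm_empty (N : ℕ) :
    cycleTerm N ∅ = (1 / ((N : ℚ) + 1)) • (cyclohedron (N + 1)).toRing := by
  simp [cycleTerm, uncoveredCard, cycleClass_empty]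

end MotivicSums

/-! ### Rotations of the cycle -/

section Rotation

variable {V : Type*} [Fintype V] [DecidableEq V] {G : SimpleGraph V}

theorem IsTube.image (e : G ≃g G) {S : Finset V} (hS : IsTube G S) : IsTube G (S.image e) := by
  obtain ⟨hS, hSu⟩ := hS
  refine ⟨?_, fun h => hSu ?_⟩
  · rw [induce_connected_iff] at hS ⊢
    obtain ⟨⟨x, hx⟩, hS⟩ := hS
    refine ⟨⟨e x, by simpa using hx⟩, ?_⟩
    rintro p ⟨y, hy, hpy⟩ hstep z hz
    rw [Finset.mem_coe, Finset.mem_image] at hy hz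
    obtain ⟨y, hy, rfl⟩ := hy
    obtain ⟨z, hz, rfl⟩ := hz
    exact hS (fun x => p (e x)) ⟨y, hy, hpy⟩ (fun a ha b hb hab => hstep _
      (Finset.mem_coe.2 (Finset.mem_image_of_mem e ha)) _
      (Finset.mem_coe.2 (Finset.mem_image_of_mem e hb)) (e.map_adj_iff.2 hab)) z hz
  · rw [Finset.eq_univ_iff_forall] at h ⊢
    intro x
    obtain ⟨y, hy, hyx⟩ := Finset.mem_image.1 (h (e x))
    exact e.injective hyx ▸ hy

theorem image_image_symm {V : Type*} [DecidableEq V] {G : SimpleGraph V} (e : G ≃g G)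
    (S : Finset V) : (S.image e.symm).image e = S := by
  rw [Finset.image_image, show (e : V → V) ∘ e.symm = id from funext e.apply_symm_apply,
    Finset.image_id]

theorem image_setOf_isTube (e : G ≃g G) :
    (Finset.image e) '' {S | IsTube G S} = {S | IsTube G S} := by
  ext S
  constructor
  · rintro ⟨S, hS, rfl⟩
    exact hS.image e
  · exact fun hS => ⟨S.image e.symm, hS.image e.symm, image_image_symm e S⟩

theorem tubeCompat_image_iff {V : Type*} [DecidableEq V] {G : SimpleGraph V} (e : G ≃g G)
    (S T : Finset V) :
    TubeCompat G S T ↔ TubeCompat G (S.image e) (T.image e) := by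
  rw [TubeCompat, TubeCompat, Finset.image_subset_image_iff e.injective,
    Finset.image_subset_image_iff e.injective]
  refine or_congr_right (or_congr_right ?_)
  simp only [Finset.forall_mem_image, ne_eq, e.injective.eq_iff, e.map_adj_iff]

theorem IsTubing.image (e : G ≃g G) {T : Finset (Finset V)} (hT : IsTubing G T) :
    IsTubing G (T.image (Finset.image e)) :=
  isTubing_image (image_setOf_isTube e) (fun S _ S' _ => tubeCompat_image_iff e S S') hT.1 hT.2

theorem tubingClass_image {n : ℕ} {G : SimpleGraph (Fin n)} (e : G ≃g G)
    {T : Finset (Finset (Fin n))} (hT : IsTubing G T) :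
    tubingClass G (T.image (Finset.image e)) = tubingClass G T := by
  obtain ⟨f⟩ := cliqueStar_image_iso (Finset.image e) (Finset.image_injective e.injective).injOn
    (image_setOf_isTube e) (fun S _ S' _ => tubeCompat_image_iff e S S') T hT.1
  exact (posetClass_congr f.dual).symm

/-- The vertices in no tube of `T`. -/
def uncovered (T : Finset (Finset V)) : Finset V := Finset.univ.filter fun v => ∀ S ∈ T, v ∉ S

theorem mem_uncovered {T : Finset (Finset V)} {v : V} : v ∈ uncovered T ↔ ∀ S ∈ T, v ∉ S := by
  simp [uncovered]

theorem uncovered_image (e : G ≃g G) (T : Finset (Finset V)) :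
    uncovered (T.image (Finset.image e)) = (uncovered T).image e := by
  ext v
  obtain ⟨v, rfl⟩ := e.surjective v
  simp [mem_uncovered, e.injective.eq_iff]

/-- The core of the full vertex set is nonempty and consists of uncovered vertices. This permits
dividing by their number. -/
theorem IsTubing.uncovered_nonempty (hG : G.Connected) {T : Finset (Finset V)}
    (hT : IsTubing G T) : (uncovered T).Nonempty := by
  obtain ⟨v, hv⟩ := hT.core_nonempty hG Finset.univ (Finset.mem_insert_self _ _)
  refine ⟨v, mem_uncovered.2 fun S hS => ?_⟩
  exact (mem_laminarCore.1 hv).2 S (Finset.mem_insert_of_mem hS)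
    (Finset.ssubset_univ_iff.2 (hT.1 S hS).2)

/-- The rotation of the cycle by `d`. -/
def rotation {n : ℕ} (d : Fin (n + 1)) :
    SimpleGraph.cycleGraph (n + 1) ≃g SimpleGraph.cycleGraph (n + 1) where
  toEquiv := Equiv.addRight d
  map_rel_iff' := by
    intro u v
    simp [SimpleGraph.cycleGraph_adj']

/-- Double counting of pairs of a tubing and one of its uncovered vertices, each with weight `1 /
|uncovered T|`: by rotation invariance all `N + 1` vertices contribute equally. -/
theorem sum_tubings_cycleGraph {N : ℕ} (h : Finset (Finset (Fin (N + 1))) → PolytopeRing)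
    (hrot : ∀ d, ∀ T ∈ tubings (SimpleGraph.cycleGraph (N + 1)),
      h (T.image (Finset.image (rotation d))) = h T) :
    ∑ T ∈ tubings (SimpleGraph.cycleGraph (N + 1)), h T = ((N : ℚ) + 1) •
      ∑ T ∈ (tubings (SimpleGraph.cycleGraph (N + 1))).filter fun T => Fin.last N ∈ uncovered T,
        (1 / ((uncovered T).card : ℚ)) • h T := by
  set C := SimpleGraph.cycleGraph (N + 1)
  have h1 : ∀ T ∈ tubings C, h T = ∑ v ∈ uncovered T, (1 / ((uncovered T).card : ℚ)) • h T := by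
    intro T hT
    have hne : ((uncovered T).card : ℚ) ≠ 0 := by
      exact_mod_cast (Finset.card_pos.2
        ((mem_tubings.1 hT).uncovered_nonempty cycleGraph_connected)).ne'
    rw [Finset.sum_const, ← Nat.cast_smul_eq_nsmul ℚ, smul_smul, mul_one_div_cancel hne, one_smul]
  have h2 : ∀ v : Fin (N + 1), ∑ T ∈ (tubings C).filter (fun T => v ∈ uncovered T),
      (1 / ((uncovered T).card : ℚ)) • h T =
      ∑ T ∈ (tubings C).filter (fun T => Fin.last N ∈ uncovered T),
        (1 / ((uncovered T).card : ℚ)) • h T := by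
    intro v
    have hmem : ∀ d u : Fin (N + 1), ∀ T ∈ (tubings C).filter (fun T => u ∈ uncovered T),
        T.image (Finset.image (rotation d)) ∈
          (tubings C).filter (fun T => u + d ∈ uncovered T) := by
      intro d u T hT
      obtain ⟨hT, hu⟩ := Finset.mem_filter.1 hT
      refine Finset.mem_filter.2 ⟨mem_tubings.2 ((mem_tubings.1 hT).image _), ?_⟩
      rw [uncovered_image]
      exact Finset.mem_image_of_mem (rotation d) hu
    have hinv : ∀ d d' : Fin (N + 1), d + d' = 0 → ∀ T : Finset (Finset (Fin (N + 1))),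
        (T.image (Finset.image (rotation d))).image (Finset.image (rotation d')) = T := by
      intro d d' hd T
      have h1 : Finset.image (rotation d' : Fin (N + 1) → Fin (N + 1)) ∘
          Finset.image (rotation d) = id := by
        funext S
        rw [Function.comp, Finset.image_image,
          show (rotation d' : Fin (N + 1) → Fin (N + 1)) ∘ rotation d = id from funext fun x => by
            change x + d + d' = x
            rw [add_assoc, hd, add_zero], Finset.image_id, id]
      rw [Finset.image_image, h1, Finset.image_id]
    refine Finset.sum_nbij' (fun T => T.image (Finset.image (rotation (Fin.last N - v))))
      (fun T => T.image (Finset.image (rotation (v - Fin.last N)))) ?_ ?_ ?_ ?_ ?_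
    · intro T hT
      have := hmem (Fin.last N - v) v T hT
      rwa [add_sub_cancel] at this
    · intro T hT
      have := hmem (v - Fin.last N) (Fin.last N) T hT
      rwa [add_sub_cancel] at this
    · exact fun T _ => hinv _ _ (by simp) T
    · exact fun T _ => hinv _ _ (by simp) T
    · intro T hT
      rw [hrot _ T (Finset.mem_filter.1 hT).1, uncovered_image,
        Finset.card_image_of_injective _ (rotation _).injective]
  calc ∑ T ∈ tubings C, h T
      = ∑ T ∈ tubings C, ∑ v, if v ∈ uncovered T then (1 / ((uncovered T).card : ℚ)) • h T
          else 0 := by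
        refine Finset.sum_congr rfl fun T hT => ?_
        rw [← Finset.sum_filter, Finset.filter_univ_mem]
        exact h1 T hT
    _ = ∑ v : Fin (N + 1), ∑ T ∈ (tubings C).filter (fun T => Fin.last N ∈ uncovered T),
          (1 / ((uncovered T).card : ℚ)) • h T := by
        rw [Finset.sum_comm]
        refine Finset.sum_congr rfl fun v _ => ?_
        rw [← Finset.sum_filter, h2]
    _ = _ := by
        rw [Finset.sum_const, Finset.card_univ, Fintype.card_fin, ← Nat.cast_smul_eq_nsmul ℚ]
        push_cast
        rfl

theorem uncovered_card_image {N : ℕ} (T : Finset (ℕ × ℕ)) :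
    (uncovered (T.image (intervalFinset (N + 1)))).card = uncoveredCard N T := by
  rw [uncoveredCard, ← Finset.card_map Fin.valEmbedding]
  congr 1
  ext x
  simp only [Finset.mem_map, mem_uncovered, Finset.forall_mem_image, mem_intervalFinset,
    Finset.mem_filter, Finset.mem_range, Fin.valEmbedding_apply]
  constructor
  · rintro ⟨x, h, rfl⟩
    exact ⟨x.2, fun t ht => h ht⟩
  · rintro ⟨hx, h⟩
    exact ⟨⟨x, hx⟩, fun t ht => h t ht, rfl⟩

/-- Once the last vertex is uncovered, no tube is the complement of an interval, so exactly the
interval tubings of `[0, N)` remain, the full interval `[0, N)` being a legitimate tube. -/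
theorem motivicInterior_cyclohedron (N : ℕ) :
    (cyclohedron (N + 1)).motivicInterior =
      ((N : ℚ) + 1) • ∑ T ∈ intervalTubings 0 N, cycleTerm N T := by
  set C := SimpleGraph.cycleGraph (N + 1) with hC
  have hA : ∀ t : ℕ × ℕ, t ∈ {t : ℕ × ℕ | t.1 < t.2 ∧ t.2 ≤ N} → Sum.inl t ∈ cycleTubes N :=
    fun t ht => ht
  have hinj : Set.InjOn (intervalFinset (N + 1)) {t : ℕ × ℕ | t.1 < t.2 ∧ t.2 ≤ N} :=
    fun t ht u hu h => Sum.inl_injective (arcFinset_injOn N (hA t ht) (hA u hu) h)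
  rw [cyclohedron, motivicInterior_graphAssociahedron cycleGraph_connected,
    sum_tubings_cycleGraph, sum_image_eq (G := C) (intervalFinset (N + 1)) hinj
      (fun t ht u hu => arcCompat_iff (Sum.inl t) (hA t ht) (Sum.inl u) (hA u hu))
      (𝒯 := intervalTubings 0 N)]
  · congr 1
    refine Finset.sum_congr rfl fun T hT => ?_
    have hTA := mem_intervalTubings.1 hT
    have hTA' : ∀ t ∈ T.image (Sum.inl (β := ℕ × ℕ)), t ∈ cycleTubes N := fun t ht => by
      obtain ⟨u, hu, rfl⟩ := Finset.mem_image.1 ht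
      exact (hTA.1 u hu).2
    rw [cycleTerm, cycleClass_eq hTA', Finset.image_image, uncovered_card_image,
      Finset.card_image_of_injOn (hinj.mono fun t ht => (hTA.1 t ht).2)]
    rfl
  · intro T
    rw [mem_intervalTubings]
    exact ⟨fun h => ⟨fun t ht => (h.1 t ht).2, h.2⟩,
      fun h => ⟨fun t ht => ⟨Nat.zero_le _, h.1 t ht⟩, h.2⟩⟩
  · intro T
    rw [Finset.mem_filter, mem_tubings, mem_uncovered, IsTubing, ← image_cycleTubes]
    constructor
    · rintro ⟨⟨h1, h2⟩, h3⟩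
      refine ⟨fun S hS => ?_, h2⟩
      obtain ⟨t | t, ht, rfl⟩ := h1 S hS
      · exact ⟨t, ht, rfl⟩
      · exact absurd (Finset.mem_compl.2 (last_notMem_intervalFinset ht.2)) (h3 _ hS)
    · rintro ⟨h1, h2⟩
      refine ⟨⟨fun S hS => ?_, h2⟩, fun S hS => ?_⟩
      · obtain ⟨t, ht, rfl⟩ := h1 S hS
        exact ⟨Sum.inl t, ht, rfl⟩
      · obtain ⟨t, ht, rfl⟩ := h1 S hS
        exact last_notMem_intervalFinset ht.2
  · intro d T hT
    rw [tubingClass_image _ (mem_tubings.1 hT), Finset.card_image_of_injective _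
      (Finset.image_injective (rotation d).injective)]

end Rotation

/-! ### Generating series -/

section Series

open PowerSeries

variable {R : Type*} [CommRing R]

theorem coeff_subst_eq_sum {b f : PowerSeries R} (hb : HasSubst b) (hX : X ∣ b) (n : ℕ) :
    coeff n (f.subst b) = ∑ d ∈ Finset.range (n + 1), coeff d f * coeff n (b ^ d) := by
  rw [coeff_subst' hb, finsum_eq_sum_of_support_subset]
  · rfl
  · intro d hd
    rw [Finset.coe_range, Set.mem_Iio]
    by_contra h
    exact hd (by
      simp only [X_pow_dvd_iff.1 (pow_dvd_pow_of_dvd hX d) n (by omega), smul_zero])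

/-- Substitution of a series with linear coefficient `1` is injective. -/
theorem eq_zero_of_subst_eq_zero {b f : PowerSeries R} (hb : HasSubst b) {g : PowerSeries R}
    (hbg : b = X * g) (hg : constantCoeff g = 1) (h : f.subst b = 0) : f = 0 := by
  ext n
  induction n using Nat.strong_induction_on with
  | _ n ih =>
    have h1 := coeff_subst_eq_sum (f := f) hb ⟨g, hbg⟩ n
    -- Once the lower coefficients of `f` vanish, only `d = n` contributes, and the leading
    -- coefficient of `b ^ n` is `1`.
    have h2 : coeff n (b ^ n) = 1 := by
      have := coeff_X_pow_mul (g ^ n) n 0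
      rwa [zero_add, ← mul_pow, ← hbg, coeff_zero_eq_constantCoeff_apply,
        map_pow constantCoeff, hg, one_pow] at this
    rw [h, map_zero, Finset.sum_range_succ, Finset.sum_eq_zero, zero_add, h2, mul_one] at h1
    · rw [← h1, map_zero]
    · intro d hd
      rw [ih d (Finset.mem_range.1 hd), map_zero, zero_mul]

/-- Substituting `b` into `b(a(x)) - x` gives `b(a(b(x))) - b(x) = 0`, and substitution of `b` is
injective. -/
theorem subst_eq_X_of_subst_eq_X {a b g : PowerSeries R} (ha : HasSubst a) (hb : HasSubst b)
    (hbg : b = X * g) (hg : constantCoeff g = 1) (h : a.subst b = X) : b.subst a = X := by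
  have h1 : (PowerSeries.subst a b - X : PowerSeries R).subst b = 0 := by
    rw [subst_sub hb, subst_comp_subst_apply ha hb, h, X_subst, subst_X hb, sub_self]
  exact sub_eq_zero.1 (eq_zero_of_subst_eq_zero hb hbg hg h1)

theorem betaSeries_eq : betaSeries = X * (1 - X * PowerSeries.mk fun i =>
    ∑ T ∈ properTubings (i + 1), (-1) ^ T.card * pathClass (i + 1) T) := by
  simp only [← motivicInterior_associahedron]
  rw [betaSeries]
  ring

theorem coeff_betaSeries_pow (m k : ℕ) : coeff (m + 1) (betaSeries ^ (k + 1)) =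
    coeff m (X ^ k * (1 - X * PowerSeries.mk fun i =>
      ∑ T ∈ properTubings (i + 1), (-1) ^ T.card * pathClass (i + 1) T) ^ (k + 1)) := by
  rw [betaSeries_eq, mul_pow, pow_succ' X, mul_assoc, coeff_succ_X_mul]

/-- Write `α(β) = β + ∑ 𝔞ₖ βᵏ⁺¹`. The recursion with `pathTerm` evaluates the second sum as `∑ 𝔞ₙ°
xⁿ⁺¹`, which cancels the correction in `β`. -/
theorem subst_betaSeries_alphaSeries : alphaSeries.subst betaSeries = (X : PowerSeries _) := by
  have hcoeff : ∀ k, coeff (k + 1) alphaSeries = (if k = 0 then 1 else 0) + pathTerm k ∅ := by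
    intro k
    rw [alphaSeries, map_add, coeff_X, pow_two, mul_assoc, coeff_succ_X_mul]
    cases k with
    | zero => simp [pathTerm]
    | succ k => simp [coeff_succ_X_mul, pathTerm, pathClass_empty]
  ext n
  rw [coeff_subst_eq_sum hasSubst_betaSeries ⟨_, betaSeries_eq⟩]
  cases n with
  | zero => simp [alphaSeries]
  | succ m =>
    rw [Finset.sum_range_succ']
    simp only [hcoeff, coeff_betaSeries_pow, add_mul, Finset.sum_add_distrib, ite_mul, one_mul,
      zero_mul]
    rw [← sum_intervalTubings_eq_coeff pathTerm_glueTubing, Finset.sum_ite_eq' (Finset.range (m + 1)) 0,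
      if_pos (by simp)]
    cases m with
    | zero => simp [pathTerm, alphaSeries]
    | succ m =>
      rw [sum_pathTerm, motivicInterior_associahedron]
      simp [coeff_succ_X_mul, coeff_X, coeff_one, alphaSeries]

/-- The factor `N + 1` from rotation cancels the denominator in `W°`, while the weight of the empty
tubing supplies the denominators of `W`. -/
theorem cycloInteriorSeries_eq : cycloInteriorSeries = cycloSeries.subst betaSeries := by
  ext n
  rw [coeff_subst_eq_sum hasSubst_betaSeries ⟨_, betaSeries_eq⟩]
  cases n with
  | zero => simp [cycloInteriorSeries, cycloSeries]
  | succ N =>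
    have hcoeff : ∀ k, coeff (k + 1) cycloSeries = cycleTerm k ∅ := by
      intro k
      rw [cycloSeries, coeff_succ_X_mul, coeff_mk, cycleTerm_empty]
    rw [Finset.sum_range_succ']
    simp only [hcoeff, coeff_betaSeries_pow]
    rw [← sum_intervalTubings_eq_coeff cycleTerm_glueTubing, cycloInteriorSeries,
      coeff_succ_X_mul, coeff_mk, motivicInterior_cyclohedron, smul_smul, one_div_mul_cancel
        (by positivity), one_smul]
    simp [cycloSeries]

end Series

end PolytopeAlgebra

/-- `β` is the compositional inverse of the associahedral series `α`, and the generating series of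
the motivic interiors of the cyclohedra is `W°(x) = W(β(x))`. -/
theorem theorem6p1 :
    PowerSeries.subst PolytopeAlgebra.betaSeries PolytopeAlgebra.alphaSeries
        = (PowerSeries.X : PowerSeries PolytopeAlgebra.PolytopeRing) ∧
      PowerSeries.subst PolytopeAlgebra.alphaSeries PolytopeAlgebra.betaSeries
        = (PowerSeries.X : PowerSeries PolytopeAlgebra.PolytopeRing) ∧
      PolytopeAlgebra.cycloInteriorSeries
        = PowerSeries.subst PolytopeAlgebra.betaSeries PolytopeAlgebra.cycloSeries := by
  refine ⟨PolytopeAlgebra.subst_betaSeries_alphaSeries, ?_,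
    PolytopeAlgebra.cycloInteriorSeries_eq⟩
  exact PolytopeAlgebra.subst_eq_X_of_subst_eq_X PolytopeAlgebra.hasSubst_alphaSeries
    PolytopeAlgebra.hasSubst_betaSeries PolytopeAlgebra.betaSeries_eq (by simp)
    PolytopeAlgebra.subst_betaSeries_alphaSeries
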